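/- All graphs are finite and simple, with labelled vertices. Let $k\ge 1$ be an integer. A coloured graph $G$ is a graph in which each vertex $v$ has a set of colours $\mathrm{Col}(v)\subseteq[k]$; a vertex is coloured if this set is non-empty. A graph is series-parallel if it has no $K_4$ minor, and biconnected if it is 2-connected or isomorphic to $K_2$. *The class $\mathcal B_k$.* Let $G$ be a coloured graph with one pointed vertex $r$, its root. A colour $c$ is good for $G$ if the graph obtained from $G$ by adding a new vertex connected to $r$ and to every vertex that has colour $c$ is series-parallel. For a set $C$ of colours, $G$ is a $C$-tree if $C$ is the set of all colours of $G$ and (a) each $c\in C$ is good for $G$; (b) $G$ is connected and has no cut vertex $x$ such that $G-x$ has a component without colours and without $r$; (c) $r$ is not coloured, is not a cut vertex of $G$, and is not the only vertex of $G$. Let $\mathcal B_k$ be the class of biconnected $[k]$-trees in which each vertex has at most one colour. *Networks.* An SP-network is a connected graph with two distinct distinguished vertices, the source $s$ and the sink $t$ (its poles), such that adding an edge $st$ yields a 2-connected series-parallel multigraph (so a single edge $st$ is an SP-network). Let $\mathcal D$ be the class of all SP-networks, $\mathcal E_2$ the class of networks that consist of the single edge $st$, $\mathcal S$ the class of SP-networks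 that are a series composition of two SP-networks (one from $s$ to $z$ and one from $z$ to $t$, having only the vertex $z$ in common), and $\mathcal P$ the class of SP-networks that are a parallel composition of at least two networks from $\mathcal S\cup\mathcal E_2$, at most one of them in $\mathcal E_2$ (all with source $s$ and sink $t$, pairwise having only $s$ and $t$ in common). *The class $\mathcal F'_k$.* Let $\mathcal T'_k$ be the class of coloured trees with exactly $k$ coloured vertices $v_1,\dots,v_k$, where $v_i$ has colour set $\{i\}$, in which each uncoloured vertex has degree at least $3$. Let $\mathcal F'_k$ be the class of all pointed coloured graphs that can be obtained by taking a tree $T\in\mathcal T'_k$, subdividing its edges arbitrarily by new uncoloured vertices to get a tree $T'$, and adding a new uncoloured root $r$ that is connected to every leaf of $T'$ and to every uncoloured vertex of degree $2$ of $T'$, while each remaining vertex of $T'$ may or may not be connected to $r$. (The vertex of a one-vertex tree is regarded as a leaf.) *Substitution.* For a class $\mathcal N\subseteq\mathcal D$ closed under interchanging source and sink, let $\mathcal F'_k(\cdot,\mathcal N)$ be the class of graphs that can be obtained from a graph $H\in\mathcal F'_k$ by replacing each edge $e=xy$ of $H$ by a network $D_e\in\mathcal N$ with poles $x$ and $y$,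 where the internal (non-pole) vertices of the networks are new, uncoloured, and distinct for distinct edges; the root and the colours of the vertices of $H$ are kept. **Theorem.** If $k\ge 2$, then $$\mathcal B_k=\mathcal F'_k(\cdot,\mathcal D),$$ and each graph in $\mathcal B_k$ is obtained from exactly one pair $(H,(D_e)_{e\in E(H)})$ with $H\in\mathcal F'_k$ and networks $D_e\in\mathcal D$. For $k=1$, $$\mathcal B_1=\mathcal F'_1(\cdot,\mathcal P+\mathcal E_2)=\mathcal Z\times(\mathcal P+\mathcal E_2),$$ where again each graph in $\mathcal B_1$ is obtained from exactly one pair $(H,(D_e)_{e\in E(H)})$ with $H\in\mathcal F'_1$ and networks $D_e\in\mathcal P\cup\mathcal E_2$; the last equality means that a coloured graph $G$ with root $r$ is in $\mathcal B_1$ if and only if it has a (unique) vertex $v$ such that $v$ has colour set $\{1\}$, no other vertex is coloured, and $G$, with its colours removed, is a network in $\mathcal P\cup\mathcal E_2$ with source $r$ and sink $v$. -/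

import Mathlib

namespace SPBlocks

/-! ### Minors, biconnectivity -/

/-- `H` is a minor of `G`: there are pairwise disjoint connected branch sets in `G`, one for each
vertex of `H`, with an edge of `G` between the branch sets of adjacent vertices of `H`. -/
def IsMinor {W U : Type*} (H : SimpleGraph W) (G : SimpleGraph U) : Prop :=
  ∃ bag : W → Set U,
    (∀ w, (G.induce (bag w)).Connected) ∧
    (∀ w w', w ≠ w' → Disjoint (bag w) (bag w')) ∧
    (∀ w w', H.Adj w w' → ∃ x ∈ bag w, ∃ y ∈ bag w', G.Adj x y)

/-- `G` is series-parallel: it has no `K₄` minor. -/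
def IsSeriesParallel {U : Type*} (G : SimpleGraph U) : Prop :=
  ¬ IsMinor (⊤ : SimpleGraph (Fin 4)) G

/-- `x` is a cut vertex of the (connected) graph `G`: the graph `G - x` is disconnected. -/
def IsCutVertex {U : Type*} (G : SimpleGraph U) (x : U) : Prop :=
  ¬ (G.induce {x}ᶜ).Preconnected

/-- Biconnected graphs: `K₂` and the 2-connected graphs. -/
def IsBiconnected {U : Type*} (G : SimpleGraph U) : Prop :=
  Nontrivial U ∧ G.Connected ∧ ∀ x, ¬ IsCutVertex G x

/-! ### Labelled graphs and coloured pointed graphs -/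

/-- Graphs whose vertex set is a subset of the set `V` of labels. -/
abbrev LGraph (V : Type*) := (⊤ : SimpleGraph V).Subgraph

/-- A finite `{0,1}^k`-coloured graph with vertices in `V` and with one pointed vertex, its root.
The set of colours of the vertex `v` is `col v`. The colours `1, …, k` are the elements
of `Fin k`. -/
@[ext]
structure ColGraph (k : ℕ) (V : Type*) where
  graph : LGraph V
  root : V
  col : V → Finset (Fin k)
  finite : graph.verts.Finite
  root_mem : root ∈ graph.verts
  col_eq_empty : ∀ v, v ∉ graph.verts → col v = ∅

namespace ColGraph

variable {k : ℕ} {V : Type*}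

/-- The (uncoloured) graph obtained from `G` by adding a new vertex `w` (here `none`), connected
to the root and to each vertex that has colour `c`. -/
def addApex (G : ColGraph k V) (c : Fin k) : SimpleGraph (Option G.graph.verts) :=
  SimpleGraph.fromRel fun a b =>
    match a, b with
    | some u, some v => G.graph.Adj u v
    | none, some v => (v : V) = G.root ∨ c ∈ G.col v
    | _, none => False

/-- The colour `c` is good for `G`. -/
def IsGood (G : ColGraph k V) (c : Fin k) : Prop :=
  IsSeriesParallel (G.addApex c)

/-- `G` is a `C`-tree, for a set `C` of colours. -/
structure IsCTree (G : ColGraph k V) (C : Set (Fin k)) : Prop where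
  /-- `C` is the set of all colours of `G`. -/
  colours : {c | ∃ v ∈ G.graph.verts, c ∈ G.col v} = C
  good : ∀ c ∈ C, G.IsGood c
  connected : G.graph.coe.Connected
  /-- No cut vertex `x` is such that `G - x` has a component without colours and without the
  root. -/
  components : ∀ x : G.graph.verts, IsCutVertex G.graph.coe x →
    ∀ K : (G.graph.coe.induce {x}ᶜ).ConnectedComponent,
      ∃ v ∈ K.supp, ((v : G.graph.verts) : V) = G.root ∨ (G.col (v : G.graph.verts)).Nonempty
  root_uncoloured : G.col G.root = ∅
  root_not_cut : ¬ IsCutVertex G.graph.coe ⟨G.root, G.root_mem⟩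
  root_not_only : ∃ v ∈ G.graph.verts, v ≠ G.root

end ColGraph

/-- The class `ℬ_k` of biconnected `[k]`-trees in which each vertex has at most one colour
(with vertices in `V`). -/
def blocks (k : ℕ) (V : Type*) : Set (ColGraph k V) :=
  {G | G.IsCTree Set.univ ∧ IsBiconnected G.graph.coe ∧ ∀ v, (G.col v).card ≤ 1}

/-! ### Series-parallel networks

A network is represented together with its poles: it is a graph `D` with two distinguished
vertices, the source `s` and the sink `t`. -/

section Networks

variable {V : Type*}

/-- The graph with the two vertices `s` and `t`, joined by an edge. -/
def edgeGraph (s t : V) (h : s ≠ t) : LGraph V :=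
  SimpleGraph.subgraphOfAdj ⊤ ((SimpleGraph.top_adj s t).2 h)

/-- `D` is an SP-network with source `s` and sink `t`: it is connected, and adding the edge `st`
makes it 2-connected (where the double edge that arises from `K₂` counts as 2-connected) and
series-parallel. -/
def IsSPNetwork (D : LGraph V) (s t : V) : Prop :=
  D.verts.Finite ∧ s ∈ D.verts ∧ t ∈ D.verts ∧ D.coe.Connected ∧
    ∃ h : s ≠ t, IsBiconnected (D ⊔ edgeGraph s t h).coe ∧
      IsSeriesParallel (D ⊔ edgeGraph s t h).coe

/-- The class `ℰ₂`: a single edge between the source and the sink. -/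
def IsEdgeNetwork (D : LGraph V) (s t : V) : Prop :=
  ∃ h : s ≠ t, D = edgeGraph s t h

/-- The class `𝒮` of series SP-networks: those that are composed of a network from `s` to `z` and a
network from `z` to `t`, having only the vertex `z` in common. -/
def IsSeriesNetwork (D : LGraph V) (s t : V) : Prop :=
  IsSPNetwork D s t ∧ ∃ (z : V) (D₁ D₂ : LGraph V), IsSPNetwork D₁ s z ∧ IsSPNetwork D₂ z t ∧
    D₁.verts ∩ D₂.verts = {z} ∧ D = D₁ ⊔ D₂

/-- The class `𝒫` of parallel SP-networks: those that are composed of two or more distinct networks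
in `𝒮 ∪ ℰ₂` with the same source and sink, having only their poles in common. (At most one of them
is the edge `st`, since they are distinct.) -/
def IsParallelNetwork (D : LGraph V) (s t : V) : Prop :=
  IsSPNetwork D s t ∧ ∃ P : Set (LGraph V), P.Nontrivial ∧
    (∀ S ∈ P, IsSeriesNetwork S s t ∨ IsEdgeNetwork S s t) ∧
    (P.Pairwise fun A B => A.verts ∩ B.verts = {s, t}) ∧ D = sSup P

/-- The class `𝒫 + ℰ₂`. -/
def IsParallelOrEdge (D : LGraph V) (s t : V) : Prop :=
  IsParallelNetwork D s t ∨ IsEdgeNetwork D s t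

/-! Each of these classes is closed under interchanging source and sink. -/

theorem edgeGraph_symm (s t : V) (h : s ≠ t) : edgeGraph s t h = edgeGraph t s h.symm := by
  ext a b
  · simp [edgeGraph, or_comm]
  · simp only [edgeGraph, SimpleGraph.subgraphOfAdj_adj, Sym2.eq_swap (a := s)]

theorem IsSPNetwork.symm {D : LGraph V} {s t : V} (hD : IsSPNetwork D s t) :
    IsSPNetwork D t s := by
  obtain ⟨hf, hs, ht, hc, h, hb, hp⟩ := hD
  rw [edgeGraph_symm] at hb hp
  exact ⟨hf, ht, hs, hc, h.symm, hb, hp⟩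

theorem IsEdgeNetwork.symm {D : LGraph V} {s t : V} (hD : IsEdgeNetwork D s t) :
    IsEdgeNetwork D t s := by
  obtain ⟨h, rfl⟩ := hD
  exact ⟨h.symm, edgeGraph_symm s t h⟩

theorem IsSeriesNetwork.symm {D : LGraph V} {s t : V} (hD : IsSeriesNetwork D s t) :
    IsSeriesNetwork D t s := by
  obtain ⟨hD, z, D₁, D₂, h₁, h₂, hi, hu⟩ := hD
  exact ⟨hD.symm, z, D₂, D₁, h₂.symm, h₁.symm, by rw [Set.inter_comm, hi], by rw [hu, sup_comm]⟩

theorem IsParallelNetwork.symm {D : LGraph V} {s t : V} (hD : IsParallelNetwork D s t) :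
    IsParallelNetwork D t s := by
  obtain ⟨hD, P, hn, hP, hi, hu⟩ := hD
  refine ⟨hD.symm, P, hn, fun S hS => (hP S hS).imp (·.symm) (·.symm), ?_, hu⟩
  intro A hA B hB hAB
  exact (hi hA hB hAB).trans (Set.pair_comm s t)

theorem IsParallelOrEdge.symm {D : LGraph V} {s t : V} (hD : IsParallelOrEdge D s t) :
    IsParallelOrEdge D t s :=
  Or.imp (·.symm) (·.symm) hD

end Networks

/-! ### The trees `𝒯'_k`, their subdivisions, and the graphs `ℱ'_k` -/

section Trees

variable {k : ℕ} {V : Type*}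

/-- `T`, with the colours `col`, is in the class `𝒯'_k`: it is a finite tree with exactly `k`
coloured vertices `v₁, …, v_k`, where `v_i` has colour `{i}`, and each uncoloured vertex has degree
at least 3. -/
def IsColouredTree (T : LGraph V) (col : V → Finset (Fin k)) : Prop :=
  T.verts.Finite ∧ T.coe.IsTree ∧
    (∃ v : Fin k → V, (∀ i, v i ∈ T.verts ∧ col (v i) = {i}) ∧
      ∀ u ∈ T.verts, (col u).Nonempty → ∃ i, u = v i) ∧
    ∀ u ∈ T.verts, col u = ∅ → 3 ≤ (T.neighborSet u).ncard

/-- `IsSubdivision col T T'`: the graph `T'` can be obtained from `T` by repeatedly subdividing an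
edge `xy` with a new uncoloured vertex `z`. -/
inductive IsSubdivision (col : V → Finset (Fin k)) (T : LGraph V) : LGraph V → Prop
  | refl : IsSubdivision col T T
  | step {T₁ T₂ : LGraph V} {x y z : V} : IsSubdivision col T T₁ → T₁.Adj x y → z ∉ T₁.verts →
      col z = ∅ → T₂.verts = insert z T₁.verts →
      (∀ a b, T₂.Adj a b ↔
        (T₁.Adj a b ∧ s(a, b) ≠ s(x, y)) ∨ s(a, b) = s(x, z) ∨ s(a, b) = s(z, y)) →
      IsSubdivision col T T₂

/-- The class `ℱ'_k`: take a subdivision `T'` of a tree in `𝒯'_k` and add an uncoloured root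
that is connected to each leaf of `T'`, to each uncoloured vertex of degree 2 of `T'`,
and to any set of further vertices of `T'`. The vertex of a one-vertex tree is a leaf. -/
def apexTrees (k : ℕ) (V : Type*) : Set (ColGraph k V) :=
  {H | ∃ T T' : LGraph V, IsColouredTree T H.col ∧ IsSubdivision H.col T T' ∧
    H.root ∉ T'.verts ∧ H.col H.root = ∅ ∧
    H.graph.verts = insert H.root T'.verts ∧
    (∀ u ∈ T'.verts, ∀ v ∈ T'.verts, H.graph.Adj u v ↔ T'.Adj u v) ∧
    ∀ v ∈ T'.verts,
      (T'.neighborSet v).ncard ≤ 1 ∨ (H.col v = ∅ ∧ (T'.neighborSet v).ncard = 2) →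
        H.graph.Adj H.root v}

/-! ### Substituting networks for edges -/

/-- A coloured pointed graph `H` together with a graph `D_e` for each edge `e` of `H`. -/
abbrev EdgeFamily (k : ℕ) (V : Type*) :=
  Σ H : ColGraph k V, (H.graph.edgeSet → LGraph V)

/-- `(H, D)` is admissible for the class `𝒩` of networks if, for each edge `e = xy` of `H`, the
graph `D_e` is a network in `𝒩` with poles `x` and `y`, and the internal vertices of the networks
are new vertices, distinct for distinct edges. -/
def IsAdmissible (𝒩 : LGraph V → V → V → Prop) (p : EdgeFamily k V) : Prop :=
  (∀ (x y : V) (h : p.1.graph.Adj x y),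
    𝒩 (p.2 ⟨s(x, y), h⟩) x y ∧ (p.2 ⟨s(x, y), h⟩).verts ∩ p.1.graph.verts = {x, y}) ∧
  ∀ e e' : p.1.graph.edgeSet, e ≠ e' → (p.2 e).verts ∩ (p.2 e').verts ⊆ p.1.graph.verts

/-- The pairs `(H, D)`, where `H` is in `ℱ'_k` and `D` is a family of networks in `𝒩` that can be
substituted for the edges of `H`. -/
def apexTreeFamilies (k : ℕ) (V : Type*) (𝒩 : LGraph V → V → V → Prop) : Set (EdgeFamily k V) :=
  {p | p.1 ∈ apexTrees k V ∧ IsAdmissible 𝒩 p}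

/-- `IsSubstitution p G`, for `p = (H, D)`: the graph `G` is obtained from `H` by replacing each
edge `e` by `D_e`. The root and the coloured vertices are those of `H`, with the same colours. -/
structure IsSubstitution (p : EdgeFamily k V) (G : ColGraph k V) : Prop where
  verts : G.graph.verts = p.1.graph.verts ∪ ⋃ e, (p.2 e).verts
  adj : ∀ a b, G.graph.Adj a b ↔ ∃ e, (p.2 e).Adj a b
  root : G.root = p.1.root
  col : G.col = p.1.col

/-- The class `ℱ'_k(·, 𝒩)` of the graphs that can be obtained from graphs in `ℱ'_k` by replacing
their edges by networks in `𝒩`. -/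
def substituted (k : ℕ) (V : Type*) (𝒩 : LGraph V → V → V → Prop) : Set (ColGraph k V) :=
  {G | ∃ p ∈ apexTreeFamilies k V 𝒩, IsSubstitution p G}

/-- The class `𝒵 × 𝒩`, as a class of coloured pointed graphs: a network in `𝒩` whose source is the
root and whose sink has become a labelled vertex `v` of colour `{1}`, the only coloured vertex. Here
`IsVertexTimes 𝒩 G v` says that `G` is such a graph with the labelled vertex `v`. -/
def IsVertexTimes (𝒩 : LGraph V → V → V → Prop) (G : ColGraph 1 V) (v : V) : Prop :=
  𝒩 G.graph G.root v ∧ G.col v = {0} ∧ ∀ u, u ≠ v → G.col u = ∅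

end Trees

end SPBlocks

open SPBlocks

/-! The whole argument turns on the set `W` of those vertices of `G` that belong to `H`. By
`mem_blocks_iff`, apart from simple conditions on the colours, a graph `G` is in `ℬ_k` when it is
biconnected, every colour occurs at exactly one vertex, and joining any coloured vertex to the root
`r` by an edge creates no `K₄` minor. The task is to find `W`, to read off `H` and the networks from
it, and to show that `W` is forced.

Given `W`, a vertex outside `W` has attachments: the vertices of `W` that it reaches without passing
through `W`. The torso of `W` joins two vertices of `W` that are adjacent or are attachments of a
common vertex. If every outside vertex has at most two attachments and the torso without `r` is
acyclic (`Loose`), then `G` falls into pieces with two poles, one for each edge of the torso.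

Existence of `W` (`exists_decomposition`). The set consisting of `r` and one coloured vertex is
`Loose`. As long as some coloured vertex `v` is missing, the piece around `v` can be cut: either it
has `r` as a pole (`exists_cut_of_root_piece`) or it lies on an edge of the tree
(`exists_cut_of_tree_piece`). If there were no cut, Menger's theorem for two linkages
(`exists_two_linkages`, `exists_rooted_triangle`) would give three pairwise adjacent connected sets
which form a `K₄` minor with `{r}`, using one edge between `r` and a coloured vertex. Adding a cut
vertex keeps `W` loose. Finally, vertices other than `r` and the coloured ones are removed while
they have at most two neighbours in the torso. The resulting torso is in `ℱ'_k`, because there every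
uncoloured non-root vertex has at least three neighbours (`mem_apexTrees_iff`). For `k ≥ 2` the
pieces are SP-networks (`exists_family`).

Conversely, a substitution into `H ∈ ℱ'_k` is biconnected since `H` is. A `K₄` minor in it, after a
coloured vertex is joined to `r`, would survive either in a torso that is acyclic without `r`, or in
a single network with its poles joined (`IsSubstitution.biConn`, `IsSubstitution.not_hasKFour`).

Uniqueness. The torso of the kept vertices is `H`, and each network is the subgraph induced by a
piece, so `W` determines everything (`IsSubstitution.family_eq`). A kept uncoloured vertex other
than `r` has three directions in `H`, each leading to the root or to a coloured vertex. Were it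
outside the vertex set of another solution, it would have three attachments there
(`IsSubstitution.verts_subset`). Hence any two solutions keep the same vertices.

For `k = 1` the only `H` is the single edge from `r` to the coloured vertex `v`, so `G` is itself
the network. It must be biconnected without the help of an edge `rv`, which excludes series
networks. The components of `G` without `r` and `v` provide the parallel parts
(`isParallelOrEdge_of_biConn`). -/

namespace SPBlocks

/-! ### Walks, components and connected sets inside a fixed vertex type -/

section Linked

variable {U U' : Type*} {g g' : SimpleGraph U} {X Y S : Set U} {a b c : U}

/-- `a` and `b` are joined by a walk of `g` all of whose vertices are in `X`. -/
def Linked (g : SimpleGraph U) (X : Set U) (a b : U) : Prop :=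
  a ∈ X ∧ Relation.ReflTransGen (fun u w => g.Adj u w ∧ w ∈ X) a b

theorem Linked.refl (ha : a ∈ X) : Linked g X a a := ⟨ha, .refl⟩

theorem Linked.left_mem (h : Linked g X a b) : a ∈ X := h.1

theorem Linked.tail (h : Linked g X a b) (hbc : g.Adj b c) (hc : c ∈ X) : Linked g X a c :=
  ⟨h.1, h.2.tail ⟨hbc, hc⟩⟩

theorem Linked.of_adj (ha : a ∈ X) (hab : g.Adj a b) (hb : b ∈ X) : Linked g X a b :=
  (Linked.refl ha).tail hab hb

theorem Linked.mem_of_closed (h : Linked g X a b) (ha : a ∈ S)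
    (hS : ∀ u ∈ S, ∀ w ∈ X, g.Adj u w → w ∈ S) : b ∈ S := by
  obtain ⟨-, h⟩ := h
  induction h with
  | refl => exact ha
  | tail _ h ih => exact hS _ ih _ h.2 h.1

theorem Linked.right_mem (h : Linked g X a b) : b ∈ X :=
  h.mem_of_closed h.1 fun _ _ _ hw _ => hw

/-- Induction on the length of a walk. -/
theorem Linked.induct {P : U → Prop} (h : Linked g X a b) (h0 : P a)
    (hs : ∀ u w, Linked g X a u → P u → g.Adj u w → w ∈ X → P w) : P b := by
  have := h.mem_of_closed (S := {u | Linked g X a u ∧ P u}) ⟨.refl h.1, h0⟩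
    fun u hu w hw huw => ⟨hu.1.tail huw hw, hs u w hu.1 hu.2 huw hw⟩
  exact this.2

theorem Linked.trans (h : Linked g X a b) (h' : Linked g X b c) : Linked g X a c :=
  ⟨h.1, h.2.trans h'.2⟩

theorem Linked.symm (h : Linked g X a b) : Linked g X b a :=
  h.induct (.refl h.1) fun _ _ hu ih huw hw =>
    (Linked.of_adj hw huw.symm hu.right_mem).trans ih

theorem Linked.mono (h : Linked g X a b) (hg : g ≤ g') (hX : X ⊆ Y) : Linked g' Y a b :=
  h.induct (.refl (hX h.1)) fun _ _ _ ih huw hw => ih.tail (hg huw) (hX hw)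

theorem Linked.mono_set (h : Linked g X a b) (hX : X ⊆ Y) : Linked g Y a b := h.mono le_rfl hX

theorem Linked.mono_graph (h : Linked g X a b) (hg : g ≤ g') : Linked g' X a b :=
  h.mono hg subset_rfl

/-- A walk within `X` may be transferred step by step. -/
theorem Linked.transfer {g' : SimpleGraph U'} {Y : Set U'} (f : U → U') (h : Linked g X a b)
    (ha : f a ∈ Y) (hs : ∀ u ∈ X, ∀ w ∈ X, g.Adj u w → f u ∈ Y →
      Linked g' Y (f u) (f w)) : Linked g' Y (f a) (f b) :=
  h.induct (P := fun u => Linked g' Y (f a) (f u)) (.refl ha) fun u w hu ih huw hw =>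
    ih.trans (hs u hu.right_mem w hw huw ih.right_mem)

/-- The vertices that are linked to `a` in `X`. -/
def comp (g : SimpleGraph U) (X : Set U) (a : U) : Set U := {u | Linked g X a u}

theorem self_mem_comp (ha : a ∈ X) : a ∈ comp g X a := .refl ha

theorem comp_subset : comp g X a ⊆ X := fun _ h => h.right_mem

theorem Linked.in_comp (h : Linked g X a b) : Linked g (comp g X a) a b :=
  h.induct (.refl (self_mem_comp h.1)) fun _ _ hu ih huw hw => ih.tail huw (hu.tail huw hw)

/-- The first vertex in `S` of a walk that starts outside `S`. -/
theorem Linked.first_hit (h : Linked g X a b) (ha : a ∉ S) (hb : b ∈ S) :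
    ∃ u s, Linked g (X \ S) a u ∧ g.Adj u s ∧ s ∈ S ∧ s ∈ X := by
  by_contra! hc
  refine (h.mem_of_closed (S := comp g (X \ S) a) (.refl ⟨h.1, ha⟩) ?_).right_mem.2 hb
  intro u hu w hw huw
  exact Linked.tail hu huw ⟨hw, fun hwS => hc u w hu huw hwS hw⟩

/-- A nonempty set that is connected in `g`. -/
def Conn (g : SimpleGraph U) (X : Set U) : Prop :=
  X.Nonempty ∧ ∀ a ∈ X, ∀ b ∈ X, Linked g X a b

theorem Conn.of_root (ha : a ∈ X) (h : ∀ b ∈ X, Linked g X a b) : Conn g X :=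
  ⟨⟨a, ha⟩, fun b hb c hc => (h b hb).symm.trans (h c hc)⟩

theorem Conn.singleton : Conn g {a} := .of_root rfl fun b hb => by
  rw [Set.mem_singleton_iff.1 hb]; exact .refl rfl

theorem Conn.comp (ha : a ∈ X) : Conn g (comp g X a) :=
  .of_root (self_mem_comp ha) fun _ hb => Linked.in_comp hb

theorem Conn.mono (h : Conn g X) (hg : g ≤ g') : Conn g' X :=
  ⟨h.1, fun a ha b hb => (h.2 a ha b hb).mono_graph hg⟩

theorem Conn.subset_comp (h : Conn g X) (ha : a ∈ X) (hX : X ⊆ Y) : X ⊆ SPBlocks.comp g Y a :=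
  fun _ hb => (h.2 _ ha _ hb).mono_set hX

theorem Conn.union (h : Conn g X) (h' : Conn g Y) (hXY : ∃ a ∈ X, ∃ b ∈ Y, a = b ∨ g.Adj a b) :
    Conn g (X ∪ Y) := by
  obtain ⟨a, ha, b, hb, hab⟩ := hXY
  have hl : Linked g (X ∪ Y) a b := by
    rcases hab with rfl | hab
    · exact .refl (.inl ha)
    · exact .of_adj (.inl ha) hab (.inr hb)
  refine .of_root (a := a) (.inl ha) fun c hc => ?_
  rcases hc with hc | hc
  · exact (h.2 a ha c hc).mono_set Set.subset_union_left
  · exact hl.trans ((h'.2 b hb c hc).mono_set Set.subset_union_right)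

/-- Two disjoint connected subsets of a connected set can be enlarged so that they become
adjacent. -/
theorem Conn.grow {C P Q : Set U} (hC : Conn g C) (hP : Conn g P) (hQ : Conn g Q) (hPC : P ⊆ C)
    (hQC : Q ⊆ C) (hPQ : Disjoint P Q) : ∃ P', P ⊆ P' ∧ P' ⊆ C ∧ Conn g P' ∧ Disjoint P' Q ∧
      ∃ a ∈ P', ∃ b ∈ Q, g.Adj a b := by
  obtain ⟨p, hp⟩ := hP.1
  obtain ⟨q, hq⟩ := hQ.1
  have hsub : P ⊆ C \ Q := fun x hx => ⟨hPC hx, fun h => hPQ.le_bot ⟨hx, h⟩⟩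
  refine ⟨SPBlocks.comp g (C \ Q) p, hP.subset_comp hp hsub, fun x hx => (comp_subset hx).1,
    .comp (hsub hp), Set.disjoint_left.2 fun x hx => (comp_subset hx).2, ?_⟩
  obtain ⟨u, s, hu, hus, hs, -⟩ := (hC.2 p (hPC hp) q (hQC hq)).first_hit (hsub hp).2 hq
  exact ⟨u, hu, s, hs, hus⟩

theorem Linked.exists_conn {A B C : Set U} (ha : a ∈ A) (hb : b ∈ B)
    (h : Linked g C a b) : ∃ P ⊆ C, Conn g P ∧ (P ∩ A).Nonempty ∧ (P ∩ B).Nonempty :=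
  ⟨comp g C a, comp_subset, .comp h.1, ⟨a, self_mem_comp h.1, ha⟩, b, h, hb⟩

end Linked

/-! ### Menger's theorem for two disjoint linkages -/

section Menger

variable {U : Type*} {g : SimpleGraph U}

/-- One half of a graph that is separated by `c` and `z`: two disjoint linkages from `A`
to `{c, z}` exist if no vertex separates `A` from `B`. -/
theorem no_cut_of_no_cut {C A B : Set U} {c z : U}
    (h : ∀ z, ∃ a ∈ A, ∃ b ∈ B, Linked g (C \ {z}) a b)
    (hcz : ∀ a ∈ A, ∀ b ∈ B, ¬ Linked g (C \ {c, z}) a b) (x : U) :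
    ∃ a ∈ A, ∃ b ∈ ({c, z} : Set U),
      Linked g (({u | u ∈ C ∧ (u = c ∨ u = z ∨ ∃ a ∈ A, Linked g (C \ {c, z}) a u)}) \ {x}) a b := by
  obtain ⟨a, ha, b, hb, hab⟩ := h x
  by_cases hacz : a ∈ ({c, z} : Set U)
  · exact ⟨a, ha, a, hacz, .refl ⟨⟨hab.1.1, by simp at hacz; tauto⟩, hab.1.2⟩⟩
  · have key : ∃ s ∈ ({c, z} : Set U), ∃ u, Linked g ((C \ {x}) \ {c, z}) a u ∧ g.Adj u s ∧
        s ∈ C \ {x} := by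
      by_contra! hcon
      refine hcz a ha b hb ?_
      have := hab.mem_of_closed (S := comp g ((C \ {x}) \ {c, z}) a)
        (self_mem_comp ⟨hab.1, hacz⟩) fun u hu w hw huw =>
          Linked.tail hu huw ⟨hw, fun hwS => hcon w hwS u hu huw hw⟩
      exact Linked.mono_set this fun y hy => ⟨hy.1.1, hy.2⟩
    obtain ⟨s, hs, u, hau, hus, hsC⟩ := key
    refine ⟨a, ha, s, hs, Linked.tail ?_ hus ⟨⟨hsC.1, by simp at hs; tauto⟩, hsC.2⟩⟩
    refine hau.in_comp.mono_set fun y hy => ?_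
    have hyC := (comp_subset hy).1
    exact ⟨⟨hyC.1, .inr (.inr ⟨a, ha, Linked.mono_set hy fun y hy => ⟨hy.1.1, hy.2⟩⟩)⟩, hyC.2⟩

/-- Menger's theorem for two linkages: if no vertex `z` separates `A` from `B` in the finite set
`C`, then there are two disjoint connected subsets of `C` that meet both `A` and `B`. -/
theorem exists_two_linkages [Nonempty U] (C : Set U) (hC : C.Finite) : ∀ (A B : Set U),
    (∀ z, ∃ a ∈ A, ∃ b ∈ B, Linked g (C \ {z}) a b) →
    ∃ P Q : Set U, P ⊆ C ∧ Q ⊆ C ∧ Disjoint P Q ∧ Conn g P ∧ Conn g Q ∧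
      (P ∩ A).Nonempty ∧ (P ∩ B).Nonempty ∧ (Q ∩ A).Nonempty ∧ (Q ∩ B).Nonempty := by
  induction hn : C.ncard using Nat.strong_induction_on generalizing C with
  | _ n ih =>
  subst hn
  intro A B h
  by_cases hAB : ∃ c ∈ C, c ∈ A ∧ c ∈ B
  · obtain ⟨c, hc, hcA, hcB⟩ := hAB
    obtain ⟨a, ha, b, hb, hab⟩ := h c
    obtain ⟨Q, hQC, hQ, hQA, hQB⟩ := hab.exists_conn ha hb
    refine ⟨{c}, Q, by simpa using hc, fun x hx => (hQC hx).1, ?_, .singleton, hQ,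
      ⟨c, rfl, hcA⟩, ⟨c, rfl, hcB⟩, hQA, hQB⟩
    exact Set.disjoint_left.2 fun x hx hxQ => (hQC hxQ).2 hx
  push Not at hAB
  by_cases hcC : ∃ c ∈ C, c ∉ A ∧ c ∉ B
  · obtain ⟨c, hc, hcA, hcB⟩ := hcC
    by_cases hcrit : ∀ z, ∃ a ∈ A, ∃ b ∈ B, Linked g ((C \ {c}) \ {z}) a b
    · obtain ⟨P, Q, hP, hQ, h'⟩ := ih _ (Set.ncard_sdiff_singleton_lt_of_mem hc hC) (C \ {c})
        (hC.subset Set.sdiff_subset) rfl A B hcrit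
      exact ⟨P, Q, fun x hx => (hP hx).1, fun x hx => (hQ hx).1, h'⟩
    push Not at hcrit
    obtain ⟨z, hz⟩ := hcrit
    have hz' : ∀ a ∈ A, ∀ b ∈ B, ¬ Linked g (C \ {c, z}) a b := by
      intro a ha b hb hl
      exact hz a ha b hb (hl.mono_set fun x hx => by simp at hx ⊢; tauto)
    -- If a single vertex `x` were all of `{c, z}` that lies in `C`, deleting it would separate `A`
    -- from `B`. Hence `c` and `z` are two different vertices of `C`.
    have hsep : ∀ x, (∀ y ∈ C, y ∈ ({c, z} : Set U) → y = x) → False := by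
      intro x hx
      obtain ⟨a, ha, b, hb, hl⟩ := h x
      exact hz' a ha b hb (hl.mono_set fun y hy => ⟨hy.1, fun hy' => hy.2 (hx y hy.1 hy')⟩)
    have hzC : z ∈ C := by
      by_contra hzC
      refine hsep c fun y hy hy' => ?_
      rcases hy' with rfl | rfl
      · rfl
      · exact absurd hy hzC
    have hzc : z ≠ c := by
      rintro rfl
      exact hsep z fun y hy hy' => by simpa using hy'
    set CA : Set U := {u | u ∈ C ∧ (u = c ∨ u = z ∨ ∃ a ∈ A, Linked g (C \ {c, z}) a u)} with hCA
    set CB : Set U := {u | u ∈ C ∧ (u = c ∨ u = z ∨ ∃ a ∈ B, Linked g (C \ {c, z}) a u)} with hCB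
    have hA' := no_cut_of_no_cut h hz'
    have h' : ∀ z, ∃ b ∈ B, ∃ a ∈ A, Linked g (C \ {z}) b a := fun z => by
      obtain ⟨a, ha, b, hb, hl⟩ := h z
      exact ⟨b, hb, a, ha, hl.symm⟩
    have hB' := no_cut_of_no_cut h' (fun b hb a ha hl => hz' a ha b hb hl.symm)
    have hCAC : CA ⊆ C := fun x hx => hx.1
    have hCBC : CB ⊆ C := fun x hx => hx.1
    -- The ends of a linkage that avoids `z` are not in `{c, z}`, as `c` is in neither `A` nor `B`.
    -- So `b` is missing from the half `CA` and `a` from the half `CB`, and the induction hypothesis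
    -- applies to both halves.
    obtain ⟨a, ha, b, hb, hl⟩ := h z
    have hbcz : b ∉ ({c, z} : Set U) := by
      rintro (rfl | rfl)
      · exact hcB hb
      · exact hl.right_mem.2 rfl
    have hacz : a ∉ ({c, z} : Set U) := by
      rintro (rfl | rfl)
      · exact hcA ha
      · exact hl.1.2 rfl
    have hbA : b ∉ CA := by
      rintro ⟨-, rfl | rfl | ⟨a', ha', hl'⟩⟩
      · exact hbcz (.inl rfl)
      · exact hbcz (.inr rfl)
      · exact hz' a' ha' b hb hl'
    have haB : a ∉ CB := by
      rintro ⟨-, rfl | rfl | ⟨a', ha', hl'⟩⟩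
      · exact hacz (.inl rfl)
      · exact hacz (.inr rfl)
      · exact hz' a ha a' ha' hl'.symm
    have hltA : CA.ncard < C.ncard :=
      Set.ncard_lt_ncard ⟨hCAC, fun hs => hbA (hs hl.right_mem.1)⟩ hC
    have hltB : CB.ncard < C.ncard :=
      Set.ncard_lt_ncard ⟨hCBC, fun hs => haB (hs hl.1.1)⟩ hC
    have hint : ∀ x, x ∈ CA → x ∈ CB → x = c ∨ x = z := by
      rintro x ⟨-, h1⟩ ⟨-, h2⟩
      rcases h1 with h1 | h1 | ⟨a, ha, hl⟩
      · exact .inl h1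
      · exact .inr h1
      rcases h2 with h2 | h2 | ⟨b, hb, hl'⟩
      · exact .inl h2
      · exact .inr h2
      exact absurd (hl.trans hl'.symm) (hz' a ha b hb)
    -- Two disjoint linkages to `{c, z}` end in different vertices, so they can be named such that
    -- `P` contains `c` and `Q` contains `z`. The linkages of the two halves are then glued at `c`
    -- and at `z`, where alone the halves meet.
    have pick : ∀ (D A : Set U), D ⊆ C → D.ncard < C.ncard →
        (∀ x, ∃ a ∈ A, ∃ b ∈ ({c, z} : Set U), Linked g (D \ {x}) a b) →
        ∃ P Q : Set U, P ⊆ D ∧ Q ⊆ D ∧ Conn g P ∧ Conn g Q ∧ Disjoint P Q ∧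
          (P ∩ A).Nonempty ∧ (Q ∩ A).Nonempty ∧ c ∈ P ∧ z ∈ Q := by
      intro D A hDC hlt hD
      obtain ⟨P, Q, hPD, hQD, hPQ, hP, hQ, hPA, ⟨p, hpP, hp⟩, hQA, ⟨q, hqQ, hq⟩⟩ :=
        ih _ hlt D (hC.subset hDC) rfl A {c, z} hD
      have hpq : p ≠ q := fun hpq => hPQ.le_bot ⟨hpP, hpq ▸ hqQ⟩
      rcases hp with rfl | rfl <;> rcases hq with rfl | rfl
      · exact absurd rfl hpq
      · exact ⟨P, Q, hPD, hQD, hP, hQ, hPQ, hPA, hQA, hpP, hqQ⟩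
      · exact ⟨Q, P, hQD, hPD, hQ, hP, hPQ.symm, hQA, hPA, hqQ, hpP⟩
      · exact absurd rfl hpq
    obtain ⟨P₁, Q₁, hP1, hQ1, cP1, cQ1, d1, hPA, hQA, hc1, hz1⟩ := pick CA A hCAC hltA hA'
    obtain ⟨P₂, Q₂, hP2, hQ2, cP2, cQ2, d2, hPB, hQB, hc2, hz2⟩ := pick CB B hCBC hltB hB'
    rw [Set.disjoint_left] at d1 d2
    refine ⟨P₁ ∪ P₂, Q₁ ∪ Q₂, Set.union_subset (hP1.trans hCAC) (hP2.trans hCBC),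
      Set.union_subset (hQ1.trans hCAC) (hQ2.trans hCBC), ?_,
      cP1.union cP2 ⟨c, hc1, c, hc2, .inl rfl⟩, cQ1.union cQ2 ⟨z, hz1, z, hz2, .inl rfl⟩,
      hPA.mono (by gcongr; exact Set.subset_union_left),
      hPB.mono (by gcongr; exact Set.subset_union_right),
      hQA.mono (by gcongr; exact Set.subset_union_left),
      hQB.mono (by gcongr; exact Set.subset_union_right)⟩
    rw [Set.disjoint_left]
    rintro x (hx | hx) (hx' | hx')
    · exact d1 hx hx'
    · rcases hint x (hP1 hx) (hQ2 hx') with rfl | rfl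
      · exact d2 hc2 hx'
      · exact d1 hx hz1
    · rcases hint x (hQ1 hx') (hP2 hx) with rfl | rfl
      · exact d1 hc1 hx'
      · exact d2 hx hz2
    · exact d2 hx hx'
  · push Not at hcC
    -- Now every vertex of `C` is in exactly one of `A` and `B`, so each linkage crosses an edge
    -- between them, and no vertex `z` meets all these edges.
    have edge : ∀ z, ∃ a ∈ A, ∃ b ∈ B, a ∈ C ∧ b ∈ C ∧ a ≠ z ∧ b ≠ z ∧ g.Adj a b := by
      intro z
      obtain ⟨a, ha, b, hb, hl⟩ := h z
      obtain ⟨u, s, hu, hus, hs, hsC⟩ := hl.first_hit (hAB a hl.1.1 ha) hb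
      have hu' := hu.right_mem
      have huA : u ∈ A := by
        by_contra huA
        exact hu'.2 (hcC u hu'.1.1 huA)
      exact ⟨u, huA, s, hs, hu'.1.1, hsC.1, hu'.1.2, hsC.2, hus⟩
    have fin : ∀ a ∈ A, ∀ b ∈ B, ∀ a' ∈ A, ∀ b' ∈ B, a ∈ C → b ∈ C → a' ∈ C → b' ∈ C →
        a ≠ a' → b ≠ b' → g.Adj a b → g.Adj a' b' → 
        ∃ P Q : Set U, P ⊆ C ∧ Q ⊆ C ∧ Disjoint P Q ∧ Conn g P ∧ Conn g Q ∧
      (P ∩ A).Nonempty ∧ (P ∩ B).Nonempty ∧ (Q ∩ A).Nonempty ∧ (Q ∩ B).Nonempty := by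
      intro a ha b hb a' ha' b' hb' haC hbC haC' hbC' hne hne' hadj hadj'
      have e : ∀ a b, g.Adj a b → Conn g {a, b} := fun a b h => by
        rw [Set.insert_eq]
        exact Conn.singleton.union .singleton ⟨a, rfl, b, rfl, .inr h⟩
      refine ⟨{a, b}, {a', b'}, by simp [Set.insert_subset_iff, *],
        by simp [Set.insert_subset_iff, *], ?_, e _ _ hadj, e _ _ hadj', ⟨a, by simp, ha⟩,
        ⟨b, by simp, hb⟩, ⟨a', by simp, ha'⟩, ⟨b', by simp, hb'⟩⟩
      rw [Set.disjoint_left]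
      rintro x (rfl | rfl) (rfl | rfl)
      · exact hne rfl
      · exact hAB _ haC ha hb'
      · exact hAB _ hbC ha' hb
      · exact hne' rfl
    obtain ⟨z⟩ := ‹Nonempty U›
    -- Two of three edges are disjoint: an arbitrary one, one that avoids `a₁`, and, if these two
    -- share their end in `B`, one that avoids the shared end.
    obtain ⟨a₁, ha1, b₁, hb1, ha1C, hb1C, -, -, h1⟩ := edge z
    obtain ⟨a₂, ha2, b₂, hb2, ha2C, hb2C, hne2, -, h2⟩ := edge a₁
    by_cases hb12 : b₂ = b₁
    · subst hb12
      obtain ⟨a₃, ha3, b₃, hb3, ha3C, hb3C, -, hne3, h3⟩ := edge b₂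
      by_cases ha13 : a₃ = a₁
      · subst ha13
        exact fin a₃ ha3 b₃ hb3 a₂ ha2 b₂ hb2 ha3C hb3C ha2C hb2C hne2.symm hne3 h3 h2
      · exact fin a₁ ha1 b₂ hb2 a₃ ha3 b₃ hb3 ha1C hb2C ha3C hb3C (Ne.symm ha13) hne3.symm h1 h3
    · exact fin a₁ ha1 b₁ hb1 a₂ ha2 b₂ hb2 ha1C hb1C ha2C hb2C hne2.symm (Ne.symm hb12) h1 h2

end Menger

/-! ### Attachments and torsos -/

section Torso

variable {U : Type*} {g g' : SimpleGraph U} {W X : Set U} {v u x y a b : U}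

/-- `x ∈ W` is an attachment of `v`: the vertex `v` reaches a neighbour of `x` outside `W`. -/
def Att (g : SimpleGraph U) (W : Set U) (v x : U) : Prop :=
  x ∈ W ∧ ∃ u, Linked g Wᶜ v u ∧ g.Adj u x

theorem Att.of_linked (h : Linked g Wᶜ u v) (hv : Att g W v x) : Att g W u x :=
  ⟨hv.1, hv.2.imp fun _ hw => ⟨h.trans hw.1, hw.2⟩⟩

theorem Att.notMem (h : Att g W v x) : v ∉ W := h.2.choose_spec.1.1

theorem Att.of_adj (hv : v ∉ W) (hx : x ∈ W) (h : g.Adj v x) : Att g W v x :=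
  ⟨hx, v, .refl hv, h⟩

theorem Linked.exists_att (h : Linked g X v b) (hv : v ∉ W) (hb : b ∈ W) :
    ∃ x ∈ X, Att g W v x ∧ Linked g X v x := by
  obtain ⟨u, s, hu, hus, hs, hsX⟩ := h.first_hit hv hb
  exact ⟨s, hsX, ⟨hs, u, hu.mono_set fun _ h => h.2, hus⟩,
    (hu.mono_set fun _ h => h.1).tail hus hsX⟩

/-- The torso of `W` in `g`: two vertices of `W` are adjacent if they are joined by a path without
internal vertices in `W`. -/
def torso (g : SimpleGraph U) (W : Set U) : SimpleGraph U where
  Adj x y := x ≠ y ∧ x ∈ W ∧ y ∈ W ∧ (g.Adj x y ∨ ∃ v, Att g W v x ∧ Att g W v y)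
  symm := ⟨fun _ _ ⟨h1, h2, h3, h4⟩ =>
    ⟨h1.symm, h3, h2, h4.imp (·.symm) fun ⟨v, a, b⟩ => ⟨v, b, a⟩⟩⟩
  loopless := ⟨fun _ h => h.1 rfl⟩

/-- A walk of `g` that starts in `W` yields a walk in the torso of `W`. -/
theorem Linked.torso_aux (h : Linked g X a b) (ha : a ∈ W) :
    (b ∈ W → Linked (torso g W) (X ∩ W) a b) ∧
      (b ∉ W → ∃ p, Linked (torso g W) (X ∩ W) a p ∧ Att g W b p) := by
  refine h.induct (P := fun b => (b ∈ W → Linked (torso g W) (X ∩ W) a b) ∧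
      (b ∉ W → ∃ p, Linked (torso g W) (X ∩ W) a p ∧ Att g W b p))
    ⟨fun _ => .refl ⟨h.1, ha⟩, fun hn => absurd ha hn⟩ ?_
  intro b c _ ih hbc hcX
  by_cases hb : b ∈ W <;> by_cases hc : c ∈ W
  · exact ⟨fun _ => (ih.1 hb).tail ⟨hbc.ne, hb, hc, .inl hbc⟩ ⟨hcX, hc⟩, fun h => absurd hc h⟩
  · exact ⟨fun h => absurd h hc, fun _ => ⟨b, ih.1 hb, .of_adj hc hb hbc.symm⟩⟩
  · obtain ⟨p, hp, hbp⟩ := ih.2 hb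
    refine ⟨fun _ => ?_, fun h => absurd hc h⟩
    by_cases hpc : p = c
    · exact hpc ▸ hp
    · exact hp.tail ⟨hpc, hbp.1, hc, .inr ⟨b, hbp, .of_adj hb hc hbc⟩⟩ ⟨hcX, hc⟩
  · obtain ⟨p, hp, hbp⟩ := ih.2 hb
    exact ⟨fun h => absurd h hc,
      fun _ => ⟨p, hp, Att.of_linked (.of_adj hc hbc.symm hb) hbp⟩⟩

theorem Linked.torso (h : Linked g X a b) (ha : a ∈ W) (hb : b ∈ W) :
    Linked (torso g W) (X ∩ W) a b :=
  (h.torso_aux ha).1 hb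

theorem Linked.torso_att (h : Linked g X a b) (ha : a ∈ W) (hb : b ∉ W) :
    ∃ p, Linked (SPBlocks.torso g W) (X ∩ W) a p ∧ Att g W b p :=
  (h.torso_aux ha).2 hb

theorem Conn.torso (h : Conn g X) (hX : (X ∩ W).Nonempty) : Conn (torso g W) (X ∩ W) :=
  ⟨hX, fun _ ha _ hb => (h.2 _ ha.1 _ hb.1).torso ha.2 hb.2⟩

/-- An end of the edge that is outside `W` is moved to one of its attachments within its own
connected set. If both ends are outside `W`, they have the same attachments, so the two chosen
vertices are joined in the torso. -/
theorem torso_adj_of_adj {P Q : Set U} (hP : Conn g P) (hQ : Conn g Q) (hPQ : Disjoint P Q)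
    (hPW : (P ∩ W).Nonempty) (hQW : (Q ∩ W).Nonempty) (hab : ∃ a ∈ P, ∃ b ∈ Q, g.Adj a b) :
    ∃ a ∈ P ∩ W, ∃ b ∈ Q ∩ W, (SPBlocks.torso g W).Adj a b := by
  obtain ⟨a, ha, b, hb, hab⟩ := hab
  have key : ∀ P : Set U, Conn g P → (P ∩ W).Nonempty → ∀ a ∈ P, ∃ p ∈ P ∩ W,
      a = p ∨ (a ∉ W ∧ Att g W a p) := by
    intro P hP ⟨q, hqP, hqW⟩ a ha
    by_cases haW : a ∈ W
    · exact ⟨a, ⟨ha, haW⟩, .inl rfl⟩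
    · obtain ⟨p, hpP, hp, -⟩ := (hP.2 a ha q hqP).exists_att haW hqW
      exact ⟨p, ⟨hpP, hp.1⟩, .inr ⟨haW, hp⟩⟩
  obtain ⟨p, hp, hap⟩ := key P hP hPW a ha
  obtain ⟨q, hq, hbq⟩ := key Q hQ hQW b hb
  have hpq : p ≠ q := fun h => hPQ.le_bot ⟨hp.1, h ▸ hq.1⟩
  refine ⟨p, hp, q, hq, hpq, hp.2, hq.2, ?_⟩
  rcases hap with rfl | ⟨haW, hap⟩ <;> rcases hbq with rfl | ⟨hbW, hbq⟩
  · exact .inl hab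
  · exact .inr ⟨b, .of_adj hbW hp.2 hab.symm, hbq⟩
  · exact .inr ⟨a, hap, .of_adj haW hq.2 hab⟩
  · exact .inr ⟨a, hap, .of_linked (.of_adj haW hab hbW) hbq⟩

end Torso

/-! ### `K₄` minors as families of branch sets -/

section KFour

variable {U U' : Type*} {g g' : SimpleGraph U} {W X : Set U} {v u x y a b : U}

/-- `g` has a `K₄` minor, with the branch sets `B`. -/
structure IsKFour (g : SimpleGraph U) (B : Fin 4 → Set U) : Prop where
  conn : ∀ i, Conn g (B i)
  disj : ∀ i j, i ≠ j → Disjoint (B i) (B j)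
  adj : ∀ i j, i ≠ j → ∃ x ∈ B i, ∃ y ∈ B j, g.Adj x y

/-- `g` has a `K₄` minor. -/
def HasKFour (g : SimpleGraph U) : Prop := ∃ B, IsKFour g B

theorem HasKFour.mono (h : HasKFour g) (hg : g ≤ g') : HasKFour g' := by
  obtain ⟨B, h⟩ := h
  refine ⟨B, fun i => (h.conn i).mono hg, h.disj, fun i j hij => ?_⟩
  obtain ⟨x, hx, y, hy, hxy⟩ := h.adj i j hij
  exact ⟨x, hx, y, hy, hg hxy⟩

/-- Three pairwise disjoint and pairwise adjacent connected sets. -/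
structure IsTriangle (g : SimpleGraph U) (P Q R : Set U) : Prop where
  conn₁ : Conn g P
  conn₂ : Conn g Q
  conn₃ : Conn g R
  disj₁₂ : Disjoint P Q
  disj₁₃ : Disjoint P R
  disj₂₃ : Disjoint Q R
  adj₁₂ : ∃ x ∈ P, ∃ y ∈ Q, g.Adj x y
  adj₁₃ : ∃ x ∈ P, ∃ y ∈ R, g.Adj x y
  adj₂₃ : ∃ x ∈ Q, ∃ y ∈ R, g.Adj x y

theorem exists_adj_symm {P Q : Set U} (h : ∃ x ∈ P, ∃ y ∈ Q, g.Adj x y) :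
    ∃ x ∈ Q, ∃ y ∈ P, g.Adj x y := by
  obtain ⟨x, hx, y, hy, h⟩ := h
  exact ⟨y, hy, x, hx, h.symm⟩

theorem IsTriangle.hasKFour {P Q R S : Set U} (h : IsTriangle g P Q R) (hS : Conn g S)
    (d₁ : Disjoint P S) (d₂ : Disjoint Q S) (d₃ : Disjoint R S)
    (a₁ : ∃ x ∈ P, ∃ y ∈ S, g.Adj x y) (a₂ : ∃ x ∈ Q, ∃ y ∈ S, g.Adj x y)
    (a₃ : ∃ x ∈ R, ∃ y ∈ S, g.Adj x y) : HasKFour g := by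
  obtain ⟨c1, c2, c3, d12, d13, d23, a12, a13, a23⟩ := h
  refine ⟨![P, Q, R, S], ?_, ?_, ?_⟩
  · intro i
    fin_cases i <;> simpa
  · intro i j hij
    fin_cases i <;> fin_cases j <;> first | exact absurd rfl hij | assumption | (apply Disjoint.symm; assumption)
  · intro i j hij
    fin_cases i <;> fin_cases j <;> first | exact absurd rfl hij | assumption | (apply exists_adj_symm; assumption)

theorem IsKFour.triangle {B : Fin 4 → Set U} (h : IsKFour g B) {i j k : Fin 4} (hij : i ≠ j)
    (hik : i ≠ k) (hjk : j ≠ k) : IsTriangle g (B i) (B j) (B k) :=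
  ⟨h.conn _, h.conn _, h.conn _, h.disj _ _ hij, h.disj _ _ hik, h.disj _ _ hjk,
    h.adj _ _ hij, h.adj _ _ hik, h.adj _ _ hjk⟩

/-- Passing to a torso can destroy a minor only by losing a branch set that misses `W`. This is the
standard way to shrink the graph below. -/
theorem IsKFour.torso {B : Fin 4 → Set U} (h : IsKFour g B) (hB : ∀ i, (B i ∩ W).Nonempty) :
    HasKFour (torso g W) :=
  ⟨fun i => B i ∩ W, fun i => (h.conn i).torso (hB i),
    fun i j hij => (h.disj i j hij).mono Set.inter_subset_left Set.inter_subset_left,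
    fun i j hij => torso_adj_of_adj (h.conn i) (h.conn j) (h.disj i j hij) (hB i) (hB j)
      (h.adj i j hij)⟩

theorem Conn.map {g : SimpleGraph U} {g' : SimpleGraph U'} (f : g →g g') (h : Conn g X) :
    Conn g' (f '' X) := by
  refine ⟨h.1.image _, ?_⟩
  rintro _ ⟨a, ha, rfl⟩ _ ⟨b, hb, rfl⟩
  exact (h.2 a ha b hb).transfer f ⟨a, ha, rfl⟩ fun u hu w hw huw _ =>
    .of_adj ⟨u, hu, rfl⟩ (f.map_adj huw) ⟨w, hw, rfl⟩

theorem HasKFour.map {g : SimpleGraph U} {g' : SimpleGraph U'} (f : g →g g')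
    (hf : Function.Injective f) (h : HasKFour g) : HasKFour g' := by
  obtain ⟨B, h⟩ := h
  refine ⟨fun i => f '' B i, fun i => (h.conn i).map f,
    fun i j hij => (Set.disjoint_image_iff hf).2 (h.disj i j hij), fun i j hij => ?_⟩
  obtain ⟨x, hx, y, hy, hxy⟩ := h.adj i j hij
  exact ⟨_, ⟨x, hx, rfl⟩, _, ⟨y, hy, rfl⟩, f.map_adj hxy⟩

theorem Linked.comap {f : U' → U} (hf : Function.Injective f)
    (hr : ∀ a b, g.Adj a b → a ∈ Set.range f) {a b : U'} (h : Linked g X (f a) (f b)) :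
    Linked (g.comap f) (f ⁻¹' X) a b := by
  have := h.induct (P := fun u => ∃ b, f b = u ∧ Linked (g.comap f) (f ⁻¹' X) a b)
    ⟨a, rfl, .refl h.1⟩ (by
      rintro u w - ⟨b, rfl, hb⟩ huw hw
      obtain ⟨c, rfl⟩ := hr w _ huw.symm
      exact ⟨c, rfl, hb.tail huw hw⟩)
  obtain ⟨c, hc, h⟩ := this
  exact hf hc ▸ h

/-- Vertices outside the range of `f` are isolated, so they play no role: each branch set is
connected and has an edge to another one. -/
theorem HasKFour.comap {f : U' → U} (hf : Function.Injective f)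
    (hr : ∀ a b, g.Adj a b → a ∈ Set.range f) (h : HasKFour g) : HasKFour (g.comap f) := by
  obtain ⟨B, h⟩ := h
  refine ⟨fun i => f ⁻¹' B i, fun i => ⟨?_, fun a ha b hb => ((h.conn i).2 _ ha _ hb).comap hf hr⟩,
    fun i j hij => (h.disj i j hij).preimage f, fun i j hij => ?_⟩
  · obtain ⟨j, hj⟩ := exists_ne i
    obtain ⟨x, hx, y, hy, hxy⟩ := h.adj i j hj.symm
    obtain ⟨x, rfl⟩ := hr x y hxy
    exact ⟨x, hx⟩
  · obtain ⟨x, hx, y, hy, hxy⟩ := h.adj i j hij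
    obtain ⟨x, rfl⟩ := hr x y hxy
    obtain ⟨y, rfl⟩ := hr y _ hxy.symm
    exact ⟨x, hx, y, hy, hxy⟩

/-- In a `K₄` minor, an edge `xy` may be replaced by a connected set that is disjoint from the
branch sets. -/
theorem IsKFour.replace_edge {B : Fin 4 → Set U} {Z : Set U} (h : IsKFour (g ⊔ SimpleGraph.edge x y) B)
    (hg : g ≤ g') (hZ : Conn g' Z) (hd : ∀ i, Disjoint (B i) Z) (hx : ∃ z ∈ Z, g'.Adj x z)
    (hy : ∃ z ∈ Z, g'.Adj y z) : HasKFour g' := by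
  classical
  have hB : ∀ i, x ∉ B i → Conn g' (B i) := by
    refine fun i hi => ⟨(h.conn i).1, fun a ha b hb => ?_⟩
    refine ((h.conn i).2 a ha b hb).transfer id ha fun u hu w hw huw _ => ?_
    refine .of_adj hu (hg ?_) hw
    rcases huw with huw | huw
    · exact huw
    · rw [SimpleGraph.edge_adj] at huw
      rcases huw.1 with ⟨rfl, -⟩ | ⟨-, rfl⟩
      · exact absurd hu hi
      · exact absurd hw hi
  have hB' : ∀ i, x ∈ B i → Conn g' (B i ∪ Z) := by
    intro i hi
    obtain ⟨z, hz, hxz⟩ := hx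
    obtain ⟨z', hz', hyz'⟩ := hy
    have hl : x ∈ B i → y ∈ B i → Linked g' (B i ∪ Z) x y := fun hx hy =>
      ((Linked.of_adj (.inl hx) hxz (.inr hz)).trans
        ((hZ.2 z hz z' hz').mono_set Set.subset_union_right)).tail hyz'.symm (.inl hy)
    have hBi : ∀ b ∈ B i, Linked g' (B i ∪ Z) x b := fun b hb => by
      refine ((h.conn i).2 x hi b hb).transfer id (.inl hi) fun u hu w hw huw _ => ?_
      rcases huw with huw | huw
      · exact .of_adj (.inl hu) (hg huw) (.inl hw)
      · rw [SimpleGraph.edge_adj] at huw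
        rcases huw.1 with ⟨rfl, rfl⟩ | ⟨rfl, rfl⟩
        · exact hl hu hw
        · exact (hl hw hu).symm
    refine .of_root (a := x) (.inl hi) fun b hb => ?_
    rcases hb with hb | hb
    · exact hBi b hb
    · exact (Linked.of_adj (.inl hi) hxz (.inr hz)).trans
        ((hZ.2 z hz b hb).mono_set Set.subset_union_right)
  -- The branch set of `x`, if there is one, absorbs `Z`. If it contains `y` too, `Z` replaces the
  -- edge inside it; otherwise the neighbour of `y` in `Z` replaces the edge between two branch
  -- sets.
  refine ⟨fun i => if x ∈ B i then B i ∪ Z else B i, fun i => ?_, fun i j hij => ?_,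
    fun i j hij => ?_⟩
  · split_ifs with hi
    · exact hB' i hi
    · exact hB i hi
  · have hd' := h.disj i j hij
    split_ifs with hi hj hj
    · exact absurd hj (Set.disjoint_left.1 hd' hi)
    · exact Set.disjoint_union_left.2 ⟨hd', (hd j).symm⟩
    · exact Set.disjoint_union_right.2 ⟨hd', hd i⟩
    · exact hd'
  · have hsub : ∀ i, B i ⊆ if x ∈ B i then B i ∪ Z else B i := fun i => by
      split_ifs
      · exact Set.subset_union_left
      · exact subset_rfl
    obtain ⟨u, hu, w, hw, huw⟩ := h.adj i j hij
    rcases huw with huw | huw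
    · exact ⟨u, hsub i hu, w, hsub j hw, hg huw⟩
    · rw [SimpleGraph.edge_adj] at huw
      obtain ⟨z, hz, hyz⟩ := hy
      rcases huw.1 with ⟨rfl, rfl⟩ | ⟨rfl, rfl⟩
      · exact ⟨z, by rw [if_pos hu]; exact .inr hz, w, hsub j hw, hyz.symm⟩
      · exact ⟨u, hsub i hu, z, by rw [if_pos hw]; exact .inr hz, hyz⟩

end KFour

/-! ### Biconnectivity and rooted triangles -/

section Biconnected

variable {U : Type*} {g g' : SimpleGraph U} {N W X : Set U} {v u x y a b c : U}

/-- `g` is biconnected, with the set `N` of vertices. -/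
structure BiConn (g : SimpleGraph U) (N : Set U) : Prop where
  nontrivial : N.Nontrivial
  supp : ∀ a b, g.Adj a b → a ∈ N
  conn : ∀ a ∈ N, ∀ b ∈ N, Linked g N a b
  cut : ∀ x, ∀ a ∈ N, ∀ b ∈ N, a ≠ x → b ≠ x → Linked g (N \ {x}) a b

theorem BiConn.linked (h : BiConn g N) (ha : a ∈ N) (hb : b ∈ N) (hax : a ≠ x) (hbx : b ≠ x) :
    Linked g {x}ᶜ a b :=
  (h.cut x a ha b hb hax hbx).mono_set fun _ h => h.2

/-- After a first attachment `x` is deleted, `v` still reaches a vertex of `W` other than `x`, and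
the walk enters `W` at a second attachment. -/
theorem BiConn.exists_two_att (h : BiConn g N) (hv : v ∈ N) (hvW : v ∉ W) (ha : a ∈ N)
    (hb : b ∈ N) (haW : a ∈ W) (hbW : b ∈ W) (hab : a ≠ b) :
    ∃ x y, x ≠ y ∧ Att g W v x ∧ Att g W v y := by
  obtain ⟨x, -, hx, -⟩ := (h.conn v hv a ha).exists_att hvW haW
  have key : ∃ c ∈ N, c ∈ W ∧ c ≠ x := by
    by_cases hax : a = x
    · exact ⟨b, hb, hbW, fun h => hab (hax.trans h.symm)⟩
    · exact ⟨a, ha, haW, hax⟩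
  obtain ⟨c, hc, hcW, hcx⟩ := key
  have hvx : v ≠ x := fun h => hvW (h ▸ hx.1)
  obtain ⟨y, hyx, hy, -⟩ := (h.linked hv hc hvx hcx).exists_att hvW hcW
  exact ⟨x, y, fun h => hyx h.symm, hx, hy⟩

/-- A cut-free finite set contains three pairwise adjacent connected subsets that contain three
given vertices. -/
theorem exists_rooted_triangle {D : Set U} (hD : D.Finite) (hx : x ∈ D) (hy : y ∈ D) (hv : v ∈ D)
    (hxy : x ≠ y) (hxv : x ≠ v) (hyv : y ≠ v)
    (h : ∀ z, ∀ a ∈ D, ∀ b ∈ D, a ≠ z → b ≠ z → Linked g (D \ {z}) a b) :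
    ∃ P Q R, x ∈ P ∧ y ∈ Q ∧ v ∈ R ∧ P ⊆ D ∧ Q ⊆ D ∧ R ⊆ D ∧ IsTriangle g P Q R := by
  have hC : Conn g (D \ {v}) :=
    .of_root (a := x) ⟨hx, hxv⟩ fun b hb => h v x hx b hb.1 hxv hb.2
  have key : ∀ z, ∃ a ∈ ({x, y} : Set U), ∃ b ∈ {b | g.Adj b v},
      Linked g ((D \ {v}) \ {z}) a b := by
    intro z
    have : ∃ a ∈ ({x, y} : Set U), a ≠ z := by
      by_cases hxz : x = z
      · exact ⟨y, by simp, fun h => hxy (hxz.trans h.symm)⟩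
      · exact ⟨x, by simp, hxz⟩
    obtain ⟨a, ha, haz⟩ := this
    have haD : a ∈ D ∧ a ≠ v := by rcases ha with rfl | rfl <;> exact ⟨by assumption, by assumption⟩
    -- For `z = v` nothing more than `v` is deleted from `D \ {v}`, so any walk in `D` to `v` will
    -- do. It is obtained by avoiding the other one of `x` and `y`.
    have hl : Linked g (D \ {z} ∪ {v}) a v := by
      by_cases hzv : z = v
      · subst hzv
        obtain ⟨c, hca, hcz⟩ : ∃ c, a ≠ c ∧ z ≠ c := by
          by_cases hax : a = x
          · exact ⟨y, hax ▸ hxy, hyv.symm⟩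
          · exact ⟨x, hax, hxv.symm⟩
        have hl := h c a haD.1 z hv hca hcz
        exact hl.mono_set fun w hw => by
          by_cases hwz : w = z
          · exact .inr hwz
          · exact .inl ⟨hw.1, hwz⟩
      · exact (h z a haD.1 v hv haz (Ne.symm hzv)).mono_set Set.subset_union_left
    obtain ⟨u, s, hu, hus, hs, -⟩ := hl.first_hit (S := {v}) haD.2 rfl
    rw [Set.mem_singleton_iff] at hs
    subst hs
    exact ⟨a, ha, u, hus, hu.mono_set fun w hw => by simp at hw ⊢; tauto⟩
  have : Nonempty U := ⟨x⟩
  obtain ⟨P, Q, hP, hQ, hPQ, cP, cQ, ⟨p, hpP, hp⟩, ⟨p', hp'P, hp'⟩, ⟨q, hqQ, hq⟩, ⟨q', hq'Q, hq'⟩⟩ :=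
    exists_two_linkages (D \ {v}) (hD.subset Set.sdiff_subset) _ _ key
  -- Each linkage contains one of `x`, `y` and a neighbour of `v`. After `P` has grown until it
  -- touches `Q`, the two sets and `{v}` form the triangle.
  obtain ⟨P', hPP', hP', cP', d', a'⟩ := hC.grow cP cQ hP hQ hPQ
  have hvP : Disjoint P' {v} := Set.disjoint_left.2 fun w hw => (hP' hw).2
  have hvQ : Disjoint Q {v} := Set.disjoint_left.2 fun w hw => (hQ hw).2
  have hPD : P' ⊆ D := fun w hw => (hP' hw).1
  have hQD : Q ⊆ D := fun w hw => (hQ hw).1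
  have hpq : p ≠ q := fun h => hPQ.le_bot ⟨hpP, h ▸ hqQ⟩
  have aP : ∃ x ∈ P', ∃ y ∈ ({v} : Set U), g.Adj x y := ⟨p', hPP' hp'P, v, rfl, hp'⟩
  have aQ : ∃ x ∈ Q, ∃ y ∈ ({v} : Set U), g.Adj x y := ⟨q', hq'Q, v, rfl, hq'⟩
  rcases hp with rfl | rfl <;> rcases hq with rfl | rfl
  · exact absurd rfl hpq
  · exact ⟨P', Q, {v}, hPP' hpP, hqQ, rfl, hPD, hQD, by simpa,
      cP', cQ, .singleton, d', hvP, hvQ, a', aP, aQ⟩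
  · exact ⟨Q, P', {v}, hqQ, hPP' hpP, rfl, hQD, hPD, by simpa,
      cQ, cP', .singleton, d'.symm, hvQ, hvP, exists_adj_symm a', aQ, aP⟩
  · exact absurd rfl hpq

end Biconnected

/-! ### Acyclic graphs exclude triangle minors -/

section Acyclic

variable {U : Type*} {g g' : SimpleGraph U} {N W X : Set U} {v u x y z a b c : U}

theorem linked_univ_iff : Linked g Set.univ a b ↔ g.Reachable a b := by
  constructor
  · intro h
    exact h.induct (P := fun b => g.Reachable a b) .rfl fun u w _ ih huw _ => ih.trans huw.reachable
  · rintro ⟨p⟩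
    induction p with
    | nil => exact .refl trivial
    | cons h _ ih => exact (Linked.of_adj (Set.mem_univ _) h (Set.mem_univ _)).trans ih

theorem Linked.reachable (h : Linked g X a b) : g.Reachable a b :=
  linked_univ_iff.1 (h.mono_set (Set.subset_univ _))

/-- A graph is acyclic if and only if the neighbours of each vertex `x` are in different components
of the graph without `x`. -/
theorem isAcyclic_iff_not_linked :
    g.IsAcyclic ↔ ∀ x y z, g.Adj x y → g.Adj x z → y ≠ z → ¬ Linked g {x}ᶜ y z := by
  rw [SimpleGraph.isAcyclic_iff_forall_adj_isBridge]
  constructor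
  · intro h x y z hxy hxz hyz hl
    have := h hxy
    rw [SimpleGraph.isBridge_iff] at this
    refine this ?_
    have h1 : (g.deleteEdges {s(x, y)}).Adj x z := by
      rw [SimpleGraph.deleteEdges_adj]
      refine ⟨hxz, fun h => hyz ?_⟩
      simp at h
      exact (h.resolve_right fun h => hxy.ne h.1).symm
    refine h1.reachable.trans ?_
    refine Linked.reachable (X := {x}ᶜ) (hl.symm.transfer id hl.right_mem fun u hu w hw huw _ => ?_)
    refine .of_adj hu ?_ hw
    rw [SimpleGraph.deleteEdges_adj]
    refine ⟨huw, fun h => ?_⟩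
    simp at h
    rcases h with ⟨rfl, -⟩ | ⟨-, rfl⟩
    · exact hu rfl
    · exact hw rfl
  · intro h x y hxy
    rw [SimpleGraph.isBridge_iff, ← linked_univ_iff]
    intro hl
    obtain ⟨u, s, hu, hus, hs, -⟩ := hl.symm.first_hit (S := {x}) hxy.ne' rfl
    rw [Set.mem_singleton_iff] at hs
    subst hs
    rw [SimpleGraph.deleteEdges_adj] at hus
    refine h s y u hxy hus.1.symm ?_ (hu.mono (SimpleGraph.deleteEdges_le _) fun w hw => hw.2)
    rintro rfl
    exact hus.2 (by simp [Sym2.eq_swap])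

/-- An edge between `P` and `Q` is not a bridge, because its ends are also joined by a detour
through `R`. -/
theorem IsTriangle.not_isAcyclic {P Q R : Set U} (h : IsTriangle g P Q R) : ¬ g.IsAcyclic := by
  rw [SimpleGraph.isAcyclic_iff_forall_adj_isBridge]
  intro hac
  obtain ⟨c1, c2, c3, d12, d13, d23, ⟨a, ha, b, hb, hab⟩, ⟨a', ha', c, hc, hac'⟩,
    ⟨b', hb', c', hc', hbc'⟩⟩ := h
  have := hac hab
  rw [SimpleGraph.isBridge_iff] at this
  rw [Set.disjoint_left] at d12 d13 d23
  have step : ∀ u w, g.Adj u w → (¬ (u ∈ P ∧ w ∈ Q)) → (¬ (u ∈ Q ∧ w ∈ P)) →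
      (g.deleteEdges {s(a, b)}).Adj u w := by
    intro u w huw h1 h2
    rw [SimpleGraph.deleteEdges_adj]
    refine ⟨huw, fun h => ?_⟩
    simp at h
    rcases h with ⟨rfl, rfl⟩ | ⟨rfl, rfl⟩
    · exact h1 ⟨ha, hb⟩
    · exact h2 ⟨hb, ha⟩
  have lift : ∀ X : Set U, (∀ u ∈ X, ∀ w ∈ X, ¬ (u ∈ P ∧ w ∈ Q)) → Conn g X →
      ∀ u ∈ X, ∀ w ∈ X, (g.deleteEdges {s(a, b)}).Reachable u w := by
    intro X hX cX u hu w hw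
    refine Linked.reachable (X := X) ((cX.2 u hu w hw).transfer id hu fun u hu w hw huw _ => ?_)
    exact .of_adj hu (step u w huw (hX u hu w hw) fun h => hX w hw u hu h.symm) hw
  refine this ?_
  refine (lift P (fun u hu w hw h => d12 hw h.2) c1 a ha a' ha').trans ?_
  refine (step a' c hac' (fun h => d23 h.2 hc) (fun h => d13 h.2 hc)).reachable.trans ?_
  refine (lift R (fun u hu w hw h => d13 h.1 hu) c3 c hc c' hc').trans ?_
  refine (step c' b' hbc'.symm (fun h => d13 h.1 hc') (fun h => d23 h.1 hc')).reachable.trans ?_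
  exact lift Q (fun u hu w hw h => d12 h.1 hu) c2 b' hb' b hb

/-- A graph that becomes acyclic when a vertex is removed has no `K₄` minor. -/
theorem not_hasKFour_of_isAcyclic {r : U} (h : g'.IsAcyclic)
    (hg : ∀ a b, a ≠ r → b ≠ r → g.Adj a b → g'.Adj a b) : ¬ HasKFour g := by
  rintro ⟨B, hB⟩
  -- At most one branch set contains `r`; three others form a triangle in the acyclic graph `g'`.
  have key : ∃ i j k : Fin 4, i ≠ j ∧ i ≠ k ∧ j ≠ k ∧ r ∉ B i ∧ r ∉ B j ∧ r ∉ B k := by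
    by_cases hr : ∃ l, r ∈ B l
    · obtain ⟨l, hl⟩ := hr
      have hn : ∀ i, i ≠ l → r ∉ B i := fun i hi h => (hB.disj i l hi).le_bot ⟨h, hl⟩
      refine ⟨l + 1, l + 2, l + 3, ?_, ?_, ?_, hn _ ?_, hn _ ?_, hn _ ?_⟩ <;>
        (clear hl hn; revert l; decide)
    · push Not at hr
      exact ⟨0, 1, 2, by decide, by decide, by decide, hr _, hr _, hr _⟩
  obtain ⟨i, j, k, hij, hik, hjk, hi, hj, hk⟩ := key
  obtain ⟨c1, c2, c3, d12, d13, d23, a12, a13, a23⟩ := hB.triangle hij hik hjk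
  have conn : ∀ l, r ∉ B l → Conn g (B l) → Conn g' (B l) := fun l hl hc =>
    ⟨hc.1, fun a ha b hb => (hc.2 a ha b hb).transfer id ha fun u hu w hw huw _ =>
      .of_adj hu (hg u w (fun h => hl (h ▸ hu)) (fun h => hl (h ▸ hw)) huw) hw⟩
  have adj : ∀ l m, r ∉ B l → r ∉ B m → (∃ x ∈ B l, ∃ y ∈ B m, g.Adj x y) →
      ∃ x ∈ B l, ∃ y ∈ B m, g'.Adj x y := by
    rintro l m hl hm ⟨x, hx, y, hy, hxy⟩
    exact ⟨x, hx, y, hy, hg x y (fun h => hl (h ▸ hx)) (fun h => hm (h ▸ hy)) hxy⟩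
  exact IsTriangle.not_isAcyclic ⟨conn i hi c1, conn j hj c2, conn k hk c3, d12, d13, d23,
    adj i j hi hj a12, adj i k hi hk a13, adj j k hj hk a23⟩ h

end Acyclic

/-! ### Translation of the definitions into statements about vertex sets -/

section Interface

variable {U V : Type*}

/-- Connectivity of induced graphs lives on (nested) subtypes. An injection `f` with image `X` moves
it to the ambient type, where sets can be united and compared. -/
theorem preconnected_iff_linked {h : SimpleGraph U} {g : SimpleGraph V} {f : U → V}
    (hf : Function.Injective f) (hadj : ∀ a b, h.Adj a b ↔ g.Adj (f a) (f b)) {X : Set V}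
    (hX : ∀ v, v ∈ X ↔ ∃ u, f u = v) :
    h.Preconnected ↔ ∀ a ∈ X, ∀ b ∈ X, Linked g X a b := by
  constructor
  · intro hp a ha b hb
    obtain ⟨a, rfl⟩ := (hX a).1 ha
    obtain ⟨b, rfl⟩ := (hX b).1 hb
    exact (linked_univ_iff.2 (hp a b)).transfer f ((hX _).2 ⟨a, rfl⟩) fun u _ w _ huw hu =>
      .of_adj hu ((hadj u w).1 huw) ((hX _).2 ⟨w, rfl⟩)
  · intro hl a b
    have := (hl (f a) ((hX _).2 ⟨a, rfl⟩) (f b) ((hX _).2 ⟨b, rfl⟩)).induct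
      (P := fun u => ∃ c, f c = u ∧ h.Reachable a c) ⟨a, rfl, .rfl⟩ (by
        rintro u w - ⟨c, rfl, hc⟩ huw hw
        obtain ⟨d, rfl⟩ := (hX _).1 hw
        exact ⟨d, rfl, hc.trans ((hadj _ _).2 huw).reachable⟩)
    obtain ⟨c, hc, h⟩ := this
    exact hf hc ▸ h

theorem induce_connected_iff {g : SimpleGraph U} {X : Set U} :
    (g.induce X).Connected ↔ Conn g X := by
  rw [SimpleGraph.connected_iff, preconnected_iff_linked (g := g) (f := Subtype.val) (X := X)
    Subtype.val_injective (fun a b => Iff.rfl) (fun v => by simp), Set.nonempty_coe_sort, and_comm]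
  rfl

theorem isSeriesParallel_iff {g : SimpleGraph U} : IsSeriesParallel g ↔ ¬ HasKFour g := by
  refine not_congr ⟨?_, ?_⟩
  · rintro ⟨B, h1, h2, h3⟩
    exact ⟨B, fun i => induce_connected_iff.1 (h1 i), h2, fun i j hij => h3 i j hij⟩
  · rintro ⟨B, h1, h2, h3⟩
    exact ⟨B, fun i => induce_connected_iff.2 (h1 i), h2, fun i j hij => h3 i j hij⟩

variable (D : LGraph V)

theorem coe_connected_iff : D.coe.Connected ↔ Conn D.spanningCoe D.verts := by
  rw [SimpleGraph.connected_iff, preconnected_iff_linked (g := D.spanningCoe) (f := Subtype.val)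
    (X := D.verts) Subtype.val_injective (fun a b => Iff.rfl) (fun v => by simp),
    Set.nonempty_coe_sort, and_comm]
  rfl

theorem isCutVertex_coe_iff (x : D.verts) : ¬ IsCutVertex D.coe x ↔
    ∀ a ∈ D.verts \ {x.1}, ∀ b ∈ D.verts \ {x.1}, Linked D.spanningCoe (D.verts \ {x.1}) a b := by
  rw [IsCutVertex, not_not, preconnected_iff_linked (g := D.spanningCoe)
    (f := fun u : ({x}ᶜ : Set D.verts) => ((u : D.verts) : V)) (X := D.verts \ {x.1})]
  · exact Subtype.val_injective.comp Subtype.val_injective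
  · exact fun a b => Iff.rfl
  · intro v
    constructor
    · rintro ⟨hv, hx⟩
      exact ⟨⟨⟨v, hv⟩, fun h => hx (congrArg Subtype.val h)⟩, rfl⟩
    · rintro ⟨u, rfl⟩
      exact ⟨u.1.2, fun h => u.2 (Subtype.ext h)⟩

theorem isBiconnected_coe_iff : IsBiconnected D.coe ↔ BiConn D.spanningCoe D.verts := by
  rw [IsBiconnected, coe_connected_iff, Set.nontrivial_coe_sort]
  constructor
  · rintro ⟨h1, h2, h3⟩
    refine ⟨h1, fun a b h => D.edge_vert h, h2.2, fun x a ha b hb hax hbx => ?_⟩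
    by_cases hx : x ∈ D.verts
    · exact (isCutVertex_coe_iff D ⟨x, hx⟩).1 (h3 _) a ⟨ha, hax⟩ b ⟨hb, hbx⟩
    · rw [Set.sdiff_singleton_eq_self hx]
      exact h2.2 a ha b hb
  · rintro ⟨h1, -, h2, h3⟩
    exact ⟨h1, ⟨h1.nonempty, h2⟩, fun x => (isCutVertex_coe_iff D x).2
      fun a ha b hb => h3 x a ha.1 b hb.1 ha.2 hb.2⟩

theorem coe_isSeriesParallel_iff : IsSeriesParallel D.coe ↔ ¬ HasKFour D.spanningCoe := by
  rw [isSeriesParallel_iff]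
  refine not_congr ⟨fun h => ?_, fun h => ?_⟩
  · exact h.map ⟨Subtype.val, fun {a b} h => h⟩ Subtype.val_injective
  · exact HasKFour.comap (f := fun v : D.verts => v.1) Subtype.val_injective
      (fun a b hab => ⟨⟨a, D.edge_vert hab⟩, rfl⟩) h

theorem sup_edgeGraph_spanningCoe {s t : V} (h : s ≠ t) :
    (D ⊔ edgeGraph s t h).spanningCoe = D.spanningCoe ⊔ SimpleGraph.edge s t := by
  ext a b
  simp only [SimpleGraph.Subgraph.spanningCoe_adj, SimpleGraph.Subgraph.sup_adj,
    SimpleGraph.sup_adj, edgeGraph, SimpleGraph.subgraphOfAdj_adj, SimpleGraph.edge_adj, Sym2.eq_iff]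
  grind

theorem sup_edgeGraph_verts {s t : V} (h : s ≠ t) (hs : s ∈ D.verts) (ht : t ∈ D.verts) :
    (D ⊔ edgeGraph s t h).verts = D.verts := by
  rw [SimpleGraph.Subgraph.verts_sup, Set.union_eq_left]
  simp [edgeGraph, Set.insert_subset_iff, hs, ht]

variable {D}

theorem isSPNetwork_iff {s t : V} : IsSPNetwork D s t ↔ D.verts.Finite ∧ s ∈ D.verts ∧ t ∈ D.verts ∧
    s ≠ t ∧ Conn D.spanningCoe D.verts ∧ BiConn (D.spanningCoe ⊔ SimpleGraph.edge s t) D.verts ∧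
      ¬ HasKFour (D.spanningCoe ⊔ SimpleGraph.edge s t) := by
  rw [IsSPNetwork, coe_connected_iff]
  refine and_congr_right fun _ => and_congr_right fun hs => and_congr_right fun ht => ?_
  constructor
  · rintro ⟨hc, h, hb, hk⟩
    rw [isBiconnected_coe_iff, sup_edgeGraph_spanningCoe, sup_edgeGraph_verts D h hs ht] at hb
    rw [coe_isSeriesParallel_iff, sup_edgeGraph_spanningCoe] at hk
    exact ⟨h, hc, hb, hk⟩
  · rintro ⟨h, hc, hb, hk⟩
    refine ⟨hc, h, ?_, ?_⟩
    · rwa [isBiconnected_coe_iff, sup_edgeGraph_spanningCoe, sup_edgeGraph_verts D h hs ht]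
    · rwa [coe_isSeriesParallel_iff, sup_edgeGraph_spanningCoe]

theorem sup_edge_adj {g : SimpleGraph V} {s t : V} (h : s ≠ t) :
    (g ⊔ SimpleGraph.edge s t).Adj s t :=
  .inr ((SimpleGraph.edge_adj ..).2 ⟨.inl ⟨rfl, rfl⟩, h⟩)

end Interface

/-! ### Good colours and a characterization of `ℬ_k` -/

section Apex

variable {k : ℕ} {V : Type*} {G : ColGraph k V} {c : Fin k}

theorem addApex_some {u w : G.graph.verts} :
    (G.addApex c).Adj (some u) (some w) ↔ G.graph.Adj u w := by
  simp only [ColGraph.addApex, SimpleGraph.fromRel_adj]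
  constructor
  · rintro ⟨-, h | h⟩
    · exact h
    · exact h.symm
  · exact fun h => ⟨fun e => h.ne (congrArg Subtype.val (Option.some_injective _ e)), .inl h⟩

theorem addApex_none {v : G.graph.verts} :
    (G.addApex c).Adj none (some v) ↔ (v : V) = G.root ∨ c ∈ G.col v := by
  simp [ColGraph.addApex, SimpleGraph.fromRel_adj]

theorem addApex_none' {v : G.graph.verts} :
    (G.addApex c).Adj (some v) none ↔ (v : V) = G.root ∨ c ∈ G.col v := by
  rw [SimpleGraph.adj_comm, addApex_none]

/-- The new vertex is adjacent to the root and to `v`, so in a `K₄` minor it can stand in for the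
edge between them. -/
theorem not_hasKFour_of_isGood (hg : G.IsGood c) {v : V} (hv : c ∈ G.col v) (hvr : G.root ≠ v) :
    ¬ HasKFour (G.graph.spanningCoe ⊔ SimpleGraph.edge G.root v) := by
  intro hK
  have hvG : v ∈ G.graph.verts := by
    by_contra h
    rw [G.col_eq_empty v h] at hv
    simp at hv
  rw [ColGraph.IsGood, isSeriesParallel_iff] at hg
  apply hg
  have h1 := HasKFour.comap (f := fun v : G.graph.verts => v.1) Subtype.val_injective (by
    rintro a b (hab | hab)
    · exact ⟨⟨a, G.graph.edge_vert hab⟩, rfl⟩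
    · rcases ((SimpleGraph.edge_adj ..).1 hab).1 with ⟨rfl, -⟩ | ⟨rfl, -⟩
      · exact ⟨⟨_, G.root_mem⟩, rfl⟩
      · exact ⟨⟨_, hvG⟩, rfl⟩) hK
  obtain ⟨B, h2⟩ := h1
  have h3 : IsKFour (G.graph.coe.map Function.Embedding.some ⊔
      SimpleGraph.edge (some ⟨G.root, G.root_mem⟩) (some ⟨v, hvG⟩)) (fun i => some '' B i) := by
    have hf : ∀ a b, ((G.graph.spanningCoe ⊔ SimpleGraph.edge G.root v).comap
        (fun v : G.graph.verts => v.1)).Adj a b → (G.graph.coe.map Function.Embedding.some ⊔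
      SimpleGraph.edge (some ⟨G.root, G.root_mem⟩) (some ⟨v, hvG⟩)).Adj (some a) (some b) := by
      rintro ⟨a, ha⟩ ⟨b, hb⟩ (hab | hab)
      · exact .inl ((SimpleGraph.map_adj ..).2 ⟨_, _, hab, rfl, rfl⟩)
      · refine .inr ?_
        rw [SimpleGraph.edge_adj] at hab ⊢
        simpa using hab
    refine ⟨fun i => (h2.conn i).map ⟨some, fun {a b} h => hf a b h⟩, fun i j hij =>
      (Set.disjoint_image_iff (Option.some_injective _)).2 (h2.disj i j hij), fun i j hij => ?_⟩
    obtain ⟨x, hx, y, hy, hxy⟩ := h2.adj i j hij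
    exact ⟨_, ⟨x, hx, rfl⟩, _, ⟨y, hy, rfl⟩, hf _ _ hxy⟩
  refine h3.replace_edge (Z := {none}) ?_ .singleton ?_ ⟨none, rfl, addApex_none'.2 (.inl rfl)⟩
    ⟨none, rfl, addApex_none'.2 (.inr hv)⟩
  · rintro a b hab
    obtain ⟨a, b, hab', rfl, rfl⟩ := (SimpleGraph.map_adj ..).1 hab
    exact addApex_some.2 hab'
  · intro i
    simp

/-- The new vertex has at most two neighbours, so it is not a branch set on its own. Hence every
branch set survives in the torso of the old vertices, whose only possible new edge joins the root to
`v`. -/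
theorem isGood_of_not_hasKFour {v : V} (hv : ∀ u, c ∈ G.col u → u = v)
    (hK : ¬ HasKFour (G.graph.spanningCoe ⊔ SimpleGraph.edge G.root v)) : G.IsGood c := by
  rw [ColGraph.IsGood, isSeriesParallel_iff]
  rintro ⟨B, hB⟩
  have hnone : ∀ a, (G.addApex c).Adj none a → ∃ b : G.graph.verts, a = some b ∧
      (b.1 = G.root ∨ b.1 = v) := by
    rintro (_ | b) hab
    · exact absurd hab (SimpleGraph.irrefl _)
    · exact ⟨b, rfl, (addApex_none.1 hab).imp_right (hv _)⟩
  have hmeet : ∀ i, (B i ∩ Set.range some).Nonempty := by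
    intro i
    by_contra hi
    have hsub : B i ⊆ {none} := by
      rintro (_ | b) hb
      · rfl
      · exact absurd ⟨some b, hb, b, rfl⟩ hi
    have key : ∀ j, i ≠ j → ∃ b : G.graph.verts, some b ∈ B j ∧ (b.1 = G.root ∨ b.1 = v) := by
      intro j hij
      obtain ⟨x, hx, y, hy, hxy⟩ := hB.adj i j hij
      rw [hsub hx] at hxy
      obtain ⟨b, rfl, hb⟩ := hnone y hxy
      exact ⟨b, hy, hb⟩
    have h3 : ∃ j k l : Fin 4, i ≠ j ∧ i ≠ k ∧ i ≠ l ∧ j ≠ k ∧ j ≠ l ∧ k ≠ l := by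
      clear hi hsub key; revert i; decide
    obtain ⟨j, k, l, hij, hik, hil, hjk, hjl, hkl⟩ := h3
    obtain ⟨b1, h1, h1'⟩ := key j hij
    obtain ⟨b2, h2, h2'⟩ := key k hik
    obtain ⟨b3, h3, h3'⟩ := key l hil
    have ne : ∀ j k, j ≠ k → ∀ b b' : G.graph.verts, some b ∈ B j → some b' ∈ B k → b.1 ≠ b'.1 := by
      intro j k hjk b b' hb hb' h
      exact (hB.disj j k hjk).le_bot ⟨hb, Subtype.ext h ▸ hb'⟩
    have n1 := ne j k hjk b1 b2 h1 h2
    have n2 := ne j l hjl b1 b3 h1 h3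
    have n3 := ne k l hkl b2 b3 h2 h3
    grind
  have h1 := hB.torso hmeet
  have h2 := HasKFour.comap (g := torso (G.addApex c) (Set.range some))
    (f := fun v : G.graph.verts => some v) (Option.some_injective _) (fun a b hab => hab.2.1) h1
  refine hK (h2.map ⟨Subtype.val, ?_⟩ Subtype.val_injective)
  rintro a b ⟨hne, -, -, hab | ⟨x, hxa, hxb⟩⟩
  · exact .inl (addApex_some.1 hab)
  · refine .inr ?_
    have hx : ∀ a : G.graph.verts, Att (G.addApex c) (Set.range some) x (some a) →
        a.1 = G.root ∨ a.1 = v := by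
      rintro a ⟨-, u, hu, hua⟩
      rcases u with _ | u
      · exact (addApex_none.1 hua).imp_right (hv _)
      · exact absurd ⟨u, rfl⟩ hu.right_mem
    have hne' : a.1 ≠ b.1 := fun h => hne (by rw [Subtype.ext h])
    rw [SimpleGraph.edge_adj]
    have := hx a hxa
    have := hx b hxb
    exact ⟨by grind, hne'⟩

/-- A good colour of a biconnected graph is the colour of at most one vertex besides the root. -/
theorem eq_of_isGood (hg : G.IsGood c) (hb : BiConn G.graph.spanningCoe G.graph.verts) {u v : V}
    (hu : c ∈ G.col u) (hv : c ∈ G.col v) (hur : G.root ≠ u) (hvr : G.root ≠ v) : u = v := by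
  by_contra huv
  have mem : ∀ v, c ∈ G.col v → v ∈ G.graph.verts := fun v hv => by
    by_contra h
    rw [G.col_eq_empty v h] at hv
    simp at hv
  -- If `u ≠ v`, a triangle rooted at the root, `u` and `v` becomes a `K₄` minor with the new vertex
  -- as the fourth branch set.
  obtain ⟨P, Q, R, hxP, hyQ, hvR, hP, hQ, hR, hT⟩ := exists_rooted_triangle (g := G.graph.spanningCoe)
    G.finite G.root_mem (mem u hu) (mem v hv) hur hvr huv fun z a ha b hb' => hb.cut z a ha b hb'
  rw [ColGraph.IsGood, isSeriesParallel_iff] at hg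
  apply hg
  have cm : ∀ X ⊆ G.graph.verts, Conn G.graph.spanningCoe X →
      Conn (G.addApex c) {a | ∃ b : G.graph.verts, a = some b ∧ b.1 ∈ X} := by
    intro X hX hc
    refine ⟨?_, ?_⟩
    · obtain ⟨x, hx⟩ := hc.1
      exact ⟨some ⟨x, hX hx⟩, _, rfl, hx⟩
    · rintro _ ⟨a, rfl, ha⟩ _ ⟨b, rfl, hb⟩
      have := Linked.comap (f := fun v : G.graph.verts => v.1) Subtype.val_injective
        (fun a b hab => ⟨⟨a, G.graph.edge_vert hab⟩, rfl⟩) (hc.2 a ha b hb)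
      exact this.transfer some ⟨a, rfl, ha⟩ fun u hu w hw huw _ =>
        .of_adj ⟨u, rfl, hu⟩ (addApex_some.2 huw) ⟨w, rfl, hw⟩
  have dm : ∀ X Y : Set V, Disjoint X Y →
      Disjoint {a | ∃ b : G.graph.verts, a = some b ∧ b.1 ∈ X}
        {a | ∃ b : G.graph.verts, a = some b ∧ b.1 ∈ Y} := by
    intro X Y h
    rw [Set.disjoint_left] at h ⊢
    rintro _ ⟨b, rfl, hb⟩ ⟨b', hbb', hb'⟩
    rw [Option.some_injective _ hbb'] at hb
    exact h hb hb'
  have am : ∀ X Y : Set V, (∃ x ∈ X, ∃ y ∈ Y, G.graph.spanningCoe.Adj x y) →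
      ∃ x ∈ {a | ∃ b : G.graph.verts, a = some b ∧ b.1 ∈ X},
        ∃ y ∈ {a | ∃ b : G.graph.verts, a = some b ∧ b.1 ∈ Y}, (G.addApex c).Adj x y := by
    rintro X Y ⟨x, hx, y, hy, hxy⟩
    have hxy' : G.graph.Adj x y := hxy
    exact ⟨some ⟨x, hxy'.fst_mem⟩, ⟨_, rfl, hx⟩, some ⟨y, hxy'.snd_mem⟩, ⟨_, rfl, hy⟩,
      addApex_some.2 hxy⟩
  obtain ⟨c1, c2, c3, d12, d13, d23, a12, a13, a23⟩ := hT
  have hT' : IsTriangle (G.addApex c) _ _ _ := ⟨cm P hP c1, cm Q hQ c2, cm R hR c3, dm _ _ d12,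
    dm _ _ d13, dm _ _ d23, am _ _ a12, am _ _ a13, am _ _ a23⟩
  have dn : ∀ X : Set V, Disjoint {a | ∃ b : G.graph.verts, a = some b ∧ b.1 ∈ X}
      ({none} : Set (Option G.graph.verts)) := by
    intro X
    rw [Set.disjoint_left]
    rintro _ ⟨b, rfl, hb⟩ h
    simp at h
  refine hT'.hasKFour (S := {none}) .singleton (dn _) (dn _) (dn _) ?_ ?_ ?_
  · exact ⟨some ⟨G.root, G.root_mem⟩, ⟨_, rfl, hxP⟩, none, rfl, addApex_none'.2 (.inl rfl)⟩
  · exact ⟨some ⟨u, mem u hu⟩, ⟨_, rfl, hyQ⟩, none, rfl, addApex_none'.2 (.inr hu)⟩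
  · exact ⟨some ⟨v, mem v hv⟩, ⟨_, rfl, hvR⟩, none, rfl, addApex_none'.2 (.inr hv)⟩

/-- The coloured graphs in `ℬ_k`: their underlying graph is biconnected, there is exactly one vertex
of each colour `c`, and joining it to the root yields no `K₄` minor. -/
theorem mem_blocks_iff : G ∈ blocks k V ↔ BiConn G.graph.spanningCoe G.graph.verts ∧
    G.col G.root = ∅ ∧ (∀ v, (G.col v).card ≤ 1) ∧
    ∃ f : Fin k → V, ∀ c, (∀ u, c ∈ G.col u ↔ u = f c) ∧
      ¬ HasKFour (G.graph.spanningCoe ⊔ SimpleGraph.edge G.root (f c)) := by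
  constructor
  · rintro ⟨hT, hb, hcol⟩
    rw [isBiconnected_coe_iff] at hb
    refine ⟨hb, hT.root_uncoloured, hcol, ?_⟩
    have key : ∀ c : Fin k, ∃ v, (∀ u, c ∈ G.col u ↔ u = v) ∧
        ¬ HasKFour (G.graph.spanningCoe ⊔ SimpleGraph.edge G.root v) := by
      intro c
      have hr : ∀ u, c ∈ G.col u → G.root ≠ u := by
        rintro u hu rfl
        rw [hT.root_uncoloured] at hu
        simp at hu
      have hc : c ∈ {c | ∃ v ∈ G.graph.verts, c ∈ G.col v} := by
        rw [hT.colours]; trivial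
      obtain ⟨v, hv, hcv⟩ := hc
      have hg := hT.good c trivial
      refine ⟨v, fun u => ⟨fun hu => eq_of_isGood hg hb hu hcv (hr u hu) (hr v hcv), ?_⟩,
        not_hasKFour_of_isGood hg hcv (hr v hcv)⟩
      rintro rfl
      exact hcv
    choose f hf using key
    exact ⟨f, hf⟩
  · rintro ⟨hb, hr, hcol, f, hf⟩
    have hb' := (isBiconnected_coe_iff _).2 hb
    refine ⟨⟨?_, ?_, hb'.2.1, ?_, hr, hb'.2.2 _, ?_⟩, hb', hcol⟩
    · refine Set.eq_univ_of_forall fun c => ?_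
      have hc := ((hf c).1 (f c)).2 rfl
      refine ⟨f c, ?_, hc⟩
      by_contra h
      rw [G.col_eq_empty _ h] at hc
      simp at hc
    · intro c _
      exact isGood_of_not_hasKFour (fun u hu => ((hf c).1 u).1 hu) (hf c).2
    · intro x hx
      exact absurd hx (hb'.2.2 x)
    · obtain ⟨v, hv, hne⟩ := hb.nontrivial.exists_ne G.root
      exact ⟨v, hv, hne⟩

end Apex

/-! ### Subdividing and suppressing vertices of forests -/

section Acyclic

variable {V : Type*} {T : SimpleGraph V} {x y z a b : V}

theorem not_reachable_of_isolated (hz : ∀ a, ¬ T.Adj z a) (hxz : x ≠ z) : ¬ T.Reachable x z := by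
  rw [← linked_univ_iff]
  intro h
  obtain ⟨u, s, -, hus, hs, -⟩ := h.first_hit (S := {z}) hxz rfl
  rw [Set.mem_singleton_iff] at hs
  exact hz u (hs ▸ hus.symm)

/-- Without its bridge `xy`, the forest has `x` and `y` in different components, and `z` is
isolated. Each of the two new edges joins different components. -/
theorem isAcyclic_subdivide (h : T.IsAcyclic) (hxy : T.Adj x y) (hz : ∀ a, ¬ T.Adj z a) :
    (T.deleteEdges {s(x, y)} ⊔ SimpleGraph.edge x z ⊔ SimpleGraph.edge z y).IsAcyclic := by
  set T₁ := T.deleteEdges {s(x, y)} with hT1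
  have hle : T₁ ≤ T := SimpleGraph.deleteEdges_le _
  have hxz : x ≠ z := fun e => hz y (e ▸ hxy)
  have hyz : y ≠ z := fun e => hz x (e ▸ hxy.symm)
  have hbr : ¬ T₁.Reachable x y :=
    SimpleGraph.isBridge_iff.1 (SimpleGraph.isAcyclic_iff_forall_adj_isBridge.1 h hxy)
  have ac1 : (T₁ ⊔ SimpleGraph.edge x z).IsAcyclic :=
    (h.anti hle).sup_edge_of_not_reachable fun h' =>
      not_reachable_of_isolated hz hxz (h'.mono hle)
  refine ac1.sup_edge_of_not_reachable ?_
  rw [← linked_univ_iff]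
  intro hl
  obtain ⟨u, s, hu, hus, hs, -⟩ := hl.symm.first_hit (S := {z}) hyz rfl
  rw [Set.mem_singleton_iff] at hs
  subst hs
  have hux : u = x := by
    rcases hus with hus | hus
    · exact absurd (hle hus.symm) (hz u)
    · have := (SimpleGraph.edge_adj ..).1 hus
      grind
  subst hux
  refine hbr (Linked.reachable (X := Set.univ \ {s}) (hu.symm.transfer id hu.right_mem ?_))
  intro p hp q hq hpq _
  refine .of_adj hp (hpq.resolve_right fun hpq => ?_) hq
  rcases ((SimpleGraph.edge_adj ..).1 hpq).1 with ⟨-, h⟩ | ⟨h, -⟩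
  · exact hq.2 h
  · exact hp.2 h

/-- Once `z` is isolated, its former neighbours `a` and `b` lie in different components, so joining
them closes no cycle. -/
theorem isAcyclic_suppress (h : T.IsAcyclic) (ha : T.Adj z a) (hb : T.Adj z b) (hab : a ≠ b) :
    (T.deleteIncidenceSet z ⊔ SimpleGraph.edge a b).IsAcyclic := by
  refine (h.anti (SimpleGraph.deleteIncidenceSet_le _ _)).sup_edge_of_not_reachable ?_
  rw [← linked_univ_iff]
  intro hl
  refine isAcyclic_iff_not_linked.1 h z a b ha hb hab ?_
  exact hl.transfer id ha.ne' fun u _ w _ huw hu => by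
    rw [SimpleGraph.deleteIncidenceSet_adj] at huw
    exact .of_adj hu huw.1 huw.2.2

end Acyclic

/-! ### Loose decompositions, their extension by one vertex, and their pieces -/

section Loose

variable {V : Type*} {g : SimpleGraph V} {N W W' S X : Set V} {r u v w x y z a b c : V}

theorem Att.mono (h : Att g W' v a) (hW : W ⊆ W') (ha : a ∈ W) : Att g W v a :=
  ⟨ha, h.2.imp fun _ hu => ⟨hu.1.mono_set (Set.compl_subset_compl.2 hW), hu.2⟩⟩

/-- Each vertex outside `W` has at most two attachments. -/
def TwoAtt (g : SimpleGraph V) (W : Set V) : Prop :=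
  ∀ v, ∃ x y, ∀ a, Att g W v a → a = x ∨ a = y

theorem TwoAtt.eq_or_eq (h : TwoAtt g W) (ha : Att g W v a) (hb : Att g W v b) (hab : a ≠ b)
    (hc : Att g W v c) : c = a ∨ c = b := by
  obtain ⟨x, y, hxy⟩ := h v
  have := hxy a ha
  have := hxy b hb
  have := hxy c hc
  grind

/-- The torso of `W` without the root. -/
def tree (g : SimpleGraph V) (W : Set V) (r : V) : SimpleGraph V :=
  (torso g W).deleteIncidenceSet r

theorem tree_adj : (tree g W r).Adj a b ↔ (torso g W).Adj a b ∧ a ≠ r ∧ b ≠ r := by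
  rw [tree, SimpleGraph.deleteIncidenceSet_adj]

/-- The set `W` of vertices decomposes the graph `g` into pieces with two poles that are arranged
along a tree, after removal of the root `r`. -/
structure Loose (g : SimpleGraph V) (r : V) (W : Set V) : Prop where
  root_mem : r ∈ W
  two : TwoAtt g W
  acyclic : (tree g W r).IsAcyclic

/-- This is the start of the refinement: without `r`, the torso has no edges. -/
theorem Loose.pair : Loose g r {r, x} := by
  refine ⟨.inl rfl, fun v => ⟨r, x, fun a ha => ha.1⟩, ?_⟩
  rw [isAcyclic_iff_not_linked]
  intro a b c hab _ _ _
  obtain ⟨⟨hne, ha, hb, -⟩, har, hbr⟩ := tree_adj.1 hab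
  simp_all

theorem tree_not_reachable (hx : x ∉ W) (hy : y ∈ W) : ¬ (tree g W r).Reachable y x :=
  not_reachable_of_isolated (fun _ h => hx (tree_adj.1 h).1.2.1) fun e => hx (e ▸ hy)

/-- A component outside `insert z W` that is attached to `z` merges with `z` outside `W`, so its
other attachments are attachments of `z`. -/
theorem Att.of_insert (h : Att g (insert z W) v z) (ha : Att g (insert z W) v a) (ha' : a ∈ W)
    (hz : z ∉ W) : Att g W z a := by
  obtain ⟨-, u, hu, huz⟩ := h
  have : Linked g Wᶜ v u := hu.mono_set (Set.compl_subset_compl.2 (Set.subset_insert _ _))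
  exact (ha.mono (Set.subset_insert _ _) ha').of_linked
    ((Linked.of_adj hz huz.symm this.right_mem).trans this.symm)

/-- The attachments of a component attached to the new vertex `z` are among `z`, `x`, `y`, and `hs`
excludes that all three occur. Other components get no new attachments. -/
theorem TwoAtt.insert (h : TwoAtt g W) (hzW : z ∉ W) (hz : ∀ a, Att g W z a → a = x ∨ a = y)
    (hs : ∀ u, Att g (insert z W) u z → Att g (insert z W) u x → ¬ Att g (insert z W) u y) :
    TwoAtt g (insert z W) := by
  intro u
  by_cases hu : Att g (Insert.insert z W) u z
  · have key : ∀ a, Att g (Insert.insert z W) u a → a = z ∨ a = x ∨ a = y := by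
      intro a ha
      rcases ha.1 with rfl | haW
      · exact .inl rfl
      · exact .inr (hz a (hu.of_insert ha haW hzW))
    by_cases hx : Att g (Insert.insert z W) u x
    · refine ⟨z, x, fun a ha => ?_⟩
      rcases key a ha with h | h | h
      · exact .inl h
      · exact .inr h
      · exact absurd (h ▸ ha) (hs u hu hx)
    · refine ⟨z, y, fun a ha => ?_⟩
      rcases key a ha with h | h | h
      · exact .inl h
      · exact absurd (h ▸ ha) hx
      · exact .inr h
  · obtain ⟨p, q, hpq⟩ := h u
    refine ⟨p, q, fun a ha => ?_⟩
    rcases ha.1 with rfl | haW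
    · exact absurd ha hu
    · exact hpq a (ha.mono (Set.subset_insert _ _) haW)

theorem torso_insert (h : (torso g (insert z W)).Adj a b) (hzW : z ∉ W) :
    (torso g W).Adj a b ∨ (a = z ∧ Att g W z b) ∨ (b = z ∧ Att g W z a) := by
  obtain ⟨hne, ha, hb, h⟩ := h
  rcases ha with rfl | ha <;> rcases hb with rfl | hb
  · exact absurd rfl hne
  · refine .inr (.inl ⟨rfl, ?_⟩)
    rcases h with h | ⟨v, h1, h2⟩
    · exact .of_adj hzW hb h
    · exact h1.of_insert h2 hb hzW
  · refine .inr (.inr ⟨rfl, ?_⟩)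
    rcases h with h | ⟨v, h1, h2⟩
    · exact .of_adj hzW ha h.symm
    · exact h2.of_insert h1 ha hzW
  · exact .inl ⟨hne, ha, hb, h.imp_right fun ⟨v, h1, h2⟩ =>
      ⟨v, h1.mono (Set.subset_insert _ _) ha, h2.mono (Set.subset_insert _ _) hb⟩⟩

/-- A cut vertex `z` of a piece with the poles `x` and `r` is joined to at most `x` in the tree,
since `r` is deleted there. -/
theorem Loose.insert_leaf (h : Loose g r W) (hzW : z ∉ W) (hxW : x ∈ W)
    (hz : ∀ a, Att g W z a → a = x ∨ a = r)
    (hs : ∀ u, Att g (insert z W) u z → Att g (insert z W) u x → ¬ Att g (insert z W) u r) :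
    Loose g r (insert z W) := by
  refine ⟨.inr h.root_mem, h.two.insert hzW hz hs, ?_⟩
  refine (h.acyclic.sup_edge_of_not_reachable (tree_not_reachable hzW hxW)).anti ?_
  intro a b hab
  obtain ⟨hab, har, hbr⟩ := tree_adj.1 hab
  rcases torso_insert hab hzW with h | ⟨rfl, h⟩ | ⟨rfl, h⟩
  · exact .inl (tree_adj.2 ⟨h, har, hbr⟩)
  · rcases hz _ h with rfl | rfl
    · exact .inr ((SimpleGraph.edge_adj ..).2 ⟨.inr ⟨rfl, rfl⟩, hab.ne⟩)
    · exact absurd rfl hbr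
  · rcases hz _ h with rfl | rfl
    · exact .inr ((SimpleGraph.edge_adj ..).2 ⟨.inl ⟨rfl, rfl⟩, hab.ne⟩)
    · exact absurd rfl har

/-- Here `z` subdivides the tree edge `xy`. By `hs` that edge disappears, and no component is
attached to both `x` and `y` any more. -/
theorem Loose.insert_middle (h : Loose g r W) (hzW : z ∉ W) (hxr : x ≠ r) (hyr : y ≠ r)
    (hxy : x ≠ y) (hx : Att g W z x) (hy : Att g W z y)
    (hs : ¬ (torso g (insert z W)).Adj x y) : Loose g r (insert z W) := by
  have hz : ∀ a, Att g W z a → a = x ∨ a = y := fun a => h.two.eq_or_eq hx hy hxy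
  refine ⟨.inr h.root_mem, h.two.insert hzW hz fun u _ h1 h2 =>
    hs ⟨hxy, h1.1, h2.1, .inr ⟨u, h1, h2⟩⟩, ?_⟩
  set T := tree g W r with hT
  have hTxy : T.Adj x y := tree_adj.2 ⟨⟨hxy, hx.1, hy.1, .inr ⟨z, hx, hy⟩⟩, hxr, hyr⟩
  have hz' : ∀ a, ¬ T.Adj z a := fun a h' => hzW (tree_adj.1 h').1.2.1
  refine (isAcyclic_subdivide h.acyclic hTxy hz').anti ?_
  intro a b hab
  obtain ⟨hab, har, hbr⟩ := tree_adj.1 hab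
  rcases torso_insert hab hzW with h | ⟨rfl, h⟩ | ⟨rfl, h⟩
  · refine .inl (.inl ?_)
    rw [SimpleGraph.deleteEdges_adj]
    refine ⟨tree_adj.2 ⟨h, har, hbr⟩, fun he => ?_⟩
    simp only [Set.mem_singleton_iff, Sym2.eq_iff] at he
    rcases he with ⟨rfl, rfl⟩ | ⟨rfl, rfl⟩
    · exact hs hab
    · exact hs hab.symm
  · rcases hz _ h with rfl | rfl
    · exact .inl (.inr ((SimpleGraph.edge_adj ..).2 ⟨.inr ⟨rfl, rfl⟩, hab.ne⟩))
    · exact .inr ((SimpleGraph.edge_adj ..).2 ⟨.inl ⟨rfl, rfl⟩, hab.ne⟩)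
  · rcases hz _ h with rfl | rfl
    · exact .inl (.inr ((SimpleGraph.edge_adj ..).2 ⟨.inl ⟨rfl, rfl⟩, hab.ne⟩))
    · exact .inr ((SimpleGraph.edge_adj ..).2 ⟨.inr ⟨rfl, rfl⟩, hab.ne⟩)

theorem BiConn.mem_of_linked (h : BiConn g N) (ha : a ∈ N) (hl : Linked g X a b) : b ∈ N :=
  hl.mem_of_closed ha fun _ _ _ _ huw => h.supp _ _ huw.symm

theorem BiConn.att_mem (h : BiConn g N) (ha : Att g W v a) : a ∈ N := by
  obtain ⟨-, u, -, hua⟩ := ha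
  exact h.supp _ _ hua.symm

/-- A piece with the poles `x` and the root `r` is separated by one of its vertices, unless joining
`r` to another vertex yields a `K₄` minor. -/
theorem exists_cut_of_root_piece (hN : N.Finite) (hB : BiConn g N) (hrW : r ∈ W) (ha : a ∈ W)
    (haN : a ∈ N) (har : a ≠ r) (hK : ¬ HasKFour (g ⊔ SimpleGraph.edge r a)) (hv : v ∈ N)
    (hxr : x ≠ r) (hx : Att g W v x) (hr : Att g W v r) (hatt : ∀ a, Att g W v a → a = x ∨ a = r) :
    ∃ z ∈ comp g Wᶜ v, ∀ u w, Linked g (comp g Wᶜ v \ {z}) u w → g.Adj u x → ¬ g.Adj w r := by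
  by_contra! hcon
  set C := comp g Wᶜ v with hC
  have hvW : v ∉ W := hx.notMem
  have hCW : ∀ u ∈ C, u ∉ W := fun u hu => comp_subset hu
  have hCconn : Conn g C := .comp hvW
  have hxW : x ∈ W := hx.1
  have hcl : ∀ u ∈ C, ∀ w, g.Adj u w → w ∈ C ∨ w = x ∨ w = r := by
    intro u hu w huw
    by_cases hw : w ∈ W
    · exact .inr (hatt w ⟨hw, u, hu, huw⟩)
    · exact .inl (Linked.tail hu huw hw)
  -- The absence of a cut vertex is Menger's condition for the neighbours of `x` and the neighbours
  -- of `r` in the component `C`.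
  have hmenger : ∀ z, ∃ a ∈ {u | g.Adj u x}, ∃ b ∈ {u | g.Adj u r}, Linked g (C \ {z}) a b := by
    intro z
    by_cases hz : z ∈ C
    · obtain ⟨u, w, hl, h1, h2⟩ := hcon z hz
      exact ⟨u, h1, w, h2, hl⟩
    · obtain ⟨-, u, hu, hux⟩ := hx
      obtain ⟨-, w, hw, hwr⟩ := hr
      rw [Set.sdiff_singleton_eq_self hz]
      exact ⟨u, hux, w, hwr, hCconn.2 u hu w hw⟩
  have : Nonempty V := ⟨v⟩
  obtain ⟨P, Q, hP, hQ, hPQ, cP, cQ, ⟨p, hpP, hp⟩, ⟨p', hp'P, hp'⟩, ⟨q, hqQ, hq⟩, ⟨q', hq'Q, hq'⟩⟩ :=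
    exists_two_linkages C (hN.subset fun u hu => hB.mem_of_linked hv hu) _ _ hmenger
  obtain ⟨P', hPP', hP', cP', d', a'⟩ := hCconn.grow cP cQ hP hQ hPQ
  -- The third set is what hangs on `x` outside the piece. It contains `a`: a walk from `x` to `a`
  -- that avoids `r` can leave `C` only through `x`.
  set Y := comp g (C ∪ {r})ᶜ x with hY
  have hxY : x ∈ Y := self_mem_comp (by
    rintro (h | h)
    · exact hCW x h hxW
    · exact hxr h)
  have haY : a ∈ Y := by
    have h1 : Linked g {r}ᶜ x a := hB.linked (hB.att_mem hx) haN hxr har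
    have h2 := h1.mem_of_closed (S := Y ∪ C) (.inl hxY) (by
      rintro u (hu | hu) w hw huw
      · by_cases hwC : w ∈ C
        · exact .inr hwC
        · exact .inl (Linked.tail hu huw fun h => h.elim hwC hw)
      · rcases hcl u hu w huw with h | rfl | h
        · exact .inr h
        · exact .inl hxY
        · exact absurd h hw)
    exact h2.resolve_right fun h => hCW a h ha
  have hYd : ∀ X ⊆ C, Disjoint X Y := fun X hX => Set.disjoint_left.2 fun u hu huY =>
    comp_subset huY (.inl (hX hu))
  have hrd : ∀ X ⊆ C, Disjoint X {r} := fun X hX => Set.disjoint_left.2 fun u hu huY =>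
    hCW u (hX hu) (Set.mem_singleton_iff.1 huY ▸ hrW)
  have hle : g ≤ g ⊔ SimpleGraph.edge r a := le_sup_left
  have up : ∀ P Q : Set V, (∃ x ∈ P, ∃ y ∈ Q, g.Adj x y) →
      ∃ x ∈ P, ∃ y ∈ Q, (g ⊔ SimpleGraph.edge r a).Adj x y := fun P Q ⟨x, hx, y, hy, h⟩ =>
    ⟨x, hx, y, hy, .inl h⟩
  have hT : IsTriangle (g ⊔ SimpleGraph.edge r a) P' Q Y :=
    ⟨cP'.mono hle, cQ.mono hle, (Conn.comp hxY.1).mono hle, d', hYd _ hP', hYd _ hQ, up _ _ a',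
      up _ _ ⟨p, hPP' hpP, x, hxY, hp⟩, up _ _ ⟨q, hqQ, x, hxY, hq⟩⟩
  -- Both linkages contain neighbours of `r`, and `Y` is joined to `r` by the added edge `ra`.
  refine hK (hT.hasKFour (S := {r}) .singleton (hrd _ hP') (hrd _ hQ) ?_
    (up _ _ ⟨p', hPP' hp'P, r, rfl, hp'⟩) (up _ _ ⟨q', hq'Q, r, rfl, hq'⟩)
    ⟨a, haY, r, rfl, (sup_edge_adj har.symm).symm⟩)
  exact Set.disjoint_left.2 fun u hu hur => comp_subset hu (.inr hur)

/-- The piece with the poles `x` and `y`. -/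
def piece (g : SimpleGraph V) (W : Set V) (x y : V) : Set V :=
  {u | u = x ∨ u = y ∨ (Att g W u x ∧ Att g W u y)}

theorem piece_comm : piece g W x y = piece g W y x := by
  ext u
  simp only [piece, Set.mem_ofPred_eq]
  tauto

/-- The attachments `x` and `y` of `u` are its only ones, so the interior of a piece can be left
only through a pole. -/
theorem TwoAtt.piece_closed (h : TwoAtt g W) (hxy : x ≠ y) (hux : Att g W u x) (huy : Att g W u y)
    (huw : g.Adj u w) : w = x ∨ w = y ∨ (Att g W w x ∧ Att g W w y) := by
  by_cases hw : w ∈ W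
  · rcases h.eq_or_eq hux huy hxy (.of_adj hux.notMem hw huw) with h | h
    · exact .inl h
    · exact .inr (.inl h)
  · have := Linked.of_adj (X := Wᶜ) hw huw.symm hux.notMem
    exact .inr (.inr ⟨hux.of_linked this, huy.of_linked this⟩)

theorem TwoAtt.linked_piece (h : TwoAtt g W) (hxy : x ≠ y) (hux : Att g W u x) (huy : Att g W u y)
    (hl : Linked g X u w) (hX : ∀ p ∈ X, p ≠ x ∧ p ≠ y) :
    Linked g (X ∩ piece g W x y) u w ∧ Att g W w x ∧ Att g W w y := by
  refine hl.induct (P := fun w => Linked g (X ∩ piece g W x y) u w ∧ Att g W w x ∧ Att g W w y)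
    ⟨.refl ⟨hl.1, .inr (.inr ⟨hux, huy⟩)⟩, hux, huy⟩ ?_
  intro p q _ ⟨h1, h2, h3⟩ hpq hq
  rcases h.piece_closed hxy h2 h3 hpq with h' | h' | h'
  · exact absurd h' (hX q hq).1
  · exact absurd h' (hX q hq).2
  · exact ⟨h1.tail hpq ⟨hq, .inr (.inr h')⟩, h'⟩

/-- From each vertex of a piece, one can reach one of the poles while avoiding `z`. -/
theorem BiConn.exists_linked_pole (hB : BiConn g N) (h : TwoAtt g W) (hxN : x ∈ N) (hyN : y ∈ N)
    (hxy : x ≠ y) (ha : a ∈ piece g W x y) (haz : a ≠ z) :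
    ∃ s, (s = x ∨ s = y) ∧ s ≠ z ∧ Linked g (piece g W x y \ {z}) a s := by
  by_cases hax : a = x
  · exact ⟨a, .inl hax, haz, .refl ⟨ha, haz⟩⟩
  by_cases hay : a = y
  · exact ⟨a, .inr hay, haz, .refl ⟨ha, haz⟩⟩
  obtain ⟨h1, h2⟩ := (ha.resolve_left hax).resolve_left hay
  have haN : a ∈ N := by
    obtain ⟨-, u, hu, hux⟩ := h1
    exact hB.mem_of_linked (hB.supp _ _ hux) hu.symm
  obtain ⟨t, ht, htz, htN⟩ : ∃ t ∈ ({x, y} : Set V), t ≠ z ∧ t ∈ N := by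
    by_cases hxz : x = z
    · exact ⟨y, by simp, fun h => hxy (hxz.trans h.symm), hyN⟩
    · exact ⟨x, by simp, hxz, hxN⟩
  obtain ⟨u, s, hu, hus, hs, hsz⟩ := (hB.linked haN htN haz htz).first_hit (S := {x, y})
    (by simp [hax, hay]) ht
  obtain ⟨h3, -⟩ := h.linked_piece hxy h1 h2 hu fun p hp => by
    have := hp.2
    simp at this
    exact this
  have hs' : s ∈ piece g W x y := by
    rcases hs with rfl | rfl
    · exact .inl rfl
    · exact .inr (.inl rfl)
  exact ⟨s, hs, hsz, (h3.mono_set (Y := piece g W x y \ {z}) fun p hp => ⟨hp.2, hp.1.1⟩).tail hus ⟨hs', hsz⟩⟩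

theorem TwoAtt.linked_poles (h : TwoAtt g W) (hxy : x ≠ y) (hX : X ⊆ Wᶜ) (hx : Att g W u x)
    (hy : Att g W u y) (hv : Linked g X u v) (hw : Linked g X u w) (hvx : g.Adj v x)
    (hwy : g.Adj w y) : Linked g (piece g W x y ∩ (X ∪ {x, y})) x y := by
  have hX' : ∀ p ∈ X, p ≠ x ∧ p ≠ y := fun p hp =>
    ⟨fun h => hX hp (h ▸ hx.1), fun h => hX hp (h ▸ hy.1)⟩
  have hs : X ∩ piece g W x y ⊆ piece g W x y ∩ (X ∪ {x, y}) := fun p hp => ⟨hp.2, .inl hp.1⟩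
  have h3 := (h.linked_piece hxy hx hy hv hX').1.mono_set hs
  have h4 := (h.linked_piece hxy hx hy hw hX').1.mono_set hs
  exact ((h3.tail hvx ⟨.inl rfl, .inr (.inl rfl)⟩).symm.trans h4).tail hwy
    ⟨.inr (.inl rfl), .inr (.inr rfl)⟩

end Loose

/-! ### Refining a loose decomposition until it contains all coloured vertices, then thinning it out
-/

section Refine

variable {V : Type*} {g : SimpleGraph V} {N W W' S X : Set V} {r u v w x y z a b c : V}

/-- The part of the graph that hangs on the pole `x` of a piece that does not contain the root. -/
def side (g : SimpleGraph V) (r : V) (D : Set V) (x : V) : Set V := comp g ({r} ∪ D \ {x})ᶜ x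

theorem side_subset {D : Set V} : side g r D x ⊆ ({r} ∪ D \ {x})ᶜ := comp_subset

theorem self_mem_side {D : Set V} (hxr : x ≠ r) : x ∈ side g r D x :=
  self_mem_comp (by simp [hxr])

/-- Some walk from `x` to `r` avoids `y`. Without an edge from the side of `x` to `r`, it would be
trapped in this side and the interior of the piece, since the interior can be left only through `x`.
-/
theorem exists_side_adj_root (hB : BiConn g N) (h : TwoAtt g W) (hrN : r ∈ N)
    (hxN : x ∈ N) (hxr : x ≠ r) (hyr : y ≠ r) (hxy : x ≠ y) (hrW : r ∈ W) :
    ∃ u ∈ side g r (piece g W x y) x, g.Adj u r := by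
  by_contra! hcon
  have h1 := hB.linked hxN hrN hxy hyr.symm
  have h2 := h1.mem_of_closed
    (S := side g r (piece g W x y) x ∪ {u | Att g W u x ∧ Att g W u y})
    (.inl (self_mem_side hxr)) (by
      rintro u (hu | hu) w hw huw
      · by_cases hwS : w ∈ ({r} ∪ piece g W x y \ {x})
        · rcases hwS with rfl | ⟨hwp, hwx⟩
          · exact absurd huw (hcon u hu)
          · exact .inr ((hwp.resolve_left hwx).resolve_left hw)
        · exact .inl (Linked.tail hu huw hwS)
      · rcases h.piece_closed hxy hu.1 hu.2 huw with rfl | h | h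
        · exact .inl (self_mem_side hxr)
        · exact absurd h hw
        · exact .inr h)
  rcases h2 with h2 | h2
  · exact side_subset h2 (.inl rfl)
  · exact h2.1.notMem hrW

theorem reachable_deleteEdges_of_linked {T : SimpleGraph V} (h : Linked T X x a) (hy : y ∉ X) :
    (T.deleteEdges {s(x, y)}).Reachable x a := by
  refine Linked.reachable (X := X) (h.transfer id h.1 fun _ hu _ hw huw _ => .of_adj hu ?_ hw)
  rw [SimpleGraph.deleteEdges_adj]
  refine ⟨huw, fun he => ?_⟩
  simp only [Set.mem_singleton_iff, Sym2.eq_iff] at he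
  rcases he with ⟨-, rfl⟩ | ⟨rfl, -⟩
  · exact hy hw
  · exact hy hu

theorem linked_tree (h : Linked g X a b) (hr : r ∉ X) (ha : a ∈ W) (hb : b ∈ W) :
    Linked (tree g W r) (X ∩ W) a b :=
  (h.torso ha hb).transfer id ⟨h.1, ha⟩ fun _ hu _ hw huw _ => .of_adj hu
    (tree_adj.2 ⟨huw, fun h => hr (h ▸ hu.1), fun h => hr (h ▸ hw.1)⟩) hw

theorem exists_linked_tree (h : Linked g X a b) (hr : r ∉ X) (ha : a ∈ W) (hb : b ∉ W) :
    ∃ p, Linked (tree g W r) (X ∩ W) a p ∧ Att g W b p := by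
  obtain ⟨p, hp, hbp⟩ := h.torso_att ha hb
  exact ⟨p, hp.transfer id ⟨h.1, ha⟩ fun _ hu _ hw huw _ => .of_adj hu
    (tree_adj.2 ⟨huw, fun h => hr (h ▸ hu.1), fun h => hr (h ▸ hw.1)⟩) hw, hbp⟩

/-- A common vertex of the two sides would give, after projection to the torso, a walk of the tree
from `x` to `y` that does not use the edge `xy`. But every edge of a forest is a bridge. If the
common vertex is outside `W` and the two walks project to different attachments of it, these are not
`x` and `y`, as the vertex would otherwise be in the piece. -/
theorem Loose.disjoint_side (h : Loose g r W) (hT : (tree g W r).Adj x y) :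
    Disjoint (side g r (piece g W x y) x) (side g r (piece g W x y) y) := by
  obtain ⟨⟨hxy, hx, hy, -⟩, hxr, hyr⟩ := tree_adj.1 hT
  have hbr := SimpleGraph.isBridge_iff.1
    (SimpleGraph.isAcyclic_iff_forall_adj_isBridge.1 h.acyclic hT)
  rw [Set.disjoint_left]
  intro u hux huy
  set X := ({r} ∪ piece g W x y \ {x})ᶜ with hX
  set Y := ({r} ∪ piece g W x y \ {y})ᶜ with hY
  have hyX : y ∉ X := fun h => h (.inr ⟨.inr (.inl rfl), hxy.symm⟩)
  have hxY : x ∉ Y := fun h => h (.inr ⟨.inl rfl, hxy⟩)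
  have hrX : r ∉ X := fun h => h (.inl rfl)
  have hrY : r ∉ Y := fun h => h (.inl rfl)
  have e : s(y, x) = s(x, y) := Sym2.eq_swap
  by_cases hu : u ∈ W
  · have h1 := reachable_deleteEdges_of_linked (linked_tree hux hrX hx hu) fun h => hyX h.1
    have h2 := reachable_deleteEdges_of_linked (linked_tree huy hrY hy hu) fun h => hxY h.1
    rw [e] at h2
    exact hbr (h1.trans h2.symm)
  · obtain ⟨p, hp, hup⟩ := exists_linked_tree hux hrX hx hu
    obtain ⟨q, hq, huq⟩ := exists_linked_tree huy hrY hy hu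
    have h1 := reachable_deleteEdges_of_linked hp fun h => hyX h.1
    have h2 := reachable_deleteEdges_of_linked hq fun h => hxY h.1
    rw [e] at h2
    by_cases hpq : p = q
    · subst hpq
      exact hbr (h1.trans h2.symm)
    have hpX := hp.right_mem.1
    have hqY := hq.right_mem.1
    have hpy : p ≠ y := fun h => hyX (h ▸ hpX)
    have hqx : q ≠ x := fun h => hxY (h ▸ hqY)
    have hadj : (tree g W r).Adj p q := tree_adj.2 ⟨⟨hpq, hup.1, huq.1, .inr ⟨u, hup, huq⟩⟩,
      fun h => hrX (h ▸ hpX), fun h => hrY (h ▸ hqY)⟩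
    have hadj' : ((tree g W r).deleteEdges {s(x, y)}).Adj p q := by
      rw [SimpleGraph.deleteEdges_adj]
      refine ⟨hadj, fun he => ?_⟩
      simp only [Set.mem_singleton_iff, Sym2.eq_iff] at he
      rcases he with ⟨rfl, rfl⟩ | ⟨rfl, -⟩
      · refine side_subset hux (.inr ⟨.inr (.inr ⟨hup, huq⟩), ?_⟩)
        rintro rfl
        exact hu hx
      · exact hpy rfl
    exact hbr (h1.trans (hadj'.reachable.trans h2.symm))

/-- A piece that contains in its interior a vertex `v` which may be joined to the root without
creating a `K₄` minor has a cut vertex that separates its poles. -/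
theorem Loose.exists_cut_of_tree_piece (h : Loose g r W) (hN : N.Finite) (hB : BiConn g N)
    (hrN : r ∈ N) (hK : ¬ HasKFour (g ⊔ SimpleGraph.edge r v))
    (hxr : x ≠ r) (hyr : y ≠ r) (hxy : x ≠ y) (hx : Att g W v x) (hy : Att g W v y) :
    ∃ z, Att g W z x ∧ Att g W z y ∧ ¬ (torso g (insert z W)).Adj x y := by
  by_contra! hcon
  set D := piece g W x y with hD
  have hT : (tree g W r).Adj x y := tree_adj.2 ⟨⟨hxy, hx.1, hy.1, .inr ⟨v, hx, hy⟩⟩, hxr, hyr⟩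
  have hxN := hB.att_mem hx
  have hyN := hB.att_mem hy
  have hDN : D ⊆ N := by
    rintro u (rfl | rfl | ⟨⟨-, w, hw, hwx⟩, -⟩)
    · exact hxN
    · exact hyN
    · exact hB.mem_of_linked (hB.supp _ _ hwx) hw.symm
  have hrD : r ∉ D := by
    rintro (h' | h' | h')
    · exact hxr h'.symm
    · exact hyr h'.symm
    · exact h'.1.notMem h.root_mem
  have hvx : v ≠ x := fun e => hx.notMem (e ▸ hx.1)
  have hvy : v ≠ y := fun e => hx.notMem (e ▸ hy.1)
  -- By the negated claim, `x` and `y` remain adjacent in the torso after any interior vertex `z` of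
  -- the piece is added to `W`. That adjacency comes from an edge or from a walk in the piece that
  -- avoids `z`.
  have hpoles : ∀ z, z ≠ x → z ≠ y → Linked g (D \ {z}) x y := by
    intro z hzx hzy
    by_cases hzD : z ∈ D
    · obtain ⟨h1, h2⟩ := (hzD.resolve_left hzx).resolve_left hzy
      obtain ⟨-, -, -, h3 | ⟨u, h3, h4⟩⟩ := hcon z h1 h2
      · exact .of_adj ⟨.inl rfl, hzx.symm⟩ h3 ⟨.inr (.inl rfl), hzy.symm⟩
      · have h3' := h3.mono (Set.subset_insert _ _) hx.1
        have h4' := h4.mono (Set.subset_insert _ _) hy.1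
        obtain ⟨-, p, hp, hpx⟩ := h3
        obtain ⟨-, q, hq, hqy⟩ := h4
        refine (h.two.linked_poles hxy (Set.compl_subset_compl.2 (Set.subset_insert z W))
          h3' h4' hp hq hpx hqy).mono_set fun s hs => ⟨hs.1, fun hsz => ?_⟩
        rw [Set.mem_singleton_iff] at hsz
        subst hsz
        rcases hs.2 with hs | hs | hs
        · exact hs (.inl rfl)
        · exact hzx hs
        · exact hzy hs
    · obtain ⟨-, p, hp, hpx⟩ := id hx
      obtain ⟨-, q, hq, hqy⟩ := id hy
      refine (h.two.linked_poles hxy subset_rfl hx hy hp hq hpx hqy).mono_set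
        fun s hs => ⟨hs.1, fun hsz => hzD ?_⟩
      rw [← Set.mem_singleton_iff.1 hsz]
      exact hs.1
  -- Every vertex of the piece reaches a pole without `z`, and the poles reach each other. So the
  -- piece has no cut vertex, and a triangle rooted at `x`, `y`, `v` exists in it.
  have hcut : ∀ z, ∀ a ∈ D, ∀ b ∈ D, a ≠ z → b ≠ z → Linked g (D \ {z}) a b := by
    intro z a ha b hb haz hbz
    obtain ⟨s, hs, hsz, has⟩ := hB.exists_linked_pole h.two hxN hyN hxy ha haz
    obtain ⟨t, ht, htz, hbt⟩ := hB.exists_linked_pole h.two hxN hyN hxy hb hbz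
    have hst : Linked g (D \ {z}) s t := by
      rcases hs with rfl | rfl <;> rcases ht with rfl | rfl
      · exact .refl has.right_mem
      · exact hpoles z hsz.symm htz.symm
      · exact (hpoles z htz.symm hsz.symm).symm
      · exact .refl has.right_mem
    exact (has.trans hst).trans hbt.symm
  obtain ⟨P, Q, R, hxP, hyQ, hvR, hP, hQ, hR, hTr⟩ := exists_rooted_triangle (hN.subset hDN)
    (.inl rfl) (.inr (.inl rfl)) (.inr (.inr ⟨hx, hy⟩)) hxy hvx.symm hvy.symm hcut
  obtain ⟨c1, c2, c3, d12, d13, d23, a12, a13, a23⟩ := hTr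
  set Xs := side g r D x with hXs
  set Ys := side g r D y with hYs
  have hle : g ≤ g ⊔ SimpleGraph.edge r v := le_sup_left
  have hdXY : Disjoint Xs Ys := h.disjoint_side hT
  have hxXs : x ∈ Xs := self_mem_side hxr
  have hyYs : y ∈ Ys := self_mem_side hyr
  obtain ⟨p, hpX, hpr⟩ := exists_side_adj_root hB h.two hrN hxN hxr hyr hxy h.root_mem
  obtain ⟨q, hqY, hqr⟩ := exists_side_adj_root hB h.two hrN hyN hyr hxr hxy.symm h.root_mem
  rw [← piece_comm] at hqY
  rw [Set.disjoint_left] at d12 d13 d23 hdXY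
  have hXD : ∀ u ∈ Xs, u ∈ D → u = x := fun u hu huD => by
    by_contra hux
    exact side_subset hu (.inr ⟨huD, hux⟩)
  have hYD : ∀ u ∈ Ys, u ∈ D → u = y := fun u hu huD => by
    by_contra hux
    exact side_subset hu (.inr ⟨huD, hux⟩)
  have up : ∀ P Q P' Q' : Set V, P ⊆ P' → Q ⊆ Q' → (∃ x ∈ P, ∃ y ∈ Q, g.Adj x y) →
      ∃ x ∈ P', ∃ y ∈ Q', (g ⊔ SimpleGraph.edge r v).Adj x y :=
    fun P Q P' Q' h1 h2 ⟨x, hx, y, hy, h⟩ => ⟨x, h1 hx, y, h2 hy, .inl h⟩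
  have hTr' : IsTriangle (g ⊔ SimpleGraph.edge r v) (P ∪ Xs) (Q ∪ Ys) R := by
    refine ⟨(c1.union (.comp hxXs.1) ⟨x, hxP, x, hxXs, .inl rfl⟩).mono hle,
      (c2.union (.comp hyYs.1) ⟨y, hyQ, y, hyYs, .inl rfl⟩).mono hle, c3.mono hle, ?_, ?_, ?_,
      up _ _ _ _ Set.subset_union_left Set.subset_union_left a12,
      up _ _ _ _ Set.subset_union_left subset_rfl a13,
      up _ _ _ _ Set.subset_union_left subset_rfl a23⟩ <;> rw [Set.disjoint_left]
    · rintro u (hu | hu) (hu' | hu')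
      · exact d12 hu hu'
      · exact d12 hu (hYD u hu' (hP hu) ▸ hyQ)
      · exact d12 (hXD u hu (hQ hu') ▸ hxP) hu'
      · exact hdXY hu hu'
    · rintro u (hu | hu) hu'
      · exact d13 hu hu'
      · exact d13 (hXD u hu (hR hu') ▸ hxP) hu'
    · rintro u (hu | hu) hu'
      · exact d23 hu hu'
      · exact d23 (hYD u hu (hR hu') ▸ hyQ) hu'
  have hr' : ∀ D' ⊆ D, ∀ x, Disjoint (D' ∪ side g r D x) {r} := by
    intro D' hD' x
    rw [Set.disjoint_singleton_right]
    rintro (h' | h')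
    · exact hrD (hD' h')
    · exact side_subset h' (.inl rfl)
  -- The sides lead from the sets of `x` and `y` to neighbours of `r`, and the set of `v` is joined
  -- to `r` by the added edge `rv`.
  refine hK (hTr'.hasKFour (S := {r}) .singleton (hr' P hP x) (hr' Q hQ y) ?_ ?_ ?_ ?_)
  · rw [Set.disjoint_singleton_right]
    exact fun h' => hrD (hR h')
  · exact ⟨p, .inr hpX, r, rfl, .inl hpr⟩
  · exact ⟨q, .inr hqY, r, rfl, .inl hqr⟩
  · exact ⟨v, hvR, r, rfl, (sup_edge_adj fun e : r = v => hrD (hR (e ▸ hvR))).symm⟩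

/-- One step of the refinement of a decomposition. -/
theorem Loose.exists_insert (h : Loose g r W) (hN : N.Finite) (hB : BiConn g N)
    (hrN : r ∈ N) (ha : a ∈ W) (haN : a ∈ N) (har : a ≠ r)
    (hKa : ¬ HasKFour (g ⊔ SimpleGraph.edge r a)) (hv : v ∈ N) (hvW : v ∉ W)
    (hK : ¬ HasKFour (g ⊔ SimpleGraph.edge r v)) :
    ∃ z ∈ N, z ∉ W ∧ Loose g r (insert z W) := by
  obtain ⟨x, y, hxy, hx, hy⟩ := hB.exists_two_att hv hvW haN hrN ha h.root_mem har
  have root : ∀ x, x ≠ r → Att g W v x → Att g W v r →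
      ∃ z ∈ N, z ∉ W ∧ Loose g r (insert z W) := by
    intro x hxr hx hr
    have hatt : ∀ a, Att g W v a → a = x ∨ a = r := fun a => h.two.eq_or_eq hx hr hxr
    obtain ⟨z, hz, hcut⟩ := exists_cut_of_root_piece hN hB h.root_mem ha haN har hKa hv hxr hx hr hatt
    have hzW : z ∉ W := comp_subset hz
    refine ⟨z, hB.mem_of_linked hv hz, hzW, h.insert_leaf hzW hx.1
      (fun a ha => hatt a (ha.of_linked hz)) ?_⟩
    -- A component attached to `z`, `x` and `r` would link a neighbour of `x` to a neighbour of `r`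
    -- without using the cut vertex `z`.
    rintro u ⟨-, s, hs, hsz⟩ ⟨-, p, hp, hpx⟩ ⟨-, q, hq, hqr⟩
    have hsub : (insert z W)ᶜ ⊆ Wᶜ := Set.compl_subset_compl.2 (Set.subset_insert _ _)
    have hvu : Linked g Wᶜ v u :=
      (Linked.tail hz hsz.symm (hs.mono_set hsub).right_mem).trans (hs.mono_set hsub).symm
    refine hcut p q ?_ hpx hqr
    refine (hp.symm.trans hq).in_comp.mono_set fun t ht => ⟨?_, fun htz => ?_⟩
    · exact hvu.trans ((hp.mono_set hsub).trans (Linked.mono_set ht hsub))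
    · exact comp_subset ht (.inl htz)
  by_cases hxr : x = r
  · exact root y (fun h => hxy (hxr.trans h.symm)) hy (hxr ▸ hx)
  by_cases hyr : y = r
  · exact root x hxr hx (hyr ▸ hy)
  obtain ⟨z, hzx, hzy, hcut⟩ := h.exists_cut_of_tree_piece hN hB hrN hK hxr hyr hxy hx hy
  refine ⟨z, ?_, hzx.notMem, h.insert_middle hzx.notMem hxr hyr hxy hzx hzy hcut⟩
  obtain ⟨-, u, hu, hux⟩ := hzx
  exact hB.mem_of_linked (hB.supp _ _ hux) hu.symm

/-- A missing vertex `v ∈ S` need not be the one that is added next; its piece is merely cut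
somewhere. The process stops because `N \ W` shrinks. The vertex `a ∈ S` that is already in `W` is
used to cut the pieces at the root. -/
theorem Loose.exists_superset (hN : N.Finite) (hB : BiConn g N) (hrN : r ∈ N) (hS : S ⊆ N)
    (hrS : r ∉ S) (hK : ∀ v ∈ S, ¬ HasKFour (g ⊔ SimpleGraph.edge r v)) (haS : a ∈ S) :
    ∀ W ⊆ N, a ∈ W → Loose g r W → ∃ W' ⊆ N, S ⊆ W' ∧ Loose g r W' := by
  intro W
  induction hn : (N \ W).ncard using Nat.strong_induction_on generalizing W with
  | _ n ih =>
  subst hn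
  intro hWN haW h
  by_cases hSW : S ⊆ W
  · exact ⟨W, hWN, hSW, h⟩
  obtain ⟨v, hvS, hvW⟩ := Set.not_subset.1 hSW
  obtain ⟨z, hzN, hzW, h'⟩ := h.exists_insert hN hB hrN haW (hS haS) (fun e => hrS (e ▸ haS))
    (hK a haS) (hS hvS) hvW (hK v hvS)
  refine ih _ ?_ (insert z W) rfl (Set.insert_subset hzN hWN) (.inr haW) h'
  refine Set.ncard_lt_ncard ⟨fun u hu => ⟨hu.1, fun hW => hu.2 (.inr hW)⟩, fun hs => ?_⟩
    (hN.subset Set.sdiff_subset)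
  exact (hs ⟨hzN, hzW⟩).2 (.inl rfl)

/-- Removing `z` from `W` merges the components attached to `z` into one, whose attachments were
torso neighbours of `z`. The other components keep their attachments. -/
theorem Att.erase (ha : Att g (W \ {z}) u a) (hz : z ∈ W) :
    (Linked g (W \ {z})ᶜ u z → (torso g W).Adj z a) ∧
      (¬ Linked g (W \ {z})ᶜ u z → Att g W u a) := by
  obtain ⟨haW, w, hw, hwa⟩ := ha
  constructor
  · intro hl
    have h1 : Linked g ((W \ {z})ᶜ ∪ {a}) z a :=
      ((hl.symm.trans hw).mono_set Set.subset_union_left).tail hwa (.inr rfl)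
    obtain ⟨p, s, hp, hps, hs, -⟩ := (h1.torso hz haW.1).first_hit (S := {a})
      (fun h => haW.2 (Set.mem_singleton_iff.1 h).symm) rfl
    rw [Set.mem_singleton_iff] at hs
    subst hs
    have := hp.right_mem
    have hpz : p = z := by
      by_contra hpz
      rcases this.1.1 with h | h
      · exact h ⟨this.1.2, hpz⟩
      · exact this.2 h
    exact hpz ▸ hps
  · intro hl
    refine ⟨haW.1, w, hw.in_comp.mono_set fun t ht htW => ?_, hwa⟩
    by_cases htz : t = z
    · exact hl (htz ▸ ht)
    · exact comp_subset ht ⟨htW, htz⟩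

theorem torso_erase (h : (torso g (W \ {z})).Adj a b) (hz : z ∈ W) :
    (torso g W).Adj a b ∨ ((torso g W).Adj z a ∧ (torso g W).Adj z b) := by
  obtain ⟨hne, ha, hb, h | ⟨v, h1, h2⟩⟩ := h
  · exact .inl ⟨hne, ha.1, hb.1, .inl h⟩
  · by_cases hl : Linked g (W \ {z})ᶜ v z
    · exact .inr ⟨(h1.erase hz).1 hl, (h2.erase hz).1 hl⟩
    · exact .inl ⟨hne, ha.1, hb.1, .inr ⟨v, (h1.erase hz).2 hl, (h2.erase hz).2 hl⟩⟩

/-- A vertex with at most two neighbours in the torso may be removed from a decomposition. -/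
theorem Loose.erase (h : Loose g r W) (hz : z ∈ W) (hzr : z ≠ r)
    (hxy : ∀ a, (torso g W).Adj z a → a = x ∨ a = y) : Loose g r (W \ {z}) := by
  refine ⟨⟨h.root_mem, hzr.symm⟩, fun u => ?_, ?_⟩
  · by_cases hl : Linked g (W \ {z})ᶜ u z
    · exact ⟨x, y, fun a ha => hxy a ((ha.erase hz).1 hl)⟩
    · obtain ⟨p, q, hpq⟩ := h.two u
      exact ⟨p, q, fun a ha => hpq a ((ha.erase hz).2 hl)⟩
  · set T := tree g W r with hT
    have hz' : ∀ a, (tree g (W \ {z}) r).Adj z a → False := fun a h =>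
      (tree_adj.1 h).1.2.1.2 rfl
    have hlift : ∀ a b, (tree g (W \ {z}) r).Adj a b → T.Adj a b ∨ (T.Adj z a ∧ T.Adj z b) := by
      intro a b hab
      obtain ⟨hab, har, hbr⟩ := tree_adj.1 hab
      rcases torso_erase hab hz with h | ⟨h1, h2⟩
      · exact .inl (tree_adj.2 ⟨h, har, hbr⟩)
      · exact .inr ⟨tree_adj.2 ⟨h1, hzr, har⟩, tree_adj.2 ⟨h2, hzr, hbr⟩⟩
    -- New tree edges join only neighbours of `z`. With two neighbours in the tree, `z` is
    -- suppressed; with fewer, no edge is new.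
    by_cases hab : ∃ a b, a ≠ b ∧ T.Adj z a ∧ T.Adj z b
    · obtain ⟨a, b, hne, ha, hb⟩ := hab
      have hac := isAcyclic_suppress h.acyclic ha hb hne
      refine hac.anti fun c d hcd => ?_
      rcases hlift c d hcd with h | ⟨h1, h2⟩
      · refine .inl (SimpleGraph.deleteIncidenceSet_adj.2 ⟨h, ?_, ?_⟩)
        · rintro rfl
          exact hz' _ hcd
        · rintro rfl
          exact hz' _ hcd.symm
      · refine .inr ((SimpleGraph.edge_adj ..).2 ⟨?_, hcd.ne⟩)
        have e1 := hxy a (tree_adj.1 ha).1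
        have e2 := hxy b (tree_adj.1 hb).1
        have e3 := hxy c (tree_adj.1 h1).1
        have e4 := hxy d (tree_adj.1 h2).1
        have := hcd.ne
        grind
    · refine h.acyclic.anti fun c d hcd => ?_
      rcases hlift c d hcd with h | ⟨h1, h2⟩
      · exact h
      · exact absurd ⟨c, d, hcd.ne, h1, h2⟩ hab

/-- The decomposition of a biconnected graph: the torso is a tree after removal of the root,
and each vertex of `W` that is neither the root nor in `S` has at least three neighbours. -/
theorem exists_decomposition (hN : N.Finite) (hB : BiConn g N) (hrN : r ∈ N) (hS : S ⊆ N)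
    (hrS : r ∉ S) (hSne : S.Nonempty) (hK : ∀ v ∈ S, ¬ HasKFour (g ⊔ SimpleGraph.edge r v)) :
    ∃ W ⊆ N, S ⊆ W ∧ Loose g r W ∧ ∀ z ∈ W, z ≠ r → z ∉ S → ∃ a b c, a ≠ b ∧ a ≠ c ∧ b ≠ c ∧
      (torso g W).Adj z a ∧ (torso g W).Adj z b ∧ (torso g W).Adj z c := by
  obtain ⟨a, haS⟩ := hSne
  obtain ⟨W, hWN, hSW, hW⟩ := Loose.exists_superset hN hB hrN hS hrS hK haS {r, a}
    (by simp [Set.insert_subset_iff, hrN, hS haS]) (by simp) .pair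
  induction hn : W.ncard using Nat.strong_induction_on generalizing W with
  | _ n ih =>
  subst hn
  by_cases hdeg : ∀ z ∈ W, z ≠ r → z ∉ S → ∃ a b c, a ≠ b ∧ a ≠ c ∧ b ≠ c ∧
      (torso g W).Adj z a ∧ (torso g W).Adj z b ∧ (torso g W).Adj z c
  · exact ⟨W, hWN, hSW, hW, hdeg⟩
  · push Not at hdeg
    obtain ⟨z, hzW, hzr, hzS, hz⟩ := hdeg
    have hxy : ∃ x y, ∀ a, (torso g W).Adj z a → a = x ∨ a = y := by
      by_cases hx : ∃ x, (torso g W).Adj z x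
      · obtain ⟨x, hx⟩ := hx
        by_cases hy : ∃ y, x ≠ y ∧ (torso g W).Adj z y
        · obtain ⟨y, hxy, hy⟩ := hy
          refine ⟨x, y, fun a ha => ?_⟩
          by_contra! hne
          exact hz x y a hxy hne.1.symm hne.2.symm hx hy ha
        · push Not at hy
          refine ⟨x, x, fun a ha => ?_⟩
          by_contra! hne
          exact hy a hne.1.symm ha
      · push Not at hx
        exact ⟨z, z, fun a ha => absurd ha (hx a)⟩
    obtain ⟨x, y, hxy⟩ := hxy
    exact ih _ (Set.ncard_sdiff_singleton_lt_of_mem hzW (hN.subset hWN)) (W \ {z})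
      (fun u hu => hWN hu.1) (fun u hu => ⟨hSW hu, fun h => hzS (Set.mem_singleton_iff.1 h ▸ hu)⟩)
      (hW.erase hzW hzr hxy) rfl

end Refine

/-! ### Subdivided trees and the graphs in `ℱ'_k` in terms of degrees -/

section Trees

variable {k : ℕ} {V : Type*} {T T' T₁ T₂ : LGraph V} {col : V → Finset (Fin k)} {x y z a b : V}

theorem coe_isTree_iff : T.coe.IsTree ↔ Conn T.spanningCoe T.verts ∧ T.spanningCoe.IsAcyclic := by
  rw [SimpleGraph.isTree_iff, coe_connected_iff]
  refine and_congr_right fun _ => ⟨fun h => ?_, fun h => ?_⟩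
  · rw [isAcyclic_iff_not_linked] at h ⊢
    intro x y z hxy hxz hyz hl
    have hxy' : T.Adj x y := hxy
    have hxz' : T.Adj x z := hxz
    have := Linked.comap (f := fun v : T.verts => v.1) (a := ⟨y, hxy'.snd_mem⟩)
      (b := ⟨z, hxz'.snd_mem⟩) Subtype.val_injective
      (fun a b hab => ⟨⟨a, T.edge_vert hab⟩, rfl⟩) hl
    refine h ⟨x, hxy'.fst_mem⟩ ⟨y, hxy'.snd_mem⟩ ⟨z, hxz'.snd_mem⟩ hxy hxz
      (fun e => hyz (congrArg Subtype.val e)) ?_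
    exact this.mono_set fun u hu hux => hu (congrArg Subtype.val hux)
  · exact h.comap ⟨Subtype.val, fun {a b} h => h⟩ Subtype.val_injective

/-- The subdivisions of the trees in `𝒯'_k`. -/
structure IsSkeleton (T : LGraph V) (col : V → Finset (Fin k)) : Prop where
  finite : T.verts.Finite
  conn : Conn T.spanningCoe T.verts
  acyclic : T.spanningCoe.IsAcyclic
  coloured : ∃ v : Fin k → V, (∀ i, v i ∈ T.verts ∧ col (v i) = {i}) ∧
      ∀ u ∈ T.verts, (col u).Nonempty → ∃ i, u = v i
  degree : ∀ u ∈ T.verts, col u = ∅ → ∃ a b, a ≠ b ∧ T.Adj u a ∧ T.Adj u b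

theorem neighborSet_finite (h : T.verts.Finite) (u : V) : (T.neighborSet u).Finite :=
  h.subset fun _ hw => T.edge_vert (SimpleGraph.Subgraph.Adj.symm hw)

theorem IsColouredTree.isSkeleton (h : IsColouredTree T col) : IsSkeleton T col := by
  obtain ⟨hf, ht, hc, hd⟩ := h
  obtain ⟨h1, h2⟩ := coe_isTree_iff.1 ht
  refine ⟨hf, h1, h2, hc, fun u hu hcu => ?_⟩
  have h3 := hd u hu hcu
  have h4 : 1 < (T.neighborSet u).ncard := by lia
  rw [Set.one_lt_ncard_iff (neighborSet_finite hf u)] at h4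
  obtain ⟨a, b, ha, hb, hab⟩ := h4
  exact ⟨a, b, hab, ha, hb⟩

theorem IsSkeleton.subdivide (h : IsSkeleton T₁ col) (hxy : T₁.Adj x y) (hz : z ∉ T₁.verts)
    (hcz : col z = ∅) (hv : T₂.verts = insert z T₁.verts)
    (hadj : ∀ a b, T₂.Adj a b ↔
        (T₁.Adj a b ∧ s(a, b) ≠ s(x, y)) ∨ s(a, b) = s(x, z) ∨ s(a, b) = s(z, y)) :
    IsSkeleton T₂ col := by
  have hx := hxy.fst_mem
  have hy := hxy.snd_mem
  have hxz : T₂.Adj x z := (hadj _ _).2 (.inr (.inl rfl))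
  have hzy : T₂.Adj z y := (hadj _ _).2 (.inr (.inr rfl))
  have hsub : T₁.verts ⊆ T₂.verts := hv ▸ Set.subset_insert _ _
  have hzv : z ∈ T₂.verts := hv ▸ Set.mem_insert _ _
  have hxyl : Linked T₂.spanningCoe T₂.verts x y :=
    (Linked.of_adj (hsub hx) hxz hzv).tail hzy (hsub hy)
  have hlink : ∀ b ∈ T₁.verts, Linked T₂.spanningCoe T₂.verts x b := by
    intro b hb
    refine (h.conn.2 x hx b hb).transfer id (hsub hx) fun u hu w hw huw _ => ?_
    by_cases he : s(u, w) = s(x, y)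
    · rcases Sym2.eq_iff.1 he with ⟨rfl, rfl⟩ | ⟨rfl, rfl⟩
      · exact hxyl
      · exact hxyl.symm
    · exact .of_adj (hsub hu) ((hadj _ _).2 (.inl ⟨huw, he⟩)) (hsub hw)
  refine ⟨hv ▸ h.finite.insert z, ?_, ?_, ?_, ?_⟩
  · refine .of_root (hsub hx) fun b hb => ?_
    rw [hv] at hb
    rcases hb with rfl | hb
    · exact .of_adj (hsub hx) hxz hzv
    · exact hlink b hb
  · refine (isAcyclic_subdivide h.acyclic hxy
      fun a ha => hz (T₁.edge_vert ha)).anti fun a b hab => ?_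
    rcases (hadj a b).1 hab with ⟨h1, h2⟩ | h1 | h1
    · refine .inl (.inl ?_)
      rw [SimpleGraph.deleteEdges_adj]
      exact ⟨h1, h2⟩
    · refine .inl (.inr ?_)
      rw [SimpleGraph.edge_adj]
      exact ⟨Sym2.eq_iff.1 h1, hab.ne⟩
    · refine .inr ?_
      rw [SimpleGraph.edge_adj]
      exact ⟨Sym2.eq_iff.1 h1, hab.ne⟩
  · obtain ⟨v, h1, h2⟩ := h.coloured
    refine ⟨v, fun i => ⟨hsub (h1 i).1, (h1 i).2⟩, fun u hu hcu => ?_⟩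
    rw [hv] at hu
    rcases hu with rfl | hu
    · simp [hcz] at hcu
    · exact h2 u hu hcu
  · intro u hu hcu
    rw [hv] at hu
    rcases hu with rfl | hu
    · exact ⟨x, y, hxy.ne, hxz.symm, hzy⟩
    · obtain ⟨a, b, hab, ha, hb⟩ := h.degree u hu hcu
      have key : ∀ a, T₁.Adj u a → T₂.Adj u a ∨ (s(u, a) = s(x, y) ∧ T₂.Adj u z) := by
        intro a ha
        by_cases he : s(u, a) = s(x, y)
        · refine .inr ⟨he, ?_⟩
          rcases Sym2.eq_iff.1 he with ⟨rfl, rfl⟩ | ⟨rfl, rfl⟩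
          · exact hxz
          · exact hzy.symm
        · exact .inl ((hadj _ _).2 (.inl ⟨ha, he⟩))
      have hne : ∀ a, T₁.Adj u a → a ≠ z := fun a ha e => hz (e ▸ ha.snd_mem)
      rcases key a ha with h1 | ⟨h1, h1'⟩ <;> rcases key b hb with h2 | ⟨h2, h2'⟩
      · exact ⟨a, b, hab, h1, h2⟩
      · exact ⟨a, z, hne a ha, h1, h2'⟩
      · exact ⟨z, b, (hne b hb).symm, h1', h2⟩
      · exact absurd (Sym2.congr_right.1 (h1.trans h2.symm)) hab

theorem IsSubdivision.isSkeleton (h : IsSubdivision col T T') (hT : IsSkeleton T col) :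
    IsSkeleton T' col := by
  induction h with
  | refl => exact hT
  | step _ hxy hz hcz hv hadj ih => exact ih.subdivide hxy hz hcz hv hadj

/-- Uncoloured vertices of degree 2 are suppressed one by one until none is left. Reversing each
suppression is a subdivision step. -/
theorem IsSkeleton.exists_subdivision (h : IsSkeleton T' col) :
    ∃ T, IsColouredTree T col ∧ IsSubdivision col T T' := by
  induction hn : T'.verts.ncard using Nat.strong_induction_on generalizing T' with
  | _ n ih =>
  subst hn
  by_cases hdeg : ∀ u ∈ T'.verts, col u = ∅ → 3 ≤ (T'.neighborSet u).ncard
  · exact ⟨T', ⟨h.finite, coe_isTree_iff.2 ⟨h.conn, h.acyclic⟩, h.coloured, hdeg⟩, .refl⟩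
  push Not at hdeg
  obtain ⟨z, hz, hcz, hlt⟩ := hdeg
  obtain ⟨x, y, hxy, hzx, hzy⟩ := h.degree z hz hcz
  have hnb : ∀ a, T'.Adj z a → a = x ∨ a = y := by
    intro a ha
    by_contra! hne
    have : 2 < (T'.neighborSet z).ncard :=
      (Set.two_lt_ncard_iff (neighborSet_finite h.finite z)).2
        ⟨x, y, a, hzx, hzy, ha, hxy, hne.1.symm, hne.2.symm⟩
    lia
  have hxT := hzx.snd_mem
  have hyT := hzy.snd_mem
  -- Since `x`, `y`, `z` span no cycle, the edge that replaces `z` is new. So `x` and `y` keep their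
  -- degrees, and subdividing this edge gives back `T'`.
  have hnxy : ¬ T'.Adj x y := fun hadj =>
    isAcyclic_iff_not_linked.1 h.acyclic z x y hzx hzy hxy (.of_adj hzx.ne.symm hadj hzy.ne.symm)
  let T₁ : LGraph V :=
    { verts := T'.verts \ {z}
      Adj := fun a b => (T'.Adj a b ∧ a ≠ z ∧ b ≠ z) ∨ s(a, b) = s(x, y)
      adj_sub := by
        rintro a b (h | h)
        · exact h.1.ne
        · rcases Sym2.eq_iff.1 h with ⟨rfl, rfl⟩ | ⟨rfl, rfl⟩
          · exact hxy
          · exact hxy.symm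
      edge_vert := by
        rintro a b (h | h)
        · exact ⟨h.1.fst_mem, h.2.1⟩
        · rcases Sym2.eq_iff.1 h with ⟨rfl, rfl⟩ | ⟨rfl, rfl⟩
          · exact ⟨hxT, hzx.ne.symm⟩
          · exact ⟨hyT, hzy.ne.symm⟩
      symm := ⟨fun a b h => by
        rcases h with h | h
        · exact .inl ⟨h.1.symm, h.2.2, h.2.1⟩
        · exact .inr (Sym2.eq_swap.trans h)⟩ }
  have hT1 : IsSkeleton T₁ col := by
    have hle : torso T'.spanningCoe (T'.verts \ {z}) ≤ T₁.spanningCoe := by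
      rintro a b ⟨hne, ha, hb, hab | ⟨v, h1, h2⟩⟩
      · exact .inl ⟨hab, ha.2, hb.2⟩
      · have key : ∀ a, Att T'.spanningCoe (T'.verts \ {z}) v a → T'.Adj z a := by
          rintro a ⟨-, u, hu, hua⟩
          have huT : u ∈ T'.verts := T'.edge_vert hua
          have huz : u = z := by
            by_contra huz
            exact hu.right_mem ⟨huT, huz⟩
          exact huz ▸ hua
        refine .inr (Sym2.eq_iff.2 ?_)
        have := hnb a (key a h1)
        have := hnb b (key b h2)
        grind
    refine ⟨h.finite.subset Set.sdiff_subset, ?_, ?_, ?_, ?_⟩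
    · refine ⟨⟨x, hxT, hzx.ne.symm⟩, fun a ha b hb => ?_⟩
      exact ((h.conn.2 a ha.1 b hb.1).torso ha hb).mono hle Set.inter_subset_right
    · refine (isAcyclic_suppress h.acyclic hzx hzy hxy).anti fun a b hab => ?_
      rcases hab with hab | hab
      · exact .inl (SimpleGraph.deleteIncidenceSet_adj.2 hab)
      · refine .inr ((SimpleGraph.edge_adj ..).2 ⟨Sym2.eq_iff.1 hab, ?_⟩)
        rintro rfl
        rcases Sym2.eq_iff.1 hab with ⟨rfl, rfl⟩ | ⟨rfl, rfl⟩ <;> exact hxy rfl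
    · obtain ⟨v, h1, h2⟩ := h.coloured
      refine ⟨v, fun i => ⟨⟨(h1 i).1, fun e => ?_⟩, (h1 i).2⟩, fun u hu => h2 u hu.1⟩
      have := (h1 i).2
      rw [Set.mem_singleton_iff.1 e, hcz] at this
      simp at this
    · intro u hu hcu
      obtain ⟨a, b, hab, ha, hb⟩ := h.degree u hu.1 hcu
      by_cases huz : T'.Adj u z
      · have hw : ∃ w, T₁.Adj u w ∧ ∀ a, T'.Adj u a → a ≠ z → a ≠ w := by
          rcases hnb u huz.symm with rfl | rfl
          · exact ⟨y, .inr rfl, fun a ha _ e => hnxy (e ▸ ha)⟩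
          · exact ⟨x, .inr Sym2.eq_swap, fun a ha _ e => hnxy (e ▸ ha.symm)⟩
        obtain ⟨w, huw, hw⟩ := hw
        by_cases haz : a = z
        · have hbz : b ≠ z := fun e => hab (haz.trans e.symm)
          exact ⟨b, w, hw b hb hbz, .inl ⟨hb, hu.2, hbz⟩, huw⟩
        · exact ⟨a, w, hw a ha haz, .inl ⟨ha, hu.2, haz⟩, huw⟩
      · exact ⟨a, b, hab, .inl ⟨ha, hu.2, fun e => huz (e ▸ ha)⟩,
          .inl ⟨hb, hu.2, fun e => huz (e ▸ hb)⟩⟩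
  obtain ⟨T, hT, hsub⟩ := ih _ (Set.ncard_sdiff_singleton_lt_of_mem hz h.finite) hT1 rfl
  refine ⟨T, hT, .step (x := x) (y := y) (z := z) hsub (.inr rfl) (fun h => h.2 rfl) hcz ?_ ?_⟩
  · exact (Set.insert_sdiff_self_of_mem hz).symm
  · intro a b
    constructor
    · intro hab
      by_cases haz : a = z
      · subst haz
        rcases hnb b hab with rfl | rfl
        · exact .inr (.inl Sym2.eq_swap)
        · exact .inr (.inr rfl)
      by_cases hbz : b = z
      · subst hbz
        rcases hnb a hab.symm with rfl | rfl
        · exact .inr (.inl rfl)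
        · exact .inr (.inr Sym2.eq_swap)
      refine .inl ⟨.inl ⟨hab, haz, hbz⟩, fun e => ?_⟩
      rcases Sym2.eq_iff.1 e with ⟨rfl, rfl⟩ | ⟨rfl, rfl⟩
      · exact hnxy hab
      · exact hnxy hab.symm
    · rintro (⟨h1 | h1, h2⟩ | h1 | h1)
      · exact h1.1
      · exact absurd h1 h2
      · rcases Sym2.eq_iff.1 h1 with ⟨rfl, rfl⟩ | ⟨rfl, rfl⟩
        · exact hzx.symm
        · exact hzx
      · rcases Sym2.eq_iff.1 h1 with ⟨rfl, rfl⟩ | ⟨rfl, rfl⟩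
        · exact hzy
        · exact hzy.symm

/-- The graphs in `ℱ'_k`, described without reference to subdivisions. -/
structure IsApexTree (H : ColGraph k V) : Prop where
  root_uncoloured : H.col H.root = ∅
  acyclic : (H.graph.spanningCoe.deleteIncidenceSet H.root).IsAcyclic
  conn : Conn H.graph.spanningCoe (H.graph.verts \ {H.root})
  coloured : ∃ v : Fin k → V, (∀ i, v i ∈ H.graph.verts ∧ H.col (v i) = {i}) ∧
    ∀ u, (H.col u).Nonempty → ∃ i, u = v i
  leaf : ∀ v ∈ H.graph.verts, v ≠ H.root →
    (∃ a b, a ≠ b ∧ a ≠ H.root ∧ b ≠ H.root ∧ H.graph.Adj v a ∧ H.graph.Adj v b) ∨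
      H.graph.Adj H.root v
  degree : ∀ v ∈ H.graph.verts, v ≠ H.root → H.col v = ∅ → ∃ a b c, a ≠ b ∧ a ≠ c ∧ b ≠ c ∧
    H.graph.Adj v a ∧ H.graph.Adj v b ∧ H.graph.Adj v c

/-- An uncoloured vertex of `T'` has degree at least 2, and it is joined to the root if its degree
is exactly 2. This amounts to having three neighbours in `H`, a condition in which `T` and the
subdivision no longer occur. -/
theorem mem_apexTrees_iff {H : ColGraph k V} : H ∈ apexTrees k V ↔ IsApexTree H := by
  constructor
  · rintro ⟨T, T', hT, hsub, hr, hcr, hv, hadj, hroot⟩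
    have hS := hsub.isSkeleton hT.isSkeleton
    have hv' : H.graph.verts \ {H.root} = T'.verts := by
      rw [hv]
      exact Set.insert_sdiff_self_of_notMem hr
    have hle : T'.spanningCoe ≤ H.graph.spanningCoe := fun a b hab =>
      (hadj a (T'.edge_vert hab) b (T'.edge_vert hab.symm)).2 hab
    have hmem : ∀ v ∈ H.graph.verts, v ≠ H.root → v ∈ T'.verts := fun v hv hvr =>
      hv' ▸ ⟨hv, hvr⟩
    have hne : ∀ a b, T'.Adj a b → b ≠ H.root := fun a b hab e => hr (e ▸ hab.snd_mem)
    refine ⟨hcr, ?_, ?_, ?_, ?_, ?_⟩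
    · refine hS.acyclic.anti fun a b hab => ?_
      obtain ⟨hab, har, hbr⟩ := SimpleGraph.deleteIncidenceSet_adj.1 hab
      have hab' : H.graph.Adj a b := hab
      exact (hadj a (hmem a hab'.fst_mem har) b (hmem b hab'.snd_mem hbr)).1 hab
    · rw [hv']
      exact hS.conn.mono hle
    · obtain ⟨v, h1, h2⟩ := hS.coloured
      refine ⟨v, fun i => ⟨hv ▸ .inr (h1 i).1, (h1 i).2⟩, fun u hu => h2 u ?_ hu⟩
      by_contra huT
      by_cases hur : u = H.root
      · rw [hur, hcr] at hu
        simp at hu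
      · rw [H.col_eq_empty u fun h => huT (hmem u h hur)] at hu
        simp at hu
    · intro v hvH hvr
      by_cases hd : (T'.neighborSet v).ncard ≤ 1
      · exact .inr (hroot v (hmem v hvH hvr) (.inl hd))
      · rw [not_le, Set.one_lt_ncard_iff (neighborSet_finite hS.finite v)] at hd
        obtain ⟨a, b, ha, hb, hab⟩ := hd
        exact .inl ⟨a, b, hab, hne _ _ ha, hne _ _ hb, hle ha, hle hb⟩
    · intro v hvH hvr hcv
      have hvT := hmem v hvH hvr
      obtain ⟨a, b, hab, ha, hb⟩ := hS.degree v hvT hcv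
      by_cases hd : 2 < (T'.neighborSet v).ncard
      · rw [Set.two_lt_ncard_iff (neighborSet_finite hS.finite v)] at hd
        obtain ⟨a, b, c, ha, hb, hc, hab, hac, hbc⟩ := hd
        exact ⟨a, b, c, hab, hac, hbc, hle ha, hle hb, hle hc⟩
      · have h1 : 1 < (T'.neighborSet v).ncard :=
          (Set.one_lt_ncard_iff (neighborSet_finite hS.finite v)).2 ⟨a, b, ha, hb, hab⟩
        have := hroot v hvT (.inr ⟨hcv, by lia⟩)
        exact ⟨a, b, H.root, hab, hne _ _ ha, hne _ _ hb, hle ha, hle hb, this.symm⟩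
  · intro h
    let T' : LGraph V := H.graph.deleteVerts {H.root}
    have hadj : ∀ a b, T'.Adj a b ↔ a ≠ H.root ∧ b ≠ H.root ∧ H.graph.Adj a b := by
      intro a b
      simp only [T', SimpleGraph.Subgraph.deleteVerts_adj, Set.mem_singleton_iff]
      exact ⟨fun h => ⟨h.2.1, h.2.2.2.1, h.2.2.2.2⟩,
        fun h => ⟨h.2.2.fst_mem, h.1, h.2.2.snd_mem, h.2.1, h.2.2⟩⟩
    have hv : T'.verts = H.graph.verts \ {H.root} := rfl
    have hf : T'.verts.Finite := H.finite.subset Set.sdiff_subset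
    have hS : IsSkeleton T' H.col := by
      refine ⟨hf, ⟨h.conn.1, fun a ha b hb => ?_⟩, ?_, ?_, ?_⟩
      · exact (h.conn.2 a ha b hb).transfer id ha fun u hu w hw huw _ =>
          .of_adj hu ((hadj u w).2 ⟨hu.2, hw.2, huw⟩) hw
      · exact h.acyclic.anti fun a b hab => by
          obtain ⟨h1, h2, h3⟩ := (hadj a b).1 hab
          exact SimpleGraph.deleteIncidenceSet_adj.2 ⟨h3, h1, h2⟩
      · obtain ⟨v, h1, h2⟩ := h.coloured
        refine ⟨v, fun i => ⟨⟨(h1 i).1, fun e => ?_⟩, (h1 i).2⟩, fun u _ hu => h2 u hu⟩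
        have := (h1 i).2
        rw [Set.mem_singleton_iff.1 e, h.root_uncoloured] at this
        simp at this
      · intro u hu hcu
        obtain ⟨a, b, c, hab, hac, hbc, ha, hb, hc⟩ := h.degree u hu.1 hu.2 hcu
        have key : ∀ a, H.graph.Adj u a → a ≠ H.root → T'.Adj u a := fun a ha har =>
          (hadj u a).2 ⟨hu.2, har, ha⟩
        by_cases har : a = H.root
        · subst har
          exact ⟨b, c, hbc, key b hb hab.symm, key c hc hac.symm⟩
        by_cases hbr : b = H.root
        · subst hbr
          exact ⟨a, c, hac, key a ha har, key c hc hbc.symm⟩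
        · exact ⟨a, b, hab, key a ha har, key b hb hbr⟩
    obtain ⟨T, hT, hsub⟩ := hS.exists_subdivision
    refine ⟨T, T', hT, hsub, fun h => h.2 rfl, h.root_uncoloured, ?_, ?_, ?_⟩
    · exact (Set.insert_sdiff_self_of_mem H.root_mem).symm
    · intro u hu w hw
      exact ⟨fun h => (hadj u w).2 ⟨hu.2, hw.2, h⟩, fun h => ((hadj u w).1 h).2.2⟩
    · intro v hvT hd
      by_contra hvr
      obtain ⟨a, b, hab, har, hbr, ha, hb⟩ := (h.leaf v hvT.1 hvT.2).resolve_right hvr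
      have ha' : T'.Adj v a := (hadj v a).2 ⟨hvT.2, har, ha⟩
      have hb' : T'.Adj v b := (hadj v b).2 ⟨hvT.2, hbr, hb⟩
      rcases hd with hd | ⟨hcv, hd⟩
      · have := (Set.one_lt_ncard_iff (neighborSet_finite hf v)).2 ⟨a, b, ha', hb', hab⟩
        lia
      · obtain ⟨a, b, c, hab, hac, hbc, ha, hb, hc⟩ := h.degree v hvT.1 hvT.2 hcv
        have key : ∀ a, H.graph.Adj v a → T'.Adj v a := fun a ha =>
          (hadj v a).2 ⟨hvT.2, fun e => hvr (e ▸ ha.symm), ha⟩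
        have := (Set.two_lt_ncard_iff (neighborSet_finite hf v)).2
          ⟨a, b, c, key a ha, key b hb, key c hc, hab, hac, hbc⟩
        lia

end Trees

/-! ### From a biconnected graph to a substitution: the pieces are networks -/

section Pieces

variable {k : ℕ} {V : Type*} {G : ColGraph k V} {D : LGraph V} {g : SimpleGraph V} {N W : Set V}
  {x y z a b u v w : V}

theorem Linked.exists_adj {X : Set V} (h : Linked g X a b) (hab : a ≠ b) : ∃ c ∈ X, g.Adj a c ∧
    Linked g (X \ {a}) b c := by
  obtain ⟨u, s, hu, hus, hs, -⟩ := h.symm.first_hit (S := {a}) hab.symm rfl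
  rw [Set.mem_singleton_iff] at hs
  subst hs
  exact ⟨u, hu.right_mem.1, hus.symm, hu⟩

/-- A walk of `g` from `a` that avoids `z` and leads to a pole other than `z` stays in `D` up to its
first pole, because all edges of `g` at interior vertices belong to `D`. -/
theorem exists_linked_pole_of_closed (hB : BiConn g N) (hxN : x ∈ N) (hyN : y ∈ N) (hxy : x ≠ y)
    (hDN : D.verts ⊆ N)
    (hcl : ∀ u ∈ D.verts, u ≠ x → u ≠ y → ∀ w, g.Adj u w → D.Adj u w) (ha : a ∈ D.verts)
    (haz : a ≠ z) :
    ∃ s, (s = x ∨ s = y) ∧ s ≠ z ∧ Linked D.spanningCoe (D.verts \ {z}) a s := by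
  by_cases hax : a = x
  · exact ⟨a, .inl hax, haz, .refl ⟨ha, haz⟩⟩
  by_cases hay : a = y
  · exact ⟨a, .inr hay, haz, .refl ⟨ha, haz⟩⟩
  obtain ⟨t, ht, htz, htN⟩ : ∃ t ∈ ({x, y} : Set V), t ≠ z ∧ t ∈ N := by
    by_cases hxz : x = z
    · exact ⟨y, by simp, fun h => hxy (hxz.trans h.symm), hyN⟩
    · exact ⟨x, by simp, hxz, hxN⟩
  obtain ⟨u, s, hu, hus, hs, hsz⟩ := (hB.linked (hDN ha) htN haz htz).first_hit (S := {x, y})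
    (by simp [hax, hay]) ht
  have key : Linked D.spanningCoe (D.verts \ {z}) a u := by
    refine hu.induct (P := fun u => Linked D.spanningCoe (D.verts \ {z}) a u) (.refl ⟨ha, haz⟩) ?_
    intro p q hp ih hpq hq
    have h1 := hp.right_mem.2
    simp only [Set.mem_insert_iff, Set.mem_singleton_iff, not_or] at h1
    have h2 := hcl p ih.right_mem.1 h1.1 h1.2 q hpq
    exact ih.tail h2 ⟨h2.snd_mem, hq.1⟩
  have h1 := hu.right_mem.2
  simp only [Set.mem_insert_iff, Set.mem_singleton_iff, not_or] at h1
  have h2 := hcl u key.right_mem.1 h1.1 h1.2 s hus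
  exact ⟨s, hs, hsz, key.tail h2 ⟨h2.snd_mem, hsz⟩⟩

/-- A part of a biconnected graph that is connected to the rest only by the vertices `x` and `y`
is a network. -/
theorem isSPNetwork_of_closed (hN : N.Finite) (hB : BiConn g N) (hxN : x ∈ N) (hyN : y ∈ N)
    (hxy : x ≠ y) (hx : x ∈ D.verts) (hy : y ∈ D.verts) (hDN : D.verts ⊆ N)
    (hcl : ∀ u ∈ D.verts, u ≠ x → u ≠ y → ∀ w, g.Adj u w → D.Adj u w)
    (hne : D.Adj x y ∨ ∃ u ∈ D.verts, u ≠ x ∧ u ≠ y)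
    (hK : ¬ HasKFour (D.spanningCoe ⊔ SimpleGraph.edge x y)) : IsSPNetwork D x y := by
  have pole : ∀ z, ∀ a ∈ D.verts, a ≠ z → ∃ s, (s = x ∨ s = y) ∧ s ≠ z ∧
      Linked D.spanningCoe (D.verts \ {z}) a s := fun z a ha haz =>
    exists_linked_pole_of_closed hB hxN hyN hxy hDN hcl ha haz
  have pole1 : ∀ a ∈ D.verts, a ≠ y → Linked D.spanningCoe D.verts a x := by
    intro a ha hay
    obtain ⟨s, hs, hsy, hl⟩ := pole y a ha hay
    rw [hs.resolve_right hsy] at hl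
    exact hl.mono_set Set.sdiff_subset
  have pole2 : ∀ a ∈ D.verts, a ≠ x → Linked D.spanningCoe D.verts a y := by
    intro a ha hay
    obtain ⟨s, hs, hsy, hl⟩ := pole x a ha hay
    rw [hs.resolve_left hsy] at hl
    exact hl.mono_set Set.sdiff_subset
  have hxyl : Linked D.spanningCoe D.verts x y := by
    rcases hne with h | ⟨u, hu, hux, huy⟩
    · exact .of_adj hx h hy
    · exact (pole1 u hu huy).symm.trans (pole2 u hu hux)
  have hconn : Conn D.spanningCoe D.verts := by
    refine .of_root hx fun a ha => ?_
    by_cases hay : a = y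
    · exact hay ▸ hxyl
    · exact (pole1 a ha hay).symm
  refine isSPNetwork_iff.2 ⟨hN.subset hDN, hx, hy, hxy, hconn, ⟨⟨x, hx, y, hy, hxy⟩, ?_, ?_, ?_⟩, hK⟩
  · rintro a b (hab | hab)
    · exact D.edge_vert hab
    · rcases ((SimpleGraph.edge_adj ..).1 hab).1 with ⟨rfl, -⟩ | ⟨rfl, -⟩ <;> assumption
  · exact fun a ha b hb => (hconn.2 a ha b hb).mono_graph le_sup_left
  · intro z a ha b hb haz hbz
    obtain ⟨s, hs, hsz, has⟩ := pole z a ha haz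
    obtain ⟨t, ht, htz, hbt⟩ := pole z b hb hbz
    have hst : Linked (D.spanningCoe ⊔ SimpleGraph.edge x y) (D.verts \ {z}) s t := by
      rcases hs with rfl | rfl <;> rcases ht with rfl | rfl
      · exact .refl has.right_mem
      · exact .of_adj has.right_mem (sup_edge_adj hxy) hbt.right_mem
      · exact .of_adj has.right_mem (sup_edge_adj hxy).symm hbt.right_mem
      · exact .refl has.right_mem
    exact ((has.mono_graph le_sup_left).trans hst).trans (hbt.mono_graph le_sup_left).symm

theorem IsKFour.subset {B : Fin 4 → Set V} (h : IsKFour g B) (hN : ∀ a b, g.Adj a b → a ∈ N)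
    (i : Fin 4) : B i ⊆ N := by
  intro u hu
  obtain ⟨j, hij⟩ := exists_ne i
  obtain ⟨p, hp, q, -, hpq⟩ := h.adj i j hij.symm
  exact ((h.conn i).2 p hp u hu).mem_of_closed (hN p q hpq) fun _ _ _ _ huw => hN _ _ huw.symm

/-- The component of `w` outside `D` is adjacent to both poles, as neither of them is a cut vertex.
It can therefore replace the edge `xy` in a `K₄` minor. -/
theorem not_hasKFour_of_outside (hB : BiConn g N) (hxN : x ∈ N) (hyN : y ∈ N) (hxy : x ≠ y)
    (hx : x ∈ D.verts) (hy : y ∈ D.verts) (hle : D.spanningCoe ≤ g)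
    (hcl : ∀ u ∈ D.verts, u ≠ x → u ≠ y → ∀ w, g.Adj u w → D.Adj u w)
    (hw : ∃ w ∈ N, w ∉ D.verts) (hK : ¬ HasKFour g) :
    ¬ HasKFour (D.spanningCoe ⊔ SimpleGraph.edge x y) := by
  rintro ⟨B, h⟩
  obtain ⟨w, hwN, hw⟩ := hw
  have hsub := h.subset (N := D.verts) (by
    rintro a b (hab | hab)
    · exact D.edge_vert hab
    · rcases ((SimpleGraph.edge_adj ..).1 hab).1 with ⟨rfl, -⟩ | ⟨rfl, -⟩ <;> assumption)
  have key : ∀ x y, x ∈ N → x ∈ D.verts → y ∈ D.verts → x ≠ y →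
      (∀ u ∈ D.verts, u ≠ x → u ≠ y → ∀ w, g.Adj u w → D.Adj u w) →
      ∃ z ∈ comp g D.vertsᶜ w, g.Adj x z := by
    intro x y hxN hx hy hxy hcl
    obtain ⟨u, s, hu, hus, hs, hsy⟩ := (hB.linked hwN hxN (x := y) (fun e => hw (e ▸ hy)) hxy).first_hit
      (S := D.verts) hw hx
    have hsx : s = x := by
      by_contra hsx
      exact hu.right_mem.2 (hcl s hs hsx hsy u hus.symm).snd_mem
    exact ⟨u, hu.mono_set fun p hp => hp.2, hsx ▸ hus.symm⟩
  refine hK (h.replace_edge (Z := comp g D.vertsᶜ w) hle (.comp hw) (fun i => ?_)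
    (key x y hxN hx hy hxy hcl)
    (key y x hyN hy hx hxy.symm fun u hu h1 h2 => hcl u hu h2 h1))
  exact Set.disjoint_left.2 fun p hp hp' => comp_subset hp' (hsub i hp)

/-- The piece that belongs to an edge of the torso. -/
def pieceSet (g : SimpleGraph V) (W : Set V) (e : Sym2 V) : Set V :=
  {u | u ∈ e ∨ (u ∉ W ∧ ∀ a ∈ e, Att g W u a)}

theorem mem_pieceSet : u ∈ pieceSet g W s(x, y) ↔
    u = x ∨ u = y ∨ (Att g W u x ∧ Att g W u y) := by
  simp only [pieceSet, Set.mem_ofPred_eq, Sym2.mem_iff, forall_eq_or_imp, forall_eq, or_assoc]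
  refine or_congr_right (or_congr_right ⟨And.right, fun h => ⟨h.1.notMem, h⟩⟩)

/-- The coloured graph given by the torso of a set `W` of vertices. -/
def torsoGraph (G : ColGraph k V) (W : Set V) (hW : W ⊆ G.graph.verts) (hr : G.root ∈ W)
    (hc : ∀ v, v ∉ W → G.col v = ∅) : ColGraph k V where
  graph :=
    { verts := W
      Adj := (torso G.graph.spanningCoe W).Adj
      adj_sub := fun h => h.1
      edge_vert := fun h => h.2.1
      symm := (torso G.graph.spanningCoe W).symm }
  root := G.root
  col := G.col
  finite := G.finite.subset hW
  root_mem := hr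
  col_eq_empty := hc

theorem exists_torso_adj (hB : BiConn g N) (hWN : W ⊆ N)
    (hW : ∀ x y, ∃ w ∈ W, w ≠ x ∧ w ≠ y) (hv : v ∈ W) :
    ∃ a b, a ≠ b ∧ (torso g W).Adj v a ∧ (torso g W).Adj v b := by
  obtain ⟨w, hw, hwv, -⟩ := hW v v
  obtain ⟨a, -, ha, -⟩ := ((hB.conn v (hWN hv) w (hWN hw)).torso hv hw).exists_adj hwv.symm
  obtain ⟨w', hw', hwv', hwa⟩ := hW v a
  obtain ⟨b, hb, hvb, -⟩ := ((hB.linked (hWN hv) (hWN hw') ha.ne hwa).torso hv hw').exists_adj hwv'.symm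
  exact ⟨a, b, fun e => hb.1 e.symm, ha, hvb⟩

theorem exists_ne_of_three {p q s : V} (hpq : p ≠ q) (hps : p ≠ s) (hqs : q ≠ s) (x y : V) :
    (p ≠ x ∧ p ≠ y) ∨ (q ≠ x ∧ q ≠ y) ∨ (s ≠ x ∧ s ≠ y) := by
  grind

/-- `H` is the torso of the set found in `exists_decomposition`, and the network of an edge is the
subgraph induced by its piece. -/
theorem exists_family (hk : 2 ≤ k) (hG : G ∈ blocks k V) :
    ∃ p ∈ apexTreeFamilies k V IsSPNetwork, IsSubstitution p G := by
  obtain ⟨hB, hcr, hcard, f, hf⟩ := mem_blocks_iff.1 hG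
  set g := G.graph.spanningCoe with hg
  set N := G.graph.verts with hN
  have hfcol : ∀ c, G.col (f c) = {c} := fun c =>
    Finset.eq_singleton_iff_unique_mem.2 ⟨((hf c).1 _).2 rfl, fun d hd =>
      Finset.card_le_one.1 (hcard _) d hd c (((hf c).1 _).2 rfl)⟩
  have hfinj : Function.Injective f := fun c d h => by
    have := hfcol c
    rw [h, hfcol d] at this
    simpa using this.symm
  have hS : ∀ v, (G.col v).Nonempty → ∃ c, v = f c := fun v ⟨c, hc⟩ => ⟨c, ((hf c).1 v).1 hc⟩
  have hfN : ∀ c, f c ∈ N := fun c => by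
    by_contra h
    have := G.col_eq_empty _ h
    simp [hfcol] at this
  have hfr : ∀ c, f c ≠ G.root := fun c h => by
    have := hfcol c
    rw [h, hcr] at this
    simp at this
  obtain ⟨W, hWN, hSW, hL, hdeg⟩ := exists_decomposition (g := g) (r := G.root) (S := Set.range f)
    G.finite hB G.root_mem (by rintro _ ⟨c, rfl⟩; exact hfN c)
    (by rintro ⟨c, hc⟩; exact hfr c hc) ⟨_, ⟨0, by lia⟩, rfl⟩
    (by rintro _ ⟨c, rfl⟩; exact (hf c).2)
  have hfW : ∀ c, f c ∈ W := fun c => hSW ⟨c, rfl⟩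
  have hcW : ∀ v, v ∉ W → G.col v = ∅ := by
    intro v hv
    by_contra hne
    obtain ⟨c, rfl⟩ := hS v (Finset.nonempty_iff_ne_empty.2 hne)
    exact hv (hfW c)
  -- Here `2 ≤ k` matters: the root and two coloured vertices are three vertices of `W`. So each
  -- piece has a vertex of `W` outside it, and each vertex of `W` has two neighbours in the torso.
  have hthree : ∀ x y, ∃ w ∈ W, w ≠ x ∧ w ≠ y := by
    intro x y
    have h01 : f ⟨0, by lia⟩ ≠ f ⟨1, by lia⟩ := fun h => by
      have := hfinj h
      simp at this
    have h0 := hfr ⟨0, by lia⟩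
    have h1 := hfr ⟨1, by lia⟩
    rcases exists_ne_of_three h01 h0 h1 x y with h | h | h
    · exact ⟨_, hfW _, h⟩
    · exact ⟨_, hfW _, h⟩
    · exact ⟨_, hL.root_mem, h⟩
  have hK : ¬ HasKFour g := fun h => (hf ⟨0, by lia⟩).2 (h.mono le_sup_left)
  set H := torsoGraph G W hWN hL.root_mem hcW with hH
  have hHadj : ∀ a b, H.graph.Adj a b ↔ (torso g W).Adj a b := fun a b => Iff.rfl
  let D : H.graph.edgeSet → LGraph V := fun e => G.graph.induce (pieceSet g W e.1)
  have hpN : ∀ x y, x ∈ W → y ∈ W → pieceSet g W s(x, y) ⊆ N := by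
    intro x y hx hy u hu
    rcases mem_pieceSet.1 hu with rfl | rfl | ⟨⟨-, w, hw, hwx⟩, -⟩
    · exact hWN hx
    · exact hWN hy
    · exact hB.mem_of_linked (hB.supp _ _ hwx) hw.symm
  have hpW : ∀ x y, x ∈ W → y ∈ W → pieceSet g W s(x, y) ∩ W = {x, y} := by
    intro x y hx hy
    ext u
    rw [Set.mem_inter_iff, mem_pieceSet]
    constructor
    · rintro ⟨h | h | h, hu⟩
      · exact .inl h
      · exact .inr h
      · exact absurd hu h.1.notMem
    · rintro (rfl | rfl)
      · exact ⟨.inl rfl, hx⟩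
      · exact ⟨.inr (.inl rfl), hy⟩
  refine ⟨⟨H, D⟩, ⟨mem_apexTrees_iff.2 ⟨hcr, hL.acyclic, ?_, ⟨f, fun c => ⟨hfW c, hfcol c⟩, hS⟩, ?_, ?_⟩,
    ?_, ?_⟩, ?_, ?_, rfl, rfl⟩
  · refine ⟨⟨_, hfW ⟨0, by lia⟩, hfr _⟩, fun a ha b hb => ?_⟩
    exact ((hB.linked (hWN ha.1) (hWN hb.1) ha.2 hb.2).torso ha.1 hb.1).mono_set
      fun u hu => ⟨hu.2, hu.1⟩
  · intro v hv hvr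
    obtain ⟨a, b, hab, ha, hb⟩ := exists_torso_adj hB hWN hthree hv
    by_cases har : a = G.root
    · exact .inr (har ▸ ha.symm)
    by_cases hbr : b = G.root
    · exact .inr (hbr ▸ hb.symm)
    exact .inl ⟨a, b, hab, har, hbr, ha, hb⟩
  · intro v hv hvr hcv
    refine hdeg v hv hvr ?_
    rintro ⟨c, rfl⟩
    have := hfcol c
    rw [show G.col (f c) = ∅ from hcv] at this
    simp at this
  · intro x y h
    obtain ⟨hxy, hx, hy, h'⟩ := id h
    refine ⟨?_, hpW x y hx hy⟩
    have hcl : ∀ u ∈ (D ⟨s(x, y), h⟩).verts, u ≠ x → u ≠ y → ∀ w, g.Adj u w →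
        (D ⟨s(x, y), h⟩).Adj u w := by
      intro u hu hux huy w huw
      obtain ⟨h1, h2⟩ := ((mem_pieceSet.1 hu).resolve_left hux).resolve_left huy
      exact ⟨hu, mem_pieceSet.2 (hL.two.piece_closed hxy h1 h2 huw), huw⟩
    have hxD : x ∈ (D ⟨s(x, y), h⟩).verts := mem_pieceSet.2 (.inl rfl)
    have hyD : y ∈ (D ⟨s(x, y), h⟩).verts := mem_pieceSet.2 (.inr (.inl rfl))
    refine isSPNetwork_of_closed G.finite hB (hWN hx) (hWN hy) hxy hxD hyD
      (hpN x y hx hy) hcl ?_ (not_hasKFour_of_outside hB (hWN hx) (hWN hy) hxy hxD hyD ?_ hcl ?_ hK)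
    · rcases h' with h' | ⟨u, h1, h2⟩
      · exact .inl ⟨hxD, hyD, h'⟩
      · exact .inr ⟨u, mem_pieceSet.2 (.inr (.inr ⟨h1, h2⟩)), fun e => h1.notMem (e ▸ hx),
          fun e => h1.notMem (e ▸ hy)⟩
    · exact fun a b hab => hab.2.2
    · obtain ⟨w, hw, hwx, hwy⟩ := hthree x y
      refine ⟨w, hWN hw, fun hwD => ?_⟩
      have : w ∈ pieceSet g W s(x, y) ∩ W := ⟨hwD, hw⟩
      rw [hpW x y hx hy] at this
      rcases this with h | h
      · exact hwx h
      · exact hwy h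
  · rintro ⟨e, he⟩ ⟨e', he'⟩ hne u ⟨hu, hu'⟩
    induction e with | _ x y
    induction e' with | _ x' y'
    by_contra huW
    have hux : ∀ x ∈ W, u ≠ x := fun x hx e => huW (show u ∈ W from e ▸ hx)
    have hT : (torso g W).Adj x y := he
    have hT' : (torso g W).Adj x' y' := he'
    obtain ⟨h1, h2⟩ := ((mem_pieceSet.1 hu).resolve_left (hux x hT.2.1)).resolve_left (hux y hT.2.2.1)
    obtain ⟨h3, h4⟩ := ((mem_pieceSet.1 hu').resolve_left (hux x' hT'.2.1)).resolve_left
      (hux y' hT'.2.2.1)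
    -- The poles of both edges are attachments of the shared interior vertex `u`, which has only
    -- two.
    refine hne (Subtype.ext (Sym2.eq_iff.2 ?_))
    have := hL.two.eq_or_eq h1 h2 hT.1 h3
    have := hL.two.eq_or_eq h1 h2 hT.1 h4
    have := hT'.1
    grind
  · refine Set.Subset.antisymm (fun u hu => ?_) (Set.union_subset hWN (Set.iUnion_subset ?_))
    · by_cases huW : u ∈ W
      · exact .inl huW
      · obtain ⟨x, y, hxy, hx, hy⟩ := hB.exists_two_att hu huW (hfN ⟨0, by lia⟩) G.root_mem (hfW _)
          hL.root_mem (hfr _)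
        exact .inr (Set.mem_iUnion.2 ⟨⟨s(x, y), ⟨hxy, hx.1, hy.1, .inr ⟨u, hx, hy⟩⟩⟩,
          mem_pieceSet.2 (.inr (.inr ⟨hx, hy⟩))⟩)
    · rintro ⟨e, he⟩
      induction e with | _ x y
      have hT : (torso g W).Adj x y := he
      exact hpN x y hT.2.1 hT.2.2.1
  · intro a b
    refine ⟨fun hab => ?_, fun ⟨e, he⟩ => he.2.2⟩
    have hab' : g.Adj a b := hab
    have key : ∀ a b, g.Adj a b → a ∉ W → ∃ e, (D e).Adj a b := by
      intro a b hab haW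
      obtain ⟨x, y, hxy, hx, hy⟩ := hB.exists_two_att (hB.supp _ _ hab) haW (hfN ⟨0, by lia⟩)
        G.root_mem (hfW _) hL.root_mem (hfr _)
      exact ⟨⟨s(x, y), ⟨hxy, hx.1, hy.1, .inr ⟨a, hx, hy⟩⟩⟩,
          mem_pieceSet.2 (.inr (.inr ⟨hx, hy⟩)),
          mem_pieceSet.2 (hL.two.piece_closed hxy hx hy hab), hab⟩
    by_cases ha : a ∈ W
    · by_cases hb : b ∈ W
      · exact ⟨⟨s(a, b), ⟨hab'.ne, ha, hb, .inl hab⟩⟩, mem_pieceSet.2 (.inl rfl),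
          mem_pieceSet.2 (.inr (.inl rfl)), hab⟩
      · obtain ⟨e, he⟩ := key b a hab'.symm hb
        exact ⟨e, he.symm⟩
    · exact key a b hab ha

end Pieces

/-! ### Recovering `H` and the networks from the result and the kept vertices -/

section Substitution

variable {k : ℕ} {V : Type*} {G G' : ColGraph k V} {D : LGraph V} {p p' : EdgeFamily k V}
  {x y z a b u v w : V}

theorem IsSPNetwork.exists_linked_adj (hD : IsSPNetwork D x y) (hu : u ∈ D.verts) (hux : u ≠ x)
    (huy : u ≠ y) : ∃ w, Linked D.spanningCoe (D.verts \ {x, y}) u w ∧ D.Adj w x := by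
  obtain ⟨-, hx, hy, hxy, -, hB, -⟩ := isSPNetwork_iff.1 hD
  obtain ⟨w, s, hw, hws, hs, hsy⟩ := (hB.linked hu hx huy hxy).first_hit (S := {x, y})
    (by simp [hux, huy]) (by simp)
  obtain rfl : s = x := hs.resolve_right hsy
  have hadj : ∀ a b, a ∉ ({s, y} : Set V) →
      (D.spanningCoe ⊔ SimpleGraph.edge s y).Adj a b → D.Adj a b := by
    rintro a b ha (hab | hab)
    · exact hab
    · rcases ((SimpleGraph.edge_adj ..).1 hab).1 with ⟨rfl, -⟩ | ⟨rfl, -⟩ <;> simp at ha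
  refine ⟨w, ?_, hadj _ _ hw.right_mem.2 hws⟩
  refine hw.induct (P := fun w => Linked D.spanningCoe (D.verts \ {s, y}) u w)
    (.refl ⟨hu, by simp [hux, huy]⟩) fun b c hb ih hbc hc => ?_
  have h := hadj b c hb.right_mem.2 hbc
  exact ih.tail h ⟨h.snd_mem, hc.2⟩

namespace IsAdmissible

theorem mono {𝒩 𝒩' : LGraph V → V → V → Prop} (h : ∀ D x y, 𝒩 D x y → 𝒩' D x y)
    (hp : IsAdmissible 𝒩 p) : IsAdmissible 𝒩' p :=
  ⟨fun x y hxy => (hp.1 x y hxy).imp_left (h _ _ _), hp.2⟩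

theorem verts_inter (hp : IsAdmissible IsSPNetwork p) (e : p.1.graph.edgeSet) :
    u ∈ (p.2 e).verts ∧ u ∈ p.1.graph.verts ↔ u ∈ e.1 := by
  obtain ⟨e, he⟩ := e
  induction e with | _ x y
  rw [← Set.mem_inter_iff, (hp.1 x y he).2, Sym2.mem_iff, Set.mem_insert_iff, Set.mem_singleton_iff]

theorem edge_eq (hp : IsAdmissible IsSPNetwork p) {e e' : p.1.graph.edgeSet}
    (hu : u ∈ (p.2 e).verts) (hu' : u ∈ (p.2 e').verts) (huW : u ∉ p.1.graph.verts) : e = e' := by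
  by_contra h
  exact huW (hp.2 e e' h ⟨hu, hu'⟩)

end IsAdmissible

namespace IsSubstitution

theorem adj_of_adj (hs : IsSubstitution p G) {e : p.1.graph.edgeSet} (h : (p.2 e).Adj a b) :
    G.graph.Adj a b := (hs.adj a b).2 ⟨e, h⟩

theorem adj_of_notMem (hp : IsAdmissible IsSPNetwork p) (hs : IsSubstitution p G)
    {e : p.1.graph.edgeSet} (hu : u ∈ (p.2 e).verts) (huW : u ∉ p.1.graph.verts)
    (h : G.graph.Adj u w) : (p.2 e).Adj u w := by
  obtain ⟨e', he'⟩ := (hs.adj u w).1 h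
  rwa [hp.edge_eq hu he'.fst_mem huW]

theorem mem_of_linked (hp : IsAdmissible IsSPNetwork p) (hs : IsSubstitution p G)
    {e : p.1.graph.edgeSet} (hu : u ∈ (p.2 e).verts)
    (h : Linked G.graph.spanningCoe p.1.graph.vertsᶜ u w) : w ∈ (p.2 e).verts := by
  refine h.induct (P := fun w => w ∈ (p.2 e).verts) hu fun b c hb ih hbc _ => ?_
  exact (hs.adj_of_notMem hp ih hb.right_mem hbc).snd_mem

/-- All edges at an interior vertex belong to its own network, and inside the network it reaches
each pole without passing through the other (`IsSPNetwork.exists_linked_adj`). -/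
theorem att_iff (hp : IsAdmissible IsSPNetwork p) (hs : IsSubstitution p G)
    {e : p.1.graph.edgeSet} (hu : u ∈ (p.2 e).verts) (huW : u ∉ p.1.graph.verts) :
    Att G.graph.spanningCoe p.1.graph.verts u a ↔ a ∈ e.1 := by
  constructor
  · rintro ⟨ha, w, hw, hwa⟩
    exact (hp.verts_inter e).1
      ⟨(hs.adj_of_notMem hp (hs.mem_of_linked hp hu hw) hw.right_mem hwa).snd_mem, ha⟩
  · obtain ⟨e, he⟩ := e
    have key : ∀ x y (h : p.1.graph.Adj x y), u ∈ (p.2 ⟨s(x, y), h⟩).verts →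
        Att G.graph.spanningCoe p.1.graph.verts u x := by
      intro x y h hu
      have hx : x ∈ p.1.graph.verts := h.fst_mem
      have hy : y ∈ p.1.graph.verts := h.snd_mem
      obtain ⟨w, hw, hwx⟩ := (hp.1 x y h).1.exists_linked_adj hu (fun e => huW (e ▸ hx))
        (fun e => huW (e ▸ hy))
      refine ⟨hx, w, hw.mono (fun a b hab => hs.adj_of_adj hab) fun c hc hcW => hc.2 ?_,
        hs.adj_of_adj hwx⟩
      rw [← (hp.1 x y h).2]
      exact ⟨hc.1, hcW⟩
    induction e with | _ x y
    rw [Sym2.mem_iff]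
    rintro (rfl | rfl)
    · exact key a y he hu
    · refine key a x he.symm ?_
      convert hu using 3
      exact Subtype.ext Sym2.eq_swap

theorem exists_edge_of_att (hp : IsAdmissible IsSPNetwork p) (hs : IsSubstitution p G)
    (h : Att G.graph.spanningCoe p.1.graph.verts u a) : ∃ e, u ∈ (p.2 e).verts := by
  obtain ⟨-, w, hw, hwa⟩ := h
  obtain ⟨e, he⟩ := (hs.adj w a).1 hwa
  exact ⟨e, hs.mem_of_linked hp he.fst_mem hw.symm⟩

theorem twoAtt (hp : IsAdmissible IsSPNetwork p) (hs : IsSubstitution p G) :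
    TwoAtt G.graph.spanningCoe p.1.graph.verts := by
  intro v
  by_cases h : ∃ a, Att G.graph.spanningCoe p.1.graph.verts v a
  · obtain ⟨a, ha⟩ := h
    obtain ⟨⟨e, he⟩, hv⟩ := hs.exists_edge_of_att hp ha
    induction e with | _ x y
    exact ⟨x, y, fun b hb => Sym2.mem_iff.1 ((hs.att_iff hp hv ha.notMem).1 hb)⟩
  · exact ⟨v, v, fun b hb => absurd ⟨b, hb⟩ h⟩

/-- A network is connected, so it joins its poles in the torso. Conversely, an edge or an outside
component between two kept vertices lies in one network, of which these vertices must be the poles.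
-/
theorem torso_adj_iff (hp : IsAdmissible IsSPNetwork p) (hs : IsSubstitution p G) :
    (torso G.graph.spanningCoe p.1.graph.verts).Adj x y ↔ p.1.graph.Adj x y := by
  constructor
  · rintro ⟨hxy, hx, hy, h⟩
    have key : ∃ e : p.1.graph.edgeSet, x ∈ e.1 ∧ y ∈ e.1 := by
      rcases h with h | ⟨v, hvx, hvy⟩
      · obtain ⟨e, he⟩ := (hs.adj x y).1 h
        exact ⟨e, (hp.verts_inter e).1 ⟨he.fst_mem, hx⟩, (hp.verts_inter e).1 ⟨he.snd_mem, hy⟩⟩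
      · obtain ⟨e, he⟩ := hs.exists_edge_of_att hp hvx
        exact ⟨e, (hs.att_iff hp he hvx.notMem).1 hvx, (hs.att_iff hp he hvx.notMem).1 hvy⟩
    obtain ⟨⟨e, he⟩, h⟩ := key
    obtain rfl : e = s(x, y) := (Sym2.mem_and_mem_iff hxy).1 h
    exact he
  · intro h
    refine ⟨h.ne, h.fst_mem, h.snd_mem, ?_⟩
    obtain ⟨-, hx, hy, -, hc, -, -⟩ := isSPNetwork_iff.1 (hp.1 x y h).1
    obtain ⟨c, hc, hxc, -⟩ := (hc.2 x hx y hy).exists_adj h.ne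
    by_cases hcW : c ∈ p.1.graph.verts
    · have : c ∈ (p.2 ⟨s(x, y), h⟩).verts ∩ p.1.graph.verts := ⟨hc, hcW⟩
      rw [(hp.1 x y h).2] at this
      rcases this with rfl | rfl
      · exact absurd rfl (SimpleGraph.Subgraph.Adj.ne hxc)
      · exact .inl (hs.adj_of_adj hxc)
    · exact .inr ⟨c, (hs.att_iff hp hc hcW).2 (by simp), (hs.att_iff hp hc hcW).2 (by simp)⟩

theorem verts_eq_pieceSet (hp : IsAdmissible IsSPNetwork p) (hs : IsSubstitution p G)
    (e : p.1.graph.edgeSet) :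
    (p.2 e).verts = pieceSet G.graph.spanningCoe p.1.graph.verts e.1 := by
  ext u
  by_cases huW : u ∈ p.1.graph.verts
  · have h := hp.verts_inter (u := u) e
    simp only [huW, and_true] at h
    rw [h]
    simp [pieceSet, huW]
  · have hue : u ∉ e.1 := fun h => huW ((hp.verts_inter e).2 h).2
    simp only [pieceSet, Set.mem_ofPred_eq, hue, huW, false_or, not_false_eq_true, true_and]
    refine ⟨fun hu a ha => (hs.att_iff hp hu huW).2 ha, fun h => ?_⟩
    obtain ⟨e, he⟩ := e
    induction e with | _ x y
    obtain ⟨e', he'⟩ := hs.exists_edge_of_att hp (h x (by simp))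
    have hx := (hs.att_iff hp he' huW).1 (h x (by simp))
    have hy := (hs.att_iff hp he' huW).1 (h y (by simp))
    obtain rfl : e' = ⟨s(x, y), he⟩ :=
      Subtype.ext ((Sym2.mem_and_mem_iff (SimpleGraph.Subgraph.Adj.ne he)).1 ⟨hx, hy⟩)
    exact he'

/-- The network to which an edge of `G` belongs is determined by an interior end or, if both ends
are kept, by the pair of poles. -/
theorem eq_induce (hp : IsAdmissible IsSPNetwork p) (hs : IsSubstitution p G)
    (e : p.1.graph.edgeSet) :
    p.2 e = G.graph.induce (pieceSet G.graph.spanningCoe p.1.graph.verts e.1) := by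
  rw [← hs.verts_eq_pieceSet hp]
  refine SimpleGraph.Subgraph.ext rfl ?_
  ext a b
  refine ⟨fun h => ⟨h.fst_mem, h.snd_mem, hs.adj_of_adj h⟩, fun ⟨ha, hb, h⟩ => ?_⟩
  by_cases haW : a ∈ p.1.graph.verts
  · by_cases hbW : b ∈ p.1.graph.verts
    · obtain ⟨e', he'⟩ := (hs.adj a b).1 h
      have h1 := (hp.verts_inter e).1 ⟨ha, haW⟩
      have h2 := (hp.verts_inter e).1 ⟨hb, hbW⟩
      have h3 := (hp.verts_inter e').1 ⟨he'.fst_mem, haW⟩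
      have h4 := (hp.verts_inter e').1 ⟨he'.snd_mem, hbW⟩
      have : e = e' := Subtype.ext (((Sym2.mem_and_mem_iff h.ne).1 ⟨h1, h2⟩).trans
        ((Sym2.mem_and_mem_iff h.ne).1 ⟨h3, h4⟩).symm)
      rwa [this]
    · exact (hs.adj_of_notMem hp hb hbW h.symm).symm
  · exact hs.adj_of_notMem hp ha haW h

/-- A substitution is determined by the resulting graph and the vertices that are kept. -/
theorem family_eq (hp : IsAdmissible IsSPNetwork p) (hs : IsSubstitution p G)
    (hp' : IsAdmissible IsSPNetwork p') (hs' : IsSubstitution p' G)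
    (h : p.1.graph.verts = p'.1.graph.verts) : p = p' := by
  have h1 : p.1 = p'.1 := by
    refine ColGraph.ext (SimpleGraph.Subgraph.ext h ?_) (hs.root.symm.trans hs'.root)
      (hs.col.symm.trans hs'.col)
    ext a b
    rw [← hs.torso_adj_iff hp, ← hs'.torso_adj_iff hp', h]
  obtain ⟨H, D⟩ := p
  obtain ⟨H', D'⟩ := p'
  obtain rfl : H = H' := h1
  congr 1
  funext e
  exact (hs.eq_induce hp e).trans (hs'.eq_induce hp' e).symm

theorem eq (hs : IsSubstitution p G) (hs' : IsSubstitution p G') : G = G' := by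
  refine ColGraph.ext (SimpleGraph.Subgraph.ext (hs.verts.trans hs'.verts.symm) ?_)
    (hs.root.trans hs'.root.symm) (hs.col.trans hs'.col.symm)
  ext a b
  rw [hs.adj, hs'.adj]

end IsSubstitution

theorem existsUnique_isSubstitution (hp : IsAdmissible IsSPNetwork p) :
    ∃! G : ColGraph k V, IsSubstitution p G := by
  have hfin : p.1.graph.edgeSet.Finite := by
    refine ((p.1.finite.prod p.1.finite).image fun q => s(q.1, q.2)).subset fun e he => ?_
    induction e with | _ x y
    exact ⟨(x, y), ⟨p.1.graph.edge_vert he, SimpleGraph.Subgraph.Adj.snd_mem he⟩, rfl⟩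
  have : Finite p.1.graph.edgeSet := hfin
  refine ⟨{
    graph :=
      { verts := p.1.graph.verts ∪ ⋃ e, (p.2 e).verts
        Adj := fun a b => ∃ e, (p.2 e).Adj a b
        adj_sub := fun ⟨e, he⟩ => (p.2 e).adj_sub he
        edge_vert := fun ⟨e, he⟩ => .inr (Set.mem_iUnion.2 ⟨e, (p.2 e).edge_vert he⟩)
        symm := ⟨fun _ _ ⟨e, he⟩ => ⟨e, he.symm⟩⟩ }
    root := p.1.root
    col := p.1.col
    finite := p.1.finite.union (Set.finite_iUnion fun ⟨e, he⟩ => by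
      induction e with | _ x y
      exact (hp.1 x y he).1.1)
    root_mem := .inl p.1.root_mem
    col_eq_empty := fun v hv => p.1.col_eq_empty v fun h => hv (.inl h) },
    ⟨rfl, fun _ _ => Iff.rfl, rfl, rfl⟩, fun G' hG' => hG'.eq ⟨rfl, fun _ _ => Iff.rfl, rfl, rfl⟩⟩

end Substitution

/-! ### Reaching a leaf in a finite forest -/

section Leaves

variable {V : Type*} {T : SimpleGraph V} {x y a z : V} {P : V → Prop}

/-- Each branch of a finite forest contains a vertex that satisfies `P`, if all leaves do. -/
theorem exists_leaf_of_adj {N : Set V} (hN : N.Finite) (hsupp : ∀ a b, T.Adj a b → a ∈ N)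
    (hT : T.IsAcyclic) (hP : ∀ v ∈ N, P v ∨ ∃ a b, a ≠ b ∧ T.Adj v a ∧ T.Adj v b)
    (hxy : T.Adj x y) : ∃ v, Linked T {x}ᶜ y v ∧ P v := by
  rw [isAcyclic_iff_not_linked] at hT
  have hfin : ∀ x y, T.Adj x y → (comp T {x}ᶜ y).Finite := fun x y hxy =>
    hN.subset fun u hu => hu.mem_of_closed (hsupp _ _ hxy.symm) fun _ _ _ _ h => hsupp _ _ h.symm
  induction hn : (comp T {x}ᶜ y).ncard using Nat.strong_induction_on generalizing x y with
  | _ n ih =>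
    have hyx : y ∈ ({x}ᶜ : Set V) := hxy.symm.ne
    rcases hP y (hsupp _ _ hxy.symm) with h | ⟨a, b, hab, hya, hyb⟩
    · exact ⟨y, .refl hyx, h⟩
    obtain ⟨w, hwx, hyw⟩ : ∃ w, w ≠ x ∧ T.Adj y w := by
      by_cases h : a = x
      · exact ⟨b, fun e => hab (h.trans e.symm), hyb⟩
      · exact ⟨a, h, hya⟩
    have hsub : comp T {y}ᶜ w ⊆ {x}ᶜ := by
      rintro u hu rfl
      exact hT y w u hyw hxy.symm hwx hu
    have hlink : ∀ u, Linked T {y}ᶜ w u → Linked T {x}ᶜ y u := fun u hu =>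
      (Linked.of_adj hyx hyw hwx).trans (hu.in_comp.mono_set hsub)
    -- The branch that starts at `w` is contained in the branch of `y` and lacks `y` itself.
    have hlt : (comp T {y}ᶜ w).ncard < n := by
      rw [← hn]
      refine Set.ncard_lt_ncard ⟨fun u hu => hlink u hu, fun h => ?_⟩ (hfin _ _ hxy)
      exact comp_subset (h (self_mem_comp hyx)) rfl
    obtain ⟨v, hv, hPv⟩ := ih _ hlt hyw rfl
    exact ⟨v, hlink v hv, hPv⟩

/-- At most one branch at `a` contains `z`; any other branch leads to a leaf. -/
theorem exists_leaf_avoiding {N : Set V} (hN : N.Finite) (hsupp : ∀ a b, T.Adj a b → a ∈ N)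
    (hT : T.IsAcyclic) (hP : ∀ v ∈ N, P v ∨ ∃ a b, a ≠ b ∧ T.Adj v a ∧ T.Adj v b) (ha : a ∈ N)
    (haz : a ≠ z) : ∃ v, Linked T {z}ᶜ a v ∧ P v := by
  rcases hP a ha with h | ⟨b, c, hbc, hab, hac⟩
  · exact ⟨a, .refl haz, h⟩
  obtain ⟨y, hay, hy⟩ : ∃ y, T.Adj a y ∧ ¬ Linked T {a}ᶜ y z := by
    by_contra! hcon
    exact isAcyclic_iff_not_linked.1 hT a b c hab hac hbc ((hcon b hab).trans (hcon c hac).symm)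
  obtain ⟨v, hv, hPv⟩ := exists_leaf_of_adj hN hsupp hT hP hay
  have hsub : comp T {a}ᶜ y ⊆ {z}ᶜ := by
    rintro u hu rfl
    exact hy hu
  have hv' := hv.in_comp.mono_set hsub
  exact ⟨v, (Linked.of_adj haz hay hv'.left_mem).trans hv', hPv⟩

end Leaves

/-! ### Substitutions into graphs of `ℱ'_k` are in `ℬ_k` -/

section Blocks

variable {k : ℕ} {V : Type*} {G : ColGraph k V} {p : EdgeFamily k V} {D : LGraph V}
  {x y z a b u v w : V} {X : Set V}

theorem IsApexTree.exists_linked_adj_root {H : ColGraph k V} (h : IsApexTree H)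
    (ha : a ∈ H.graph.verts) (har : a ≠ H.root) (haz : a ≠ z) :
    ∃ v, Linked H.graph.spanningCoe {z}ᶜ a v ∧ H.graph.Adj H.root v := by
  have hTadj : ∀ a b, (H.graph.spanningCoe.deleteIncidenceSet H.root).Adj a b ↔
      H.graph.Adj a b ∧ a ≠ H.root ∧ b ≠ H.root := fun a b => by
    rw [SimpleGraph.deleteIncidenceSet_adj]
    rfl
  obtain ⟨v, hv, hrv⟩ := exists_leaf_avoiding (z := z) (P := fun v => H.graph.Adj H.root v)
    (T := H.graph.spanningCoe.deleteIncidenceSet H.root) (N := H.graph.verts \ {H.root})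
    (H.finite.subset Set.sdiff_subset)
    (fun a b hab => ⟨((hTadj a b).1 hab).1.fst_mem, ((hTadj a b).1 hab).2.1⟩) h.acyclic
    (fun v hv => (h.leaf v hv.1 hv.2).symm.imp_right fun ⟨a, b, hab, har, hbr, hva, hvb⟩ =>
      ⟨a, b, hab, (hTadj _ _).2 ⟨hva, hv.2, har⟩, (hTadj _ _).2 ⟨hvb, hv.2, hbr⟩⟩) ⟨ha, har⟩ haz
  exact ⟨v, hv.mono_graph fun a b hab => ((hTadj a b).1 hab).1, hrv⟩

theorem IsApexTree.linked_root {H : ColGraph k V} (h : IsApexTree H)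
    (ha : a ∈ H.graph.verts) (haz : a ≠ z) (hz : z ≠ H.root) :
    Linked H.graph.spanningCoe {z}ᶜ a H.root := by
  by_cases har : a = H.root
  · exact har ▸ .refl haz
  obtain ⟨v, hv, hrv⟩ := h.exists_linked_adj_root ha har haz
  exact hv.tail hrv.symm hz.symm

theorem Linked.inter_of_supp {g : SimpleGraph V} {N : Set V} (h : Linked g X a b) (ha : a ∈ N)
    (hsupp : ∀ a b, g.Adj a b → a ∈ N) : Linked g (N ∩ X) a b :=
  h.induct (P := fun b => Linked g (N ∩ X) a b) (.refl ⟨ha, h.left_mem⟩) fun _ _ _ ih huw hw =>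
    ih.tail huw ⟨hsupp _ _ huw.symm, hw⟩

theorem BiConn.of_linked {g : SimpleGraph V} {N : Set V} (hne : N.Nontrivial)
    (hsupp : ∀ a b, g.Adj a b → a ∈ N)
    (h : ∀ z, ∀ a ∈ N, ∀ b ∈ N, a ≠ z → b ≠ z → Linked g {z}ᶜ a b)
    (hc : ∀ a ∈ N, ∀ b ∈ N, Linked g Set.univ a b) : BiConn g N where
  nontrivial := hne
  supp := hsupp
  conn a ha b hb := ((hc a ha b hb).inter_of_supp ha hsupp).mono_set Set.inter_subset_left
  cut z a ha b hb haz hbz := (h z a ha b hb haz hbz).inter_of_supp ha hsupp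

/-- Without the root a connected tree remains. Without any other vertex `z`, each remaining vertex
still reaches the root, because the forest offers a way around `z` to a neighbour of the root. -/
theorem IsApexTree.biConn {H : ColGraph k V} (h : IsApexTree H) :
    BiConn H.graph.spanningCoe H.graph.verts := by
  obtain ⟨⟨c, hc, hcr⟩, hconn⟩ := h.conn
  have key : ∀ a ∈ H.graph.verts, Linked H.graph.spanningCoe Set.univ a H.root := by
    intro a ha
    by_cases har : a = H.root
    · exact har ▸ .refl trivial
    obtain ⟨v, hv, hrv⟩ := h.exists_linked_adj_root ha har har
    exact (hv.mono_set (Set.subset_univ _)).tail hrv.symm trivial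
  refine .of_linked ⟨c, hc, _, H.root_mem, hcr⟩ (fun a b hab => H.graph.edge_vert hab) ?_
    fun a ha b hb => (key a ha).trans (key b hb).symm
  intro z a ha b hb haz hbz
  by_cases hz : z = H.root
  · subst hz
    exact (hconn a ⟨ha, haz⟩ b ⟨hb, hbz⟩).mono_set fun _ hu => hu.2
  · exact (h.linked_root ha haz hz).trans (h.linked_root hb hbz hz).symm

theorem IsSPNetwork.exists_linked_pole (hD : IsSPNetwork D x y) (hu : u ∈ D.verts) (huz : u ≠ z) :
    ∃ s, (s = x ∨ s = y) ∧ s ≠ z ∧ Linked D.spanningCoe (D.verts \ {z}) u s := by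
  obtain ⟨-, hx, hy, hxy, -, hB, -⟩ := isSPNetwork_iff.1 hD
  refine exists_linked_pole_of_closed hB hx hy hxy subset_rfl (fun a _ hax hay b hab => ?_) hu huz
  rcases hab with hab | hab
  · exact hab
  · rcases ((SimpleGraph.edge_adj ..).1 hab).1 with ⟨rfl, -⟩ | ⟨rfl, -⟩
    · exact absurd rfl hax
    · exact absurd rfl hay

namespace IsSubstitution

theorem exists_linked_kept (hp : IsAdmissible IsSPNetwork p) (hs : IsSubstitution p G)
    (hu : u ∈ G.graph.verts) (huz : u ≠ z) :
    ∃ s ∈ p.1.graph.verts, s ≠ z ∧ Linked G.graph.spanningCoe {z}ᶜ u s := by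
  rw [hs.verts] at hu
  rcases hu with hu | hu
  · exact ⟨u, hu, huz, .refl huz⟩
  obtain ⟨⟨e, he⟩, hu⟩ := Set.mem_iUnion.1 hu
  induction e with | _ x y
  obtain ⟨s, hsxy, hsz, hl⟩ := (hp.1 x y he).1.exists_linked_pole hu huz
  refine ⟨s, ?_, hsz, hl.mono (fun a b hab => hs.adj_of_adj hab) fun _ h => h.2⟩
  rcases hsxy with rfl | rfl
  · exact SimpleGraph.Subgraph.Adj.fst_mem he
  · exact SimpleGraph.Subgraph.Adj.snd_mem he

theorem linked_of_adj (hp : IsAdmissible IsSPNetwork p) (hs : IsSubstitution p G)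
    (h : p.1.graph.Adj x y) : Linked G.graph.spanningCoe (p.2 ⟨s(x, y), h⟩).verts x y := by
  obtain ⟨-, hx, hy, -, hc, -⟩ := isSPNetwork_iff.1 (hp.1 x y h).1
  exact (hc.2 x hx y hy).mono_graph fun a b hab => hs.adj_of_adj hab

/-- Every vertex reaches a kept vertex inside its network while avoiding `z`, and walks of `H` lift
to `G` network by network. -/
theorem biConn (hp : IsAdmissible IsSPNetwork p) (hs : IsSubstitution p G)
    (hH : BiConn p.1.graph.spanningCoe p.1.graph.verts)
    (hthree : ∀ x y, ∃ w ∈ p.1.graph.verts, w ≠ x ∧ w ≠ y) :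
    BiConn G.graph.spanningCoe G.graph.verts := by
  have hWN : p.1.graph.verts ⊆ G.graph.verts := hs.verts ▸ Set.subset_union_left
  have lift : ∀ X Y : Set V, ∀ a b, Linked p.1.graph.spanningCoe X a b → a ∈ Y →
      (∀ u ∈ X, ∀ w ∈ X, ∀ h : p.1.graph.Adj u w, (p.2 ⟨s(u, w), h⟩).verts ⊆ Y) →
      Linked G.graph.spanningCoe Y a b := by
    intro X Y a b hl ha h
    exact hl.induct (P := fun b => Linked G.graph.spanningCoe Y a b) (.refl ha)
      fun u w hu ih huw hw => ih.trans
        ((hs.linked_of_adj hp huw).mono_set (h u hu.right_mem w hw huw))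
  have kept : ∀ z, ∀ a ∈ p.1.graph.verts, ∀ b ∈ p.1.graph.verts, a ≠ z → b ≠ z →
      Linked G.graph.spanningCoe {z}ᶜ a b := by
    intro z a ha b hb haz hbz
    by_cases hz : z ∉ p.1.graph.verts ∧ ∃ e, z ∈ (p.2 e).verts
    · obtain ⟨hzW, ⟨e, he⟩, hze⟩ := hz
      induction e with | _ x y
      obtain ⟨w, hw, hwx, hwy⟩ := hthree x y
      -- When `z` is interior to the network of `e = xy`, a walk of `H` that avoids one end of `e`
      -- does not use `e`, so its lift avoids `z`. Each kept vertex differs from one of the ends,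
      -- and `w` differs from both.
      have key : ∀ t ∈ s(x, y), ∀ a ∈ p.1.graph.verts, a ≠ t → w ≠ t →
          Linked G.graph.spanningCoe {z}ᶜ a w := by
        intro t ht a ha hat hwt
        refine lift {t}ᶜ {z}ᶜ a w (hH.linked ha hw hat hwt) (fun e => hzW (e ▸ ha)) ?_
        rintro c hc d hd hcd q hq rfl
        have := congrArg Subtype.val (hp.edge_eq hze hq hzW)
        rw [show s(x, y) = s(c, d) from this, Sym2.mem_iff] at ht
        rcases ht with rfl | rfl
        · exact hc rfl
        · exact hd rfl
      have main : ∀ a ∈ p.1.graph.verts, Linked G.graph.spanningCoe {z}ᶜ a w := by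
        intro a ha
        by_cases hax : a = x
        · exact key y (by simp) a ha (hax ▸ SimpleGraph.Subgraph.Adj.ne he) hwy
        · exact key x (by simp) a ha hax hwx
      exact (main a ha).trans (main b hb).symm
    · refine lift {z}ᶜ {z}ᶜ a b (hH.linked ha hb haz hbz) haz ?_
      rintro c hc d hd hcd q hq rfl
      have hqW : q ∈ p.1.graph.verts := by
        by_contra hqW
        exact hz ⟨hqW, _, hq⟩
      rcases Sym2.mem_iff.1 ((hp.verts_inter _).1 ⟨hq, hqW⟩) with rfl | rfl
      · exact hc rfl
      · exact hd rfl
  have hsupp : ∀ a b, G.graph.spanningCoe.Adj a b → a ∈ G.graph.verts :=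
    fun a b hab => G.graph.edge_vert hab
  have main : ∀ z, ∀ a ∈ G.graph.verts, ∀ b ∈ G.graph.verts, a ≠ z → b ≠ z →
      Linked G.graph.spanningCoe {z}ᶜ a b := by
    intro z a ha b hb haz hbz
    obtain ⟨c, hc, hcz, hac⟩ := hs.exists_linked_kept hp ha haz
    obtain ⟨d, hd, hdz, hbd⟩ := hs.exists_linked_kept hp hb hbz
    exact (hac.trans (kept z c hc d hd hcz hdz)).trans hbd.symm
  refine .of_linked (hH.nontrivial.mono hWN) hsupp main fun a ha b hb => ?_
  by_cases hab : a = b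
  · exact hab ▸ .refl trivial
  obtain ⟨w, hw, hwa, hwb⟩ := hthree a b
  exact ((main b a ha w (hWN hw) hab hwb).mono_set (Set.subset_univ _)).trans
    ((main a w (hWN hw) b hb hwa (Ne.symm hab)).mono_set (Set.subset_univ _))

/-- If all branch sets meet the kept vertices, the torso contains the minor, although without `x` it
is a forest. Otherwise a branch set lies inside a single network, so all other branch sets touch
this network, and the minor survives in it once its poles are joined. -/
theorem not_hasKFour (hp : IsAdmissible IsSPNetwork p) (hs : IsSubstitution p G)
    (hr : x ∈ p.1.graph.verts) (hv : v ∈ p.1.graph.verts)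
    (hac : (p.1.graph.spanningCoe.deleteIncidenceSet x).IsAcyclic) :
    ¬ HasKFour (G.graph.spanningCoe ⊔ SimpleGraph.edge x v) := by
  rintro ⟨B, hB⟩
  set W := p.1.graph.verts with hW
  set g' := G.graph.spanningCoe ⊔ SimpleGraph.edge x v with hg'
  have hedge : ∀ a b, g'.Adj a b → G.graph.Adj a b ∨ (a = x ∧ b = v) ∨ (a = v ∧ b = x) := by
    rintro a b (hab | hab)
    · exact .inl hab
    · exact .inr ((SimpleGraph.edge_adj ..).1 hab).1
  have hout : ∀ a b, g'.Adj a b → a ∉ W → G.graph.Adj a b := by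
    intro a b hab ha
    rcases hedge a b hab with h | ⟨rfl, -⟩ | ⟨rfl, -⟩
    · exact h
    · exact absurd hr ha
    · exact absurd hv ha
  by_cases hmeet : ∀ i, (B i ∩ W).Nonempty
  · refine not_hasKFour_of_isAcyclic (r := x) hac (fun a b hax hbx hab => ?_) (hB.torso hmeet)
    rw [SimpleGraph.deleteIncidenceSet_adj]
    refine ⟨(hs.torso_adj_iff hp).1 ⟨hab.1, hab.2.1, hab.2.2.1, ?_⟩, hax, hbx⟩
    have hatt : ∀ u a, Att g' W u a → Att G.graph.spanningCoe W u a := by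
      rintro u a ⟨ha, w, hw, hwa⟩
      refine ⟨ha, w, hw.transfer id hw.left_mem fun c hc d hd hcd _ => .of_adj hc (hout c d hcd hc) hd,
        hout w a hwa hw.right_mem⟩
    refine hab.2.2.2.imp (fun h => ?_) fun ⟨u, hu⟩ => ⟨u, hatt u a hu.1, hatt u b hu.2⟩
    exact (hedge a b h).resolve_right (by rintro (⟨h, -⟩ | ⟨-, h⟩) <;> contradiction)
  · push Not at hmeet
    obtain ⟨i, hi⟩ := hmeet
    have hiW : ∀ u ∈ B i, u ∉ W := fun u hu huW => by
      have : u ∈ B i ∩ W := ⟨hu, huW⟩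
      simp [hi] at this
    obtain ⟨j, hji⟩ := exists_ne i
    obtain ⟨u, hu, w, hw, huw⟩ := hB.adj i j hji.symm
    obtain ⟨⟨e, he⟩, hue⟩ := (hs.adj u w).1 (hout u w huw (hiW u hu))
    have huD := hue.fst_mem
    clear hue
    induction e with | _ s t
    set D := p.2 ⟨s(s, t), he⟩ with hD
    have hclD : ∀ c d, c ∈ D.verts → c ∉ W → g'.Adj c d → D.Adj c d := fun c d hc hcW hcd =>
      hs.adj_of_notMem hp hc hcW (hout c d hcd hcW)
    have hiD : ∀ c ∈ B i, c ∈ D.verts := by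
      intro c hc
      refine ((hB.conn i).2 u hu c hc).induct (P := fun c => c ∈ D.verts) huD ?_
      exact fun c d hc ih hcd _ => (hclD c d ih (hiW c hc.right_mem) hcd).snd_mem
    have hmeetD : ∀ l, (B l ∩ D.verts).Nonempty := by
      intro l
      by_cases hl : l = i
      · exact ⟨u, hl ▸ hu, huD⟩
      obtain ⟨c, hc, d, hd, hcd⟩ := hB.adj i l (Ne.symm hl)
      exact ⟨d, hd, (hclD c d (hiD c hc) (hiW c hc) hcd).snd_mem⟩
    obtain ⟨-, -, -, hst, -, -, hK⟩ := isSPNetwork_iff.1 (hp.1 s t he).1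
    -- Only the poles of `D` have edges that leave `D`, so its torso has at most the edge `st` in
    -- addition to the edges of `D`.
    refine hK ((hB.torso hmeetD).mono ?_)
    rintro a b ⟨hab, haD, hbD, h⟩
    have hpole : a ∈ W → b ∈ W → (D.spanningCoe ⊔ SimpleGraph.edge s t).Adj a b := by
      intro haW hbW
      have h1 := Sym2.mem_iff.1 ((hp.verts_inter _).1 ⟨haD, haW⟩)
      have h2 := Sym2.mem_iff.1 ((hp.verts_inter _).1 ⟨hbD, hbW⟩)
      rcases h1 with rfl | rfl <;> rcases h2 with rfl | rfl
      · exact absurd rfl hab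
      · exact sup_edge_adj hst
      · exact (sup_edge_adj hst).symm
      · exact absurd rfl hab
    rcases h with h | ⟨c, ⟨-, d, hcd, hda⟩, ⟨-, d', hcd', hdb'⟩⟩
    · by_cases haW : a ∈ W
      · by_cases hbW : b ∈ W
        · exact hpole haW hbW
        · exact .inl (hclD b a hbD hbW h.symm).symm
      · exact .inl (hclD a b haD haW h)
    · refine hpole ?_ ?_
      · by_contra haW
        exact hcd.right_mem (hclD a d haD haW hda.symm).snd_mem
      · by_contra hbW
        exact hcd'.right_mem (hclD b d' hbD hbW hdb'.symm).snd_mem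

end IsSubstitution

theorem IsApexTree.exists_ne {H : ColGraph k V} (h : IsApexTree H) (hk : 2 ≤ k) (x y : V) :
    ∃ w ∈ H.graph.verts, w ≠ x ∧ w ≠ y := by
  obtain ⟨f, hf, -⟩ := h.coloured
  have hr : ∀ i, f i ≠ H.root := fun i e => by
    have := (hf i).2
    rw [e, h.root_uncoloured] at this
    simp at this
  have h01 : f ⟨0, by lia⟩ ≠ f ⟨1, by lia⟩ := fun e => by
    have := (hf ⟨0, by lia⟩).2
    rw [e, (hf _).2] at this
    simp at this
  rcases exists_ne_of_three h01 (hr _) (hr _) x y with h | h | h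
  · exact ⟨_, (hf _).1, h⟩
  · exact ⟨_, (hf _).1, h⟩
  · exact ⟨_, H.root_mem, h⟩

theorem mem_blocks_of_isSubstitution (hk : 2 ≤ k) (hp : p ∈ apexTreeFamilies k V IsSPNetwork)
    (hs : IsSubstitution p G) : G ∈ blocks k V := by
  obtain ⟨hH, hp⟩ := hp
  rw [mem_apexTrees_iff] at hH
  obtain ⟨f, hf, hf'⟩ := hH.coloured
  rw [mem_blocks_iff, hs.col, hs.root]
  refine ⟨hs.biConn hp hH.biConn (hH.exists_ne hk), hH.root_uncoloured, fun v => ?_, f, fun c => ⟨?_, ?_⟩⟩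
  · rcases (p.1.col v).eq_empty_or_nonempty with h | h
    · simp [h]
    · obtain ⟨i, rfl⟩ := hf' v h
      simp [(hf i).2]
  · refine fun u => ⟨fun hu => ?_, fun hu => ?_⟩
    · obtain ⟨i, rfl⟩ := hf' u ⟨c, hu⟩
      rw [(hf i).2, Finset.mem_singleton] at hu
      rw [hu]
    · rw [hu, (hf c).2, Finset.mem_singleton]
  · exact hs.not_hasKFour hp p.1.root_mem (hf c).1 hH.acyclic

end Blocks

/-! ### The kept vertices are determined by the graph -/

section Uniqueness

variable {k : ℕ} {V : Type*} {G : ColGraph k V} {p p' : EdgeFamily k V} {W : Set V}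
  {x y z a b u v w : V}

/-- Each branch of the tree contains a coloured vertex. -/
theorem IsApexTree.exists_coloured_of_adj {H : ColGraph k V} (hH : IsApexTree H)
    (hxy : H.graph.Adj x y) (hxr : x ≠ H.root) (hyr : y ≠ H.root) :
    ∃ v, Linked (H.graph.spanningCoe.deleteIncidenceSet H.root) {x}ᶜ y v ∧ (H.col v).Nonempty := by
  have hTadj : ∀ a b, (H.graph.spanningCoe.deleteIncidenceSet H.root).Adj a b ↔
      H.graph.Adj a b ∧ a ≠ H.root ∧ b ≠ H.root := fun a b => SimpleGraph.deleteIncidenceSet_adj ..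
  refine exists_leaf_of_adj (N := H.graph.verts \ {H.root}) (H.finite.subset Set.sdiff_subset)
    (fun a b hab => ⟨((hTadj a b).1 hab).1.fst_mem, ((hTadj a b).1 hab).2.1⟩) hH.acyclic
    (fun v hv => ?_) ((hTadj _ _).2 ⟨hxy, hxr, hyr⟩)
  rcases (H.col v).eq_empty_or_nonempty with h | h
  · right
    obtain ⟨a, b, c, hab, hac, hbc, hva, hvb, hvc⟩ := hH.degree v hv.1 hv.2 h
    by_cases har : a = H.root
    · exact ⟨b, c, hbc, (hTadj _ _).2 ⟨hvb, hv.2, fun e => hab (har.trans e.symm)⟩,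
        (hTadj _ _).2 ⟨hvc, hv.2, fun e => hac (har.trans e.symm)⟩⟩
    by_cases hbr : b = H.root
    · exact ⟨a, c, hac, (hTadj _ _).2 ⟨hva, hv.2, har⟩,
        (hTadj _ _).2 ⟨hvc, hv.2, fun e => hbc (hbr.trans e.symm)⟩⟩
    · exact ⟨a, b, hab, (hTadj _ _).2 ⟨hva, hv.2, har⟩, (hTadj _ _).2 ⟨hvb, hv.2, hbr⟩⟩
  · exact .inl h

namespace IsSubstitution

/-- In each direction from a kept vertex `x`, there is an attachment with respect to every set that
contains the root and the coloured vertices. -/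
theorem exists_att_of_adj (hp : IsAdmissible IsSPNetwork p) (hs : IsSubstitution p G)
    (hH : IsApexTree p.1) (hr : p.1.root ∈ W) (hc : ∀ v, (p.1.col v).Nonempty → v ∈ W)
    (hx : x ∉ W) (hxy : p.1.graph.Adj x y) : ∃ q, Att G.graph.spanningCoe W x q ∧
      (y ≠ p.1.root → Linked G.graph.spanningCoe {p.1.root, x}ᶜ y q) ∧
      (y = p.1.root → q ≠ x ∧ q ∈ (p.2 ⟨s(x, y), hxy⟩).verts) := by
  have hxr : x ≠ p.1.root := fun e => hx (e ▸ hr)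
  by_cases hyr : y = p.1.root
  · obtain ⟨q, hq, hxq, -⟩ := (hs.linked_of_adj hp hxy).exists_att hx (hyr ▸ hr)
    exact ⟨q, hxq, fun h => absurd hyr h, fun _ => ⟨fun e => hx (e ▸ hxq.1), hq⟩⟩
  have hTadj : ∀ a b, (p.1.graph.spanningCoe.deleteIncidenceSet p.1.root).Adj a b →
      p.1.graph.Adj a b ∧ a ≠ p.1.root ∧ b ≠ p.1.root := fun a b =>
    (SimpleGraph.deleteIncidenceSet_adj ..).1
  obtain ⟨v, hv, hcv⟩ := hH.exists_coloured_of_adj hxy hxr hyr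
  have hpole : y ∈ ({p.1.root, x}ᶜ : Set V) := by
    simp [hyr, hxy.ne.symm]
  have hyv : Linked G.graph.spanningCoe {p.1.root, x}ᶜ y v := by
    refine hv.induct (P := fun v => Linked G.graph.spanningCoe {p.1.root, x}ᶜ y v)
      (.refl hpole) fun c d hc ih hcd hd => ih.trans ?_
    obtain ⟨hcd, hcr, hdr⟩ := hTadj _ _ hcd
    refine (hs.linked_of_adj hp hcd).mono_set ?_
    rintro w hw (rfl | rfl)
    · rcases Sym2.mem_iff.1 ((hp.verts_inter _).1 ⟨hw, p.1.root_mem⟩) with h | h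
      · exact hcr h.symm
      · exact hdr h.symm
    · rcases Sym2.mem_iff.1 ((hp.verts_inter _).1 ⟨hw, hxy.fst_mem⟩) with h | h
      · exact hc.right_mem h.symm
      · exact hd h.symm
  have hfirst : ∀ w ∈ (p.2 ⟨s(x, y), hxy⟩).verts, w ≠ x →
      Linked G.graph.spanningCoe {p.1.root, x}ᶜ y w := by
    intro w hw hwx
    obtain ⟨s, hs', hsx, hl⟩ := (hp.1 x y hxy).1.exists_linked_pole hw hwx
    rw [hs'.resolve_left hsx] at hl
    refine (hl.mono (fun a b hab => hs.adj_of_adj hab) ?_).symm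
    rintro c ⟨hc, hcx⟩ (rfl | rfl)
    · rcases Sym2.mem_iff.1 ((hp.verts_inter _).1 ⟨hc, p.1.root_mem⟩) with h | h
      · exact hxr h.symm
      · exact hyr h.symm
    · exact hcx rfl
  have hxv : Linked G.graph.spanningCoe (insert x (comp G.graph.spanningCoe {p.1.root, x}ᶜ y))
      x v := by
    refine ((hs.linked_of_adj hp hxy).mono_set fun w hw => ?_).trans
      (hyv.in_comp.mono_set (Set.subset_insert _ _))
    by_cases hwx : w = x
    · exact .inl hwx
    · exact .inr (hfirst w hw hwx)
  obtain ⟨q, hq, hxq, -⟩ := hxv.exists_att hx (hc v hcv)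
  exact ⟨q, hxq, fun _ => hq.resolve_left fun e => hx (e ▸ hxq.1), fun h => absurd h hyr⟩

/-- A kept vertex `x` outside `W` is uncoloured and not the root, so it has three neighbours in `H`.
Each of these directions contains an attachment of `x` with respect to `W`, and different directions
give different attachments, one too many. -/
theorem verts_subset (hp : IsAdmissible IsSPNetwork p) (hs : IsSubstitution p G)
    (hH : IsApexTree p.1) (hW : TwoAtt G.graph.spanningCoe W) (hr : G.root ∈ W)
    (hc : ∀ v, (G.col v).Nonempty → v ∈ W) : p.1.graph.verts ⊆ W := by
  intro x hxp
  rw [hs.root] at hr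
  rw [hs.col] at hc
  by_contra hx
  have hxr : x ≠ p.1.root := fun e => hx (e ▸ hr)
  have hcx : p.1.col x = ∅ := by
    by_contra h
    exact hx (hc x (Finset.nonempty_iff_ne_empty.2 h))
  -- Two directions within the tree that met away from `x` and the root would project to a cycle in
  -- the torso without the root.
  have hdist : ∀ y y' q, p.1.graph.Adj x y → p.1.graph.Adj x y' → y ≠ y' →
      y ≠ p.1.root → y' ≠ p.1.root → Linked G.graph.spanningCoe {p.1.root, x}ᶜ y q →
      ¬ Linked G.graph.spanningCoe {p.1.root, x}ᶜ y' q := by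
    intro y y' q hy hy' hne hyr hyr' h h'
    have hl := (h.trans h'.symm).torso (W := p.1.graph.verts) hy.snd_mem hy'.snd_mem
    refine isAcyclic_iff_not_linked.1 hH.acyclic x y y' ?_ ?_ hne
      (hl.transfer id hy.ne.symm fun u hu w hw huw _ => .of_adj ?_ ?_ ?_)
    · exact (SimpleGraph.deleteIncidenceSet_adj ..).2 ⟨hy, hxr, hyr⟩
    · exact (SimpleGraph.deleteIncidenceSet_adj ..).2 ⟨hy', hxr, hyr'⟩
    · exact fun e => hu.1 (.inr e)
    · exact (SimpleGraph.deleteIncidenceSet_adj ..).2 ⟨(hs.torso_adj_iff hp).1 huw,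
        fun e => hu.1 (.inl e), fun e => hw.1 (.inl e)⟩
    · exact fun e => hw.1 (.inr e)
  -- The network between `x` and the root cannot be left once its two poles are removed, so a
  -- direction within the tree never reaches it.
  have hroot : ∀ y q (h : p.1.graph.Adj x p.1.root), p.1.graph.Adj x y → q ≠ x →
      q ∈ (p.2 ⟨s(x, p.1.root), h⟩).verts →
      ¬ Linked G.graph.spanningCoe {p.1.root, x}ᶜ y q := by
    intro y q h hy hqx hq hl
    have hpole : ∀ w ∈ (p.2 ⟨s(x, p.1.root), h⟩).verts, w ∈ ({p.1.root, x}ᶜ : Set V) →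
        w ∉ p.1.graph.verts := by
      intro w hw hwx hwW
      rcases Sym2.mem_iff.1 ((hp.verts_inter _).1 ⟨hw, hwW⟩) with h | h
      · exact hwx (.inr h)
      · exact hwx (.inl h)
    refine hpole y ?_ hl.left_mem hy.snd_mem
    refine hl.symm.induct (P := fun w => w ∈ (p.2 ⟨s(x, p.1.root), h⟩).verts) hq ?_
    exact fun c d hc ih hcd _ => (hs.adj_of_notMem hp ih (hpole c ih hc.right_mem) hcd).snd_mem
  have main : ∀ y y' q q', p.1.graph.Adj x y → p.1.graph.Adj x y' → y ≠ y' →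
      ((y ≠ p.1.root → Linked G.graph.spanningCoe {p.1.root, x}ᶜ y q) ∧
        ∀ h, y = p.1.root → q ≠ x ∧ q ∈ (p.2 ⟨s(x, y), h⟩).verts) →
      ((y' ≠ p.1.root → Linked G.graph.spanningCoe {p.1.root, x}ᶜ y' q') ∧
        ∀ h, y' = p.1.root → q' ≠ x ∧ q' ∈ (p.2 ⟨s(x, y'), h⟩).verts) → q ≠ q' := by
    rintro y y' q q' hy hy' hne ⟨h1, h2⟩ ⟨h3, h4⟩ rfl
    by_cases hyr : y = p.1.root
    · subst hyr
      exact hroot y' q hy hy' (h2 hy rfl).1 (h2 hy rfl).2 (h3 hne.symm)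
    by_cases hyr' : y' = p.1.root
    · subst hyr'
      exact hroot y q hy' hy (h4 hy' rfl).1 (h4 hy' rfl).2 (h1 hyr)
    exact hdist y y' q hy hy' hne hyr hyr' (h1 hyr) (h3 hyr')
  obtain ⟨a, b, c, hab, hac, hbc, hxa, hxb, hxc⟩ := hH.degree x hxp hxr hcx
  obtain ⟨qa, ha, ha1, ha2⟩ := hs.exists_att_of_adj hp hH hr hc hx hxa
  obtain ⟨qb, hb, hb1, hb2⟩ := hs.exists_att_of_adj hp hH hr hc hx hxb
  obtain ⟨qc, hc', hc1, hc2⟩ := hs.exists_att_of_adj hp hH hr hc hx hxc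
  have h1 := main a b qa qb hxa hxb hab ⟨ha1, fun _ => ha2⟩ ⟨hb1, fun _ => hb2⟩
  have h2 := main a c qa qc hxa hxc hac ⟨ha1, fun _ => ha2⟩ ⟨hc1, fun _ => hc2⟩
  have h3 := main b c qb qc hxb hxc hbc ⟨hb1, fun _ => hb2⟩ ⟨hc1, fun _ => hc2⟩
  rcases hW.eq_or_eq ha hb h1 hc' with h | h
  · exact h2 h.symm
  · exact h3 h.symm

theorem verts_subset_verts (hp : IsAdmissible IsSPNetwork p) (hs : IsSubstitution p G)
    (hH : IsApexTree p.1) (hp' : IsAdmissible IsSPNetwork p') (hs' : IsSubstitution p' G) :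
    p.1.graph.verts ⊆ p'.1.graph.verts := by
  refine hs.verts_subset hp hH (hs'.twoAtt hp') (hs'.root ▸ p'.1.root_mem) fun v hv => ?_
  by_contra h
  rw [hs'.col, p'.1.col_eq_empty v h] at hv
  simp at hv

end IsSubstitution

theorem apexTreeFamilies_mono {𝒩 𝒩' : LGraph V → V → V → Prop} (h : ∀ D x y, 𝒩 D x y → 𝒩' D x y) :
    apexTreeFamilies k V 𝒩 ⊆ apexTreeFamilies k V 𝒩' := fun _ hp => ⟨hp.1, hp.2.mono h⟩

theorem apexTreeFamilies_unique (hp : p ∈ apexTreeFamilies k V IsSPNetwork)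
    (hp' : p' ∈ apexTreeFamilies k V IsSPNetwork) (hs : IsSubstitution p G)
    (hs' : IsSubstitution p' G) : p = p' :=
  hs.family_eq hp.2 hp'.2 hs' ((hs.verts_subset_verts hp.2 (mem_apexTrees_iff.1 hp.1) hp'.2 hs').antisymm
    (hs'.verts_subset_verts hp'.2 (mem_apexTrees_iff.1 hp'.1) hp.2 hs))

end Uniqueness

/-! ### Biconnected networks are single edges or parallel compositions -/

section Parallel

variable {V : Type*} {G : LGraph V} {g : SimpleGraph V} {N : Set V} {r s t v u x y z a b w : V}

theorem isSPNetwork_edgeGraph (h : s ≠ t) : IsSPNetwork (edgeGraph s t h) s t := by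
  have hadj : (edgeGraph s t h).Adj s t := by simp [edgeGraph]
  have hverts : (edgeGraph s t h).verts = {s, t} := rfl
  have hsup : ∀ a b, ((edgeGraph s t h).spanningCoe ⊔ SimpleGraph.edge s t).Adj a b →
      (a = s ∧ b = t) ∨ (a = t ∧ b = s) := by
    rintro a b (hab | hab)
    · exact (Sym2.eq_iff.1 (show s(s, t) = s(a, b) from hab)).imp
        (fun h => ⟨h.1.symm, h.2.symm⟩) fun h => ⟨h.2.symm, h.1.symm⟩
    · exact ((SimpleGraph.edge_adj ..).1 hab).1
  have hconn : Conn (edgeGraph s t h).spanningCoe (edgeGraph s t h).verts := by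
    refine .of_root (a := s) (.inl rfl) fun b hb => ?_
    rcases hb with rfl | rfl
    · exact .refl (.inl rfl)
    · exact .of_adj (.inl rfl) hadj (.inr rfl)
  refine isSPNetwork_iff.2 ⟨hverts ▸ Set.toFinite _, .inl rfl, .inr rfl, h, hconn,
    ⟨⟨s, .inl rfl, t, .inr rfl, h⟩, ?_, ?_, ?_⟩, ?_⟩
  · intro a b hab
    rcases hsup a b hab with ⟨rfl, -⟩ | ⟨rfl, -⟩
    · exact .inl rfl
    · exact .inr rfl
  · exact fun a ha b hb => (hconn.2 a ha b hb).mono_graph le_sup_left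
  · intro z a ha b hb haz hbz
    rcases ha with rfl | rfl <;> rcases hb with rfl | rfl
    · exact .refl ⟨.inl rfl, haz⟩
    · exact .of_adj ⟨.inl rfl, haz⟩ (sup_edge_adj h) ⟨.inr rfl, hbz⟩
    · exact .of_adj ⟨.inr rfl, haz⟩ (sup_edge_adj h).symm ⟨.inl rfl, hbz⟩
    · exact .refl ⟨.inr rfl, haz⟩
  · refine not_hasKFour_of_isAcyclic (r := s) (g' := ⊥) SimpleGraph.isAcyclic_bot fun a b ha hb hab => ?_
    rcases hsup a b hab with ⟨rfl, -⟩ | ⟨-, rfl⟩ <;> contradiction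

theorem IsParallelOrEdge.isSPNetwork (h : IsParallelOrEdge G s t) : IsSPNetwork G s t := by
  rcases h with h | ⟨h, rfl⟩
  · exact h.1
  · exact isSPNetwork_edgeGraph h

/-- In a walk that avoids `z`, each use of the edge `st` is replaced by a walk of `g` from `s` to
`t` that also avoids `z`. -/
theorem BiConn.of_sup_edge (hB : BiConn (g ⊔ SimpleGraph.edge s t) N)
    (h : ∀ z, z ≠ s → z ≠ t → Linked g {z}ᶜ s t) (hst : Linked g Set.univ s t) : BiConn g N := by
  refine .of_linked hB.nontrivial (fun a b hab => hB.supp a b (.inl hab)) ?_ ?_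
  · intro z a ha b hb haz hbz
    refine (hB.linked ha hb haz hbz).transfer id haz fun c hc d hd hcd _ => ?_
    rcases hcd with hcd | hcd
    · exact .of_adj hc hcd hd
    · rcases ((SimpleGraph.edge_adj ..).1 hcd).1 with ⟨rfl, rfl⟩ | ⟨rfl, rfl⟩
      · exact h z (Ne.symm hc) (Ne.symm hd)
      · exact (h z (Ne.symm hd) (Ne.symm hc)).symm
  · intro a ha b hb
    refine (hB.conn a ha b hb).transfer id trivial fun c _ d _ hcd _ => ?_
    rcases hcd with hcd | hcd
    · exact .of_adj trivial hcd trivial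
    · rcases ((SimpleGraph.edge_adj ..).1 hcd).1 with ⟨rfl, rfl⟩ | ⟨rfl, rfl⟩
      · exact hst
      · exact hst.symm

theorem IsParallelOrEdge.biConn (h : IsParallelOrEdge G s t) : BiConn G.spanningCoe G.verts := by
  obtain ⟨-, hs, ht, hst, hc, hB, -⟩ := isSPNetwork_iff.1 h.isSPNetwork
  refine hB.of_sup_edge (fun z hzs hzt => ?_) ((hc.2 s hs t ht).mono_set (Set.subset_univ _))
  rcases h with ⟨-, P, ⟨A, hA, B, hB', hAB⟩, hP, hdisj, rfl⟩ | ⟨h, rfl⟩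
  -- Two parallel parts share only their poles, so `z` is missing from one of them, which still
  -- joins `s` to `t`.
  · obtain ⟨S, hS, hz⟩ : ∃ S ∈ P, z ∉ S.verts := by
      by_contra! hcon
      have : z ∈ A.verts ∩ B.verts := ⟨hcon A hA, hcon B hB'⟩
      rw [hdisj hA hB' hAB] at this
      rcases this with h | h
      · exact hzs h
      · exact hzt h
    have hS' : IsSPNetwork S s t := by
      rcases hP S hS with h | ⟨h, rfl⟩
      · exact h.1
      · exact isSPNetwork_edgeGraph h
    obtain ⟨-, hs, ht, -, hc, -⟩ := isSPNetwork_iff.1 hS'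
    refine (hc.2 s hs t ht).mono (fun a b hab => ?_) fun a ha => ?_
    · exact SimpleGraph.Subgraph.sSup_adj.2 ⟨S, hS, hab⟩
    · rintro rfl
      exact hz ha
  · exact .of_adj (Ne.symm hzs) (show (edgeGraph s t h).Adj s t by simp [edgeGraph]) (Ne.symm hzt)

/-- The component of `u` in the graph without the vertices `r` and `v`, together with `r` and `v`. -/
def bridgeGraph (G : LGraph V) (r v u : V) : LGraph V where
  verts := comp G.spanningCoe {r, v}ᶜ u ∪ {r, v}
  Adj a b := G.Adj a b ∧ (a ∈ comp G.spanningCoe {r, v}ᶜ u ∨ b ∈ comp G.spanningCoe {r, v}ᶜ u)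
  adj_sub h := h.1.ne
  edge_vert := by
    rintro a b ⟨hab, h | h⟩
    · exact .inl h
    · by_cases ha : a ∈ ({r, v} : Set V)
      · exact .inr ha
      · exact .inl (h.tail hab.symm ha)
  symm := ⟨fun _ _ h => ⟨h.1.symm, h.2.symm⟩⟩

theorem bridgeGraph_eq (h : u ∈ comp G.spanningCoe {r, v}ᶜ w) :
    bridgeGraph G r v u = bridgeGraph G r v w := by
  have : comp G.spanningCoe {r, v}ᶜ u = comp G.spanningCoe {r, v}ᶜ w :=
    Set.ext fun a => ⟨fun ha => h.trans ha, fun ha => (Linked.symm h).trans ha⟩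
  unfold bridgeGraph
  simp only [this]

/-- A set of vertices that is cut off by `z` and contains the neighbours of `r` in a component. -/
structure IsCutSide (g : SimpleGraph V) (r v : V) (C A : Set V) (z : V) : Prop where
  mem : z ∈ C
  subset : A ⊆ C
  notMem : z ∉ A
  left : ∀ w ∈ C, g.Adj r w → w ∈ A ∨ w = z
  right : ∀ w ∈ A, ¬ g.Adj w v
  closed : ∀ a ∈ A, ∀ b ∈ C, g.Adj a b → b ∈ A ∨ b = z

theorem BiConn.att_pair (hB : BiConn g N) (hr : r ∈ N) (hv : v ∈ N) (hrv : r ≠ v) (hu : u ∈ N)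
    (hur : u ∉ ({r, v} : Set V)) : Att g {r, v} u r ∧ Att g {r, v} u v := by
  obtain ⟨x, y, hxy, hx, hy⟩ := hB.exists_two_att hu hur hr hv (.inl rfl) (.inr rfl) hrv
  rcases hx.1 with rfl | rfl <;> rcases hy.1 with rfl | rfl
  · exact absurd rfl hxy
  · exact ⟨hx, hy⟩
  · exact ⟨hy, hx⟩
  · exact absurd rfl hxy

/-- With `W = {r, v}`, each component is a piece at the root, so `exists_cut_of_root_piece` yields a
cut vertex `z`. The set `A` collects the vertices that reach a neighbour of `r` without `z`. -/
theorem exists_isCutSide (hN : N.Finite) (hB : BiConn g N) (hr : r ∈ N) (hv : v ∈ N) (hrv : r ≠ v)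
    (hK : ¬ HasKFour (g ⊔ SimpleGraph.edge r v)) (hu : u ∈ N) (hur : u ∉ ({r, v} : Set V)) :
    ∃ A z, IsCutSide g r v (comp g {r, v}ᶜ u) A z := by
  obtain ⟨h1, h2⟩ := hB.att_pair hr hv hrv hu hur
  obtain ⟨z, hz, hcut⟩ := exists_cut_of_root_piece (W := {r, v}) hN hB (.inl rfl) (.inr rfl) hv
    hrv.symm hK hu hrv.symm h2 h1 fun a ha => ha.1.symm
  set C := comp g {r, v}ᶜ u with hC
  refine ⟨{a | ∃ w, Linked g (C \ {z}) a w ∧ g.Adj w r}, z, hz, ?_, ?_, ?_, ?_, ?_⟩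
  · exact fun a ⟨w, hw, _⟩ => hw.left_mem.1
  · rintro ⟨w, hw, -⟩
    exact hw.left_mem.2 rfl
  · intro w hw hrw
    by_cases hwz : w = z
    · exact .inr hwz
    · exact .inl ⟨w, .refl ⟨hw, hwz⟩, hrw.symm⟩
  · exact fun a ⟨w, hw, hwr⟩ hav => hcut a w hw hav hwr
  · rintro a ⟨w, hw, hwr⟩ b hb hab
    by_cases hbz : b = z
    · exact .inr hbz
    · have hbC : b ∈ C \ {z} := ⟨hb, hbz⟩
      exact .inl ⟨w, (Linked.of_adj hbC hab.symm hw.left_mem).trans hw, hwr⟩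

theorem mem_or_of_adj_comp {S : Set V} (ha : a ∈ comp g Sᶜ u) (hab : g.Adj a b) :
    b ∈ comp g Sᶜ u ∨ b ∈ S := by
  by_cases hb : b ∈ S
  · exact .inr hb
  · exact .inl (ha.tail hab hb)

/-- The component is split at `z` into the part towards `r` and the part towards `v`. The opposite
pole is a vertex outside each part, so `not_hasKFour_of_outside` applies to both. -/
theorem isSeriesNetwork_bridgeGraph (hN : G.verts.Finite) (hB : BiConn G.spanningCoe G.verts)
    (hr : r ∈ G.verts) (hv : v ∈ G.verts) (hrv : r ≠ v)
    (hK : ¬ HasKFour (G.spanningCoe ⊔ SimpleGraph.edge r v)) (hu : u ∈ G.verts)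
    (hur : u ∉ ({r, v} : Set V)) : IsSeriesNetwork (bridgeGraph G r v u) r v := by
  set C := comp G.spanningCoe {r, v}ᶜ u with hC
  have hCN : C ⊆ G.verts := fun a ha => hB.mem_of_linked hu ha
  have hCr : r ∉ C := fun h => comp_subset h (.inl rfl)
  have hCv : v ∉ C := fun h => comp_subset h (.inr rfl)
  have hCadj : ∀ a ∈ C, ∀ b, G.Adj a b → b ∈ C ∨ b = r ∨ b = v := fun a ha b hab =>
    mem_or_of_adj_comp (g := G.spanningCoe) ha hab
  obtain ⟨⟨-, wr, hwr, hwr'⟩, ⟨-, wv, hwv, hwv'⟩⟩ := hB.att_pair hr hv hrv hu hur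
  obtain ⟨A, z, hA⟩ := exists_isCutSide hN hB hr hv hrv hK hu hur
  have hzr : z ≠ r := fun e => hCr (e ▸ hA.mem)
  have hzv : z ≠ v := fun e => hCv (e ▸ hA.mem)
  have hAr : r ∉ A := fun h => hCr (hA.subset h)
  have hAv : v ∉ A := fun h => hCv (hA.subset h)
  have hK' : ¬ HasKFour G.spanningCoe := fun h => hK (h.mono le_sup_left)
  have hind : ∀ X, (G.induce X).spanningCoe ≤ G.spanningCoe := fun X a b hab => hab.2.2
  have hverts : (bridgeGraph G r v u).verts = C ∪ {r, v} := rfl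
  have hcl1 : ∀ a ∈ (G.induce (A ∪ {r, z})).verts, a ≠ r → a ≠ z → ∀ b, G.spanningCoe.Adj a b →
      (G.induce (A ∪ {r, z})).Adj a b := by
    intro a ha har haz b hab
    have haA : a ∈ A := ha.resolve_right (by simp [har, haz])
    refine ⟨ha, ?_, hab⟩
    rcases hCadj a (hA.subset haA) b hab with h | rfl | rfl
    · exact (hA.closed a haA b h hab).imp_right fun h => .inr h
    · exact .inr (.inl rfl)
    · exact absurd hab (hA.right a haA)
  have hcl2 : ∀ a ∈ (G.induce (C \ A ∪ {v})).verts, a ≠ z → a ≠ v → ∀ b, G.spanningCoe.Adj a b →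
      (G.induce (C \ A ∪ {v})).Adj a b := by
    intro a ha haz hav b hab
    have haA : a ∈ C \ A := ha.resolve_right hav
    refine ⟨ha, ?_, hab⟩
    rcases hCadj a haA.1 b hab with h | rfl | rfl
    · refine .inl ⟨h, fun hb => ?_⟩
      rcases hA.closed b hb a haA.1 hab.symm with h | h
      · exact haA.2 h
      · exact haz h
    · rcases hA.left a haA.1 hab.symm with h | h
      · exact absurd h haA.2
      · exact absurd h haz
    · exact .inr rfl
  have hv1 : v ∉ (G.induce (A ∪ {r, z})).verts := by
    rintro (h | h | h)
    · exact hAv h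
    · exact hrv h.symm
    · exact hzv h.symm
  have hr2 : r ∉ (G.induce (C \ A ∪ {v})).verts := by
    rintro (h | h)
    · exact hCr h.1
    · exact hrv h
  have hz1 : z ∈ (G.induce (A ∪ {r, z})).verts := .inr (.inr rfl)
  have hz2 : z ∈ (G.induce (C \ A ∪ {v})).verts := .inl ⟨hA.mem, hA.notMem⟩
  refine ⟨?_, z, G.induce (A ∪ {r, z}), G.induce (C \ A ∪ {v}), ?_, ?_, ?_, ?_⟩
  · refine isSPNetwork_of_closed hN hB hr hv hrv (.inr (.inl rfl)) (.inr (.inr rfl)) ?_ ?_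
      (.inr ⟨u, .inl (.refl hur), fun e => hur (.inl e), fun e => hur (.inr e)⟩)
      fun h => hK (h.mono (sup_le_sup_right (fun a b hab => hab.1) _))
    · rw [hverts]
      exact Set.union_subset hCN (Set.insert_subset hr (Set.singleton_subset_iff.2 hv))
    · intro a ha har hav b hab
      exact ⟨hab, .inl (ha.resolve_right (by simp [har, hav]))⟩
  · refine isSPNetwork_of_closed hN hB hr (hCN hA.mem) hzr.symm (.inr (.inl rfl)) hz1 ?_ hcl1 ?_
      (not_hasKFour_of_outside hB hr (hCN hA.mem) hzr.symm (.inr (.inl rfl)) hz1 (hind _) hcl1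
        ⟨v, hv, hv1⟩ hK')
    · exact Set.union_subset (hA.subset.trans hCN)
        (Set.insert_subset hr (Set.singleton_subset_iff.2 (hCN hA.mem)))
    · rcases hA.left wr hwr hwr'.symm with h | rfl
      · exact .inr ⟨wr, .inl h, fun e => hAr (e ▸ h), fun e => hA.notMem (e ▸ h)⟩
      · exact .inl ⟨.inr (.inl rfl), hz1, hwr'.symm⟩
  · refine isSPNetwork_of_closed hN hB (hCN hA.mem) hv hzv hz2 (.inr rfl) ?_ hcl2 ?_
      (not_hasKFour_of_outside hB (hCN hA.mem) hv hzv hz2 (.inr rfl) (hind _) hcl2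
        ⟨r, hr, hr2⟩ hK')
    · exact Set.union_subset (Set.sdiff_subset.trans hCN) (Set.singleton_subset_iff.2 hv)
    · by_cases hwz : wv = z
      · subst hwz
        exact .inl ⟨hz2, .inr rfl, hwv'⟩
      · exact .inr ⟨wv, .inl ⟨hwv, fun h => hA.right wv h hwv'⟩, hwz, fun e => hCv (e ▸ hwv)⟩
  · ext a
    constructor
    · rintro ⟨h1 | rfl | h1, h2⟩
      · rcases h2 with h2 | rfl
        · exact absurd h1 h2.2
        · exact absurd h1 hAv
      · exact absurd h2 hr2
      · exact h1
    · rintro rfl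
      exact ⟨hz1, hz2⟩
  · refine SimpleGraph.Subgraph.ext ?_ ?_
    · rw [hverts, SimpleGraph.Subgraph.verts_sup]
      ext a
      constructor
      · rintro (h | rfl | rfl)
        · by_cases haA : a ∈ A
          · exact .inl (.inl haA)
          · exact .inr (.inl ⟨h, haA⟩)
        · exact .inl (.inr (.inl rfl))
        · exact .inr (.inr rfl)
      · rintro ((h | rfl | rfl) | (h | rfl))
        · exact .inl (hA.subset h)
        · exact .inr (.inl rfl)
        · exact .inl hA.mem
        · exact .inl h.1
        · exact .inr (.inr rfl)
    · have key : ∀ a b, G.Adj a b → a ∈ C →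
          (G.induce (A ∪ {r, z}) ⊔ G.induce (C \ A ∪ {v})).Adj a b := by
        intro a b hab ha
        rw [SimpleGraph.Subgraph.sup_adj]
        by_cases haz : a = z
        · subst haz
          rcases hCadj a ha b hab with h | rfl | rfl
          · by_cases hb : b ∈ A
            · exact .inl ⟨hz1, .inl hb, hab⟩
            · exact .inr ⟨hz2, .inl ⟨h, hb⟩, hab⟩
          · exact .inl ⟨hz1, .inr (.inl rfl), hab⟩
          · exact .inr ⟨hz2, .inr rfl, hab⟩
        · by_cases haA : a ∈ A
          · exact .inl (hcl1 a (.inl haA) (fun e => hAr (e ▸ haA)) haz b hab)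
          · exact .inr (hcl2 a (.inl ⟨ha, haA⟩) haz (fun e => hCv (e ▸ ha)) b hab)
      ext a b
      constructor
      · rintro ⟨hab, h | h⟩
        · exact key a b hab h
        · exact (key b a hab.symm h).symm
      · rw [SimpleGraph.Subgraph.sup_adj]
        rintro (⟨ha, hb, hab⟩ | ⟨ha, hb, hab⟩)
        · refine ⟨hab, ?_⟩
          rcases ha with ha | rfl | rfl
          · exact .inl (hA.subset ha)
          · rcases hb with hb | rfl | rfl
            · exact .inr (hA.subset hb)
            · exact absurd rfl hab.ne
            · exact .inr hA.mem
          · exact .inl hA.mem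
        · refine ⟨hab, ?_⟩
          rcases ha with ha | rfl
          · exact .inl ha.1
          · rcases hb with hb | rfl
            · exact .inr hb.1
            · exact absurd rfl hab.ne

/-- The parallel parts are the components of the graph without `r` and `v`, each with these two
vertices added, and the edge `rv` if it is present. -/
theorem isParallelOrEdge_of_biConn (hN : G.verts.Finite) (hB : BiConn G.spanningCoe G.verts)
    (hr : r ∈ G.verts) (hv : v ∈ G.verts) (hrv : r ≠ v)
    (hK : ¬ HasKFour (G.spanningCoe ⊔ SimpleGraph.edge r v)) : IsParallelOrEdge G r v := by
  by_cases hne : ∃ u ∈ G.verts, u ∉ ({r, v} : Set V)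
  swap
  · push Not at hne
    right
    obtain ⟨c, hc, hrc, -⟩ := (hB.conn r hr v hv).exists_adj hrv
    have hadj : G.Adj r v := by
      rcases hne c hc with rfl | rfl
      · exact absurd rfl hrc.ne
      · exact hrc
    refine ⟨hrv, le_antisymm (And.intro hne fun a b hab => ?_)
      (SimpleGraph.subgraphOfAdj_le_of_adj G hadj)⟩
    have h1 := hne a hab.fst_mem
    have h2 := hne b hab.snd_mem
    have h3 := hab.ne
    simp only [Set.mem_insert_iff, Set.mem_singleton_iff] at h1 h2
    simp only [edgeGraph, SimpleGraph.subgraphOfAdj_adj, Sym2.eq_iff]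
    grind
  left
  obtain ⟨u, hu, hur⟩ := hne
  have hpoles : ∀ w, r ∈ (bridgeGraph G r v w).verts ∧ v ∈ (bridgeGraph G r v w).verts := fun w =>
    ⟨.inr (.inl rfl), .inr (.inr rfl)⟩
  have hmem : ∀ w ∉ ({r, v} : Set V), w ∈ (bridgeGraph G r v w).verts := fun w hw =>
    .inl (.refl hw)
  refine ⟨isSPNetwork_iff.2 ⟨hN, hr, hv, hrv, ⟨⟨r, hr⟩, hB.conn⟩, ⟨hB.nontrivial, ?_, ?_, ?_⟩, hK⟩,
    {S | (∃ w ∈ G.verts, w ∉ ({r, v} : Set V) ∧ S = bridgeGraph G r v w) ∨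
      (G.Adj r v ∧ S = edgeGraph r v hrv)}, ?_, ?_, ?_, ?_⟩
  · rintro a b (hab | hab)
    · exact hB.supp a b hab
    · rcases ((SimpleGraph.edge_adj ..).1 hab).1 with ⟨rfl, -⟩ | ⟨rfl, -⟩ <;> assumption
  · exact fun a ha b hb => (hB.conn a ha b hb).mono_graph le_sup_left
  · exact fun z a ha b hb haz hbz => (hB.cut z a ha b hb haz hbz).mono_graph le_sup_left
  · have hS : bridgeGraph G r v u ∈ {S | (∃ w ∈ G.verts, w ∉ ({r, v} : Set V) ∧
        S = bridgeGraph G r v w) ∨ (G.Adj r v ∧ S = edgeGraph r v hrv)} := .inl ⟨u, hu, hur, rfl⟩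
    by_contra hsub
    rw [Set.not_nontrivial_iff] at hsub
    -- If there were only one part, its cut vertex `z` would separate `r` from `v` in the whole
    -- graph.
    obtain ⟨A, z, hA⟩ := exists_isCutSide hN hB hr hv hrv hK hu hur
    have hzr : z ≠ r := fun e => comp_subset hA.mem (.inl e)
    have hzv : z ≠ v := fun e => comp_subset hA.mem (.inr e)
    have hall : ∀ w ∈ G.verts, w ∉ ({r, v} : Set V) → w ∈ comp G.spanningCoe {r, v}ᶜ u := by
      intro w hw hwr
      have : w ∈ (bridgeGraph G r v u).verts := hsub hS (.inl ⟨w, hw, hwr, rfl⟩) ▸ hmem w hwr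
      exact this.resolve_right hwr
    have hrv' : ¬ G.Adj r v := by
      intro h
      have : u ∈ (edgeGraph r v hrv).verts := hsub hS (.inr ⟨h, rfl⟩) ▸ hmem u hur
      exact hur this
    have hclosed : v ∈ insert r A := by
      refine (hB.linked hr hv hzr.symm hzv.symm).mem_of_closed (.inl rfl) fun a ha b hb hab => ?_
      have hb' : b ∈ comp G.spanningCoe {r, v}ᶜ u ∨ b ∈ ({r, v} : Set V) := by
        by_cases h : b ∈ ({r, v} : Set V)
        · exact .inr h
        · exact .inl (hall b (hB.supp _ _ hab.symm) h)
      rcases hb' with h | rfl | rfl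
      · rcases ha with rfl | ha
        · exact .inr ((hA.left b h hab).resolve_right (by assumption))
        · exact .inr ((hA.closed a ha b h hab).resolve_right (by assumption))
      · exact .inl rfl
      · rcases ha with rfl | ha
        · exact absurd hab hrv'
        · exact absurd hab (hA.right a ha)
    rcases hclosed with h | h
    · exact hrv h.symm
    · exact comp_subset (hA.subset h) (.inr rfl)
  · rintro S (⟨w, hw, hwr, rfl⟩ | ⟨h, rfl⟩)
    · exact .inl (isSeriesNetwork_bridgeGraph hN hB hr hv hrv hK hw hwr)
    · exact .inr ⟨hrv, rfl⟩
  · have hedge : ∀ w, (edgeGraph r v hrv).verts ∩ (bridgeGraph G r v w).verts = {r, v} := fun w =>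
      Set.inter_eq_left.2 fun a ha => .inr ha
    rintro S (⟨w, hw, hwr, rfl⟩ | ⟨h, rfl⟩) S' (⟨w', hw', hwr', rfl⟩ | ⟨h', rfl⟩) hne
    · refine Set.Subset.antisymm (fun a ⟨ha, ha'⟩ => ?_) fun a ha => ⟨.inr ha, .inr ha⟩
      rcases ha with ha | ha
      · rcases ha' with ha' | ha'
        · exact absurd ((bridgeGraph_eq ha).symm.trans (bridgeGraph_eq ha')) hne
        · exact ha'
      · exact ha
    · exact (Set.inter_comm _ _).trans (hedge w)
    · exact hedge w'
    · exact absurd rfl hne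
  · refine SimpleGraph.Subgraph.ext ?_ ?_
    · rw [SimpleGraph.Subgraph.verts_sSup]
      refine Set.Subset.antisymm (fun a ha => ?_) (Set.iUnion₂_subset ?_)
      · by_cases har : a ∈ ({r, v} : Set V)
        · exact Set.mem_iUnion₂.2 ⟨_, .inl ⟨u, hu, hur, rfl⟩, .inr har⟩
        · exact Set.mem_iUnion₂.2 ⟨_, .inl ⟨a, ha, har, rfl⟩, hmem a har⟩
      · have hp : ({r, v} : Set V) ⊆ G.verts := Set.insert_subset hr (Set.singleton_subset_iff.2 hv)
        rintro S (⟨w, hw, -, rfl⟩ | ⟨-, rfl⟩)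
        · exact Set.union_subset (fun a ha => hB.mem_of_linked hw ha) hp
        · exact hp
    · ext a b
      rw [SimpleGraph.Subgraph.sSup_adj]
      constructor
      · intro hab
        by_cases ha : a ∈ ({r, v} : Set V)
        · by_cases hb : b ∈ ({r, v} : Set V)
          · rcases ha with rfl | rfl <;> rcases hb with rfl | rfl
            · exact absurd rfl hab.ne
            · exact ⟨_, .inr ⟨hab, rfl⟩, by simp [edgeGraph]⟩
            · exact ⟨_, .inr ⟨hab.symm, rfl⟩, by simp [edgeGraph]⟩
            · exact absurd rfl hab.ne
          · exact ⟨_, .inl ⟨b, hab.snd_mem, hb, rfl⟩, hab, .inr (.refl hb)⟩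
        · exact ⟨_, .inl ⟨a, hab.fst_mem, ha, rfl⟩, hab, .inl (.refl ha)⟩
      · rintro ⟨S, ⟨w, -, -, rfl⟩ | ⟨h, rfl⟩, hab⟩
        · exact hab.1
        · exact (SimpleGraph.subgraphOfAdj_le_of_adj G h).2 hab

end Parallel

/-! ### One colour: `H` is a single edge -/

section OneColour

variable {V : Type*} {G : ColGraph 1 V} {p : EdgeFamily 1 V} {v : V}

theorem exists_isVertexTimes_of_mem_blocks (hG : G ∈ blocks 1 V) :
    ∃ v, IsVertexTimes IsParallelOrEdge G v := by
  obtain ⟨hB, hcr, -, f, hf⟩ := mem_blocks_iff.1 hG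
  have hcol : ∀ u c, c ∈ G.col u ↔ u = f 0 := fun u c => by
    rw [Subsingleton.elim c 0]
    exact (hf 0).1 u
  have hfr : G.root ≠ f 0 := fun e => by
    have := (hcol _ 0).2 e
    simp [hcr] at this
  have hfN : f 0 ∈ G.graph.verts := by
    by_contra h
    have := (hcol _ 0).2 rfl
    simp [G.col_eq_empty _ h] at this
  refine ⟨f 0, isParallelOrEdge_of_biConn G.finite hB G.root_mem hfN hfr (hf 0).2, ?_, fun u hu => ?_⟩
  · ext c
    simp [hcol, Subsingleton.elim c 0]
  · exact Finset.eq_empty_of_forall_notMem fun c hc => hu ((hcol u c).1 hc)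

theorem IsVertexTimes.mem_blocks (h : IsVertexTimes IsParallelOrEdge G v) : G ∈ blocks 1 V := by
  obtain ⟨hD, hv, hcol⟩ := h
  obtain ⟨-, -, -, hrv, -, -, hK⟩ := isSPNetwork_iff.1 hD.isSPNetwork
  refine mem_blocks_iff.2 ⟨hD.biConn, hcol _ hrv, fun u => ?_, fun _ => v, fun c => ⟨fun u => ?_, hK⟩⟩
  · by_cases hu : u = v
    · simp [hu, hv]
    · simp [hcol u hu]
  · by_cases hu : u = v
    · simp [hu, hv, Subsingleton.elim c 0]
    · simp [hcol u hu, hu]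

theorem IsVertexTimes.unique {𝒩 𝒩' : LGraph V → V → V → Prop} {v w : V}
    (h : IsVertexTimes 𝒩 G v) (h' : IsVertexTimes 𝒩' G w) : v = w := by
  by_contra hvw
  have := h'.2.2 v hvw
  simp [h.2.1] at this

/-- `H` is the edge from the root to `v`, and the whole of `G` is its network. -/
theorem IsVertexTimes.exists_family (h : IsVertexTimes IsParallelOrEdge G v) :
    ∃ p ∈ apexTreeFamilies 1 V IsParallelOrEdge, IsSubstitution p G := by
  obtain ⟨hD, hv, hcol⟩ := h
  obtain ⟨-, hr, hvG, hrv, -, -, -⟩ := isSPNetwork_iff.1 hD.isSPNetwork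
  have hadj : ∀ a b, (edgeGraph G.root v hrv).Adj a b ↔
      (a = G.root ∧ b = v) ∨ (a = v ∧ b = G.root) := by
    intro a b
    simp only [edgeGraph, SimpleGraph.subgraphOfAdj_adj, Sym2.eq_iff]
    grind
  let H : ColGraph 1 V :=
    { graph := edgeGraph G.root v hrv
      root := G.root
      col := G.col
      finite := Set.toFinite {G.root, v}
      root_mem := .inl rfl
      col_eq_empty := fun u hu => hcol u fun e => hu (.inr e) }
  have hH : ∀ e ∈ H.graph.edgeSet, e = s(G.root, v) := by
    intro e he
    induction e with | _ a b
    rcases (hadj a b).1 he with ⟨rfl, rfl⟩ | ⟨rfl, rfl⟩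
    · rfl
    · exact Sym2.eq_swap
  have hpair : ({G.root, v} : Set V) ⊆ G.graph.verts :=
    Set.insert_subset hr (Set.singleton_subset_iff.2 hvG)
  refine ⟨⟨H, fun _ => G.graph⟩, ⟨mem_apexTrees_iff.2 ⟨hcol _ hrv, ?_, ?_,
    ⟨fun _ => v, fun i => ⟨.inr rfl, by rw [Subsingleton.elim i 0]; exact hv⟩, fun u hu => ⟨0, ?_⟩⟩,
    ?_, ?_⟩, ?_, ?_⟩, ?_, ?_, rfl, rfl⟩
  · have : H.graph.spanningCoe.deleteIncidenceSet H.root = ⊥ := by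
      rw [eq_bot_iff]
      intro a b hab
      rw [SimpleGraph.deleteIncidenceSet_adj] at hab
      rcases (hadj a b).1 hab.1 with ⟨h, -⟩ | ⟨-, h⟩
      · exact absurd h hab.2.1
      · exact absurd h hab.2.2
    rw [this]
    exact SimpleGraph.isAcyclic_bot
  · have : H.graph.verts \ {H.root} = {v} := by
      ext a
      constructor
      · rintro ⟨h | h, ha⟩
        · exact absurd h ha
        · exact h
      · rintro rfl
        exact ⟨.inr rfl, hrv.symm⟩
    rw [this]
    exact .singleton
  · by_contra h
    have : G.col u = ∅ := hcol u h
    rw [show H.col u = G.col u from rfl, this] at hu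
    simp at hu
  · rintro u (h | rfl) hur
    · exact absurd h hur
    · exact .inr ((hadj _ _).2 (.inl ⟨rfl, rfl⟩))
  · rintro u (h | rfl) hur hu
    · exact absurd h hur
    · rw [show H.col u = G.col u from rfl, hv] at hu
      simp at hu
  · intro x y hxy
    rcases (hadj x y).1 hxy with ⟨rfl, rfl⟩ | ⟨rfl, rfl⟩
    · exact ⟨hD, Set.inter_eq_right.2 hpair⟩
    · exact ⟨hD.symm, (Set.inter_eq_right.2 hpair).trans (Set.pair_comm _ _)⟩
  · rintro ⟨e, he⟩ ⟨e', he'⟩ hne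
    exact absurd (Subtype.ext ((hH e he).trans (hH e' he').symm)) hne
  · refine Set.Subset.antisymm (fun a ha => ?_) (Set.union_subset hpair (Set.iUnion_subset fun _ => subset_rfl))
    exact .inr (Set.mem_iUnion.2 ⟨⟨s(G.root, v), (hadj _ _).2 (.inl ⟨rfl, rfl⟩)⟩, ha⟩)
  · exact fun a b => ⟨fun hab => ⟨⟨s(G.root, v), (hadj _ _).2 (.inl ⟨rfl, rfl⟩)⟩, hab⟩, fun ⟨_, h⟩ => h⟩

theorem exists_isVertexTimes_of_isSubstitution (hp : p ∈ apexTreeFamilies 1 V IsParallelOrEdge)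
    (hs : IsSubstitution p G) : ∃ v, IsVertexTimes IsParallelOrEdge G v := by
  obtain ⟨hH, hp⟩ := hp
  rw [mem_apexTrees_iff] at hH
  obtain ⟨f, hf, hf'⟩ := hH.coloured
  have hcv : ∀ u, (p.1.col u).Nonempty → u = f 0 := fun u hu => by
    obtain ⟨i, hi⟩ := hf' u hu
    rw [hi, Subsingleton.elim i 0]
  have hfr : p.1.root ≠ f 0 := fun e => by
    have := (hf 0).2
    rw [← e, hH.root_uncoloured] at this
    simp at this
  -- Every branch of the tree at `x` contains a coloured vertex, and there is only one coloured
  -- vertex, so there is at most one branch. An uncoloured vertex other than the root would have two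
  -- branches, so `H` has just two vertices.
  have hbranch : ∀ x a b, p.1.graph.Adj x a → p.1.graph.Adj x b → x ≠ p.1.root → a ≠ p.1.root →
      b ≠ p.1.root → a = b := by
    intro x a b ha hb hxr har hbr
    by_contra hab
    obtain ⟨v, hv, hv'⟩ := hH.exists_coloured_of_adj ha hxr har
    obtain ⟨w, hw, hw'⟩ := hH.exists_coloured_of_adj hb hxr hbr
    rw [hcv v hv'] at hv
    rw [hcv w hw'] at hw
    exact isAcyclic_iff_not_linked.1 hH.acyclic x a b
      ((SimpleGraph.deleteIncidenceSet_adj ..).2 ⟨ha, hxr, har⟩)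
      ((SimpleGraph.deleteIncidenceSet_adj ..).2 ⟨hb, hxr, hbr⟩) hab (hv.trans hw.symm)
  have hverts : ∀ u ∈ p.1.graph.verts, u = p.1.root ∨ u = f 0 := by
    intro u hu
    by_contra! h
    obtain ⟨a, b, c, hab, hac, hbc, ha, hb, hc⟩ := hH.degree u hu h.1
      (Finset.not_nonempty_iff_eq_empty.1 fun hne => h.2 (hcv u hne))
    by_cases har : a = p.1.root
    · exact hbc (hbranch u b c hb hc h.1 (fun e => hab (har.trans e.symm))
        fun e => hac (har.trans e.symm))
    by_cases hbr : b = p.1.root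
    · exact hac (hbranch u a c ha hc h.1 har fun e => hbc (hbr.trans e.symm))
    · exact hab (hbranch u a b ha hb h.1 har hbr)
  have hadj : p.1.graph.Adj p.1.root (f 0) := by
    refine (hH.leaf _ (hf 0).1 hfr.symm).resolve_left ?_
    rintro ⟨a, b, hab, har, hbr, ha, hb⟩
    exact hab (hbranch _ a b ha hb hfr.symm har hbr)
  have hedge : ∀ e : p.1.graph.edgeSet, e = ⟨s(p.1.root, f 0), hadj⟩ := by
    rintro ⟨e, he⟩
    refine Subtype.ext ?_
    induction e with | _ x y
    have h1 := hverts x (p.1.graph.edge_vert he)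
    have h2 := hverts y (SimpleGraph.Subgraph.Adj.snd_mem he)
    have h3 := SimpleGraph.Subgraph.Adj.ne he
    simp only [Sym2.eq_iff]
    grind
  have hG : G.graph = p.2 ⟨s(p.1.root, f 0), hadj⟩ := by
    refine SimpleGraph.Subgraph.ext ?_ ?_
    · rw [hs.verts]
      refine Set.Subset.antisymm (Set.union_subset (fun u hu => ?_) (Set.iUnion_subset fun e => ?_))
        fun u hu => .inr (Set.mem_iUnion.2 ⟨_, hu⟩)
      · refine Set.inter_subset_left ((hp.1 _ _ hadj).2.symm ▸ ?_ : u ∈ _ ∩ p.1.graph.verts)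
        exact hverts u hu
      · rw [hedge e]
    · ext a b
      rw [hs.adj]
      exact ⟨fun ⟨e, he⟩ => hedge e ▸ he, fun h => ⟨_, h⟩⟩
  refine ⟨f 0, ?_, ?_, fun u hu => ?_⟩
  · rw [hs.root, hG]
    exact (hp.1 _ _ hadj).1
  · rw [hs.col]
    exact (hf 0).2
  · rw [hs.col]
    exact Finset.not_nonempty_iff_eq_empty.1 fun hne => hu (hcv u hne)

end OneColour

end SPBlocks

/-! ### The theorem -/

open SPBlocks
theorem theorem4 (V : Type*) :
    (∀ k : ℕ, 2 ≤ k →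
      blocks k V = substituted k V IsSPNetwork ∧
      (∀ p ∈ apexTreeFamilies k V IsSPNetwork, ∃! G : ColGraph k V, IsSubstitution p G) ∧
      ∀ G ∈ blocks k V, ∃! p, p ∈ apexTreeFamilies k V IsSPNetwork ∧ IsSubstitution p G) ∧
    (blocks 1 V = substituted 1 V IsParallelOrEdge ∧
      (∀ p ∈ apexTreeFamilies 1 V IsParallelOrEdge, ∃! G : ColGraph 1 V, IsSubstitution p G) ∧
      (∀ G ∈ blocks 1 V, ∃! p, p ∈ apexTreeFamilies 1 V IsParallelOrEdge ∧ IsSubstitution p G) ∧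
      ∀ G : ColGraph 1 V, G ∈ blocks 1 V ↔ ∃! v, IsVertexTimes IsParallelOrEdge G v) := by
  -- Uniqueness holds for arbitrary SP-networks and every `k`, so the case of one colour needs no
  -- separate argument for it.
  have hsub : apexTreeFamilies 1 V IsParallelOrEdge ⊆ apexTreeFamilies 1 V IsSPNetwork :=
    apexTreeFamilies_mono fun _ _ _ h => h.isSPNetwork
  refine ⟨fun k hk => ⟨?_, fun p hp => existsUnique_isSubstitution hp.2, fun G hG => ?_⟩, ?_,
    fun p hp => existsUnique_isSubstitution (hsub hp).2, fun G hG => ?_, fun G => ⟨fun hG => ?_, ?_⟩⟩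
  · refine Set.Subset.antisymm (fun G hG => exists_family hk hG) ?_
    exact fun G ⟨p, hp, hs⟩ => mem_blocks_of_isSubstitution hk hp hs
  · obtain ⟨p, hp, hs⟩ := exists_family hk hG
    exact ⟨p, ⟨hp, hs⟩, fun p' hp' => apexTreeFamilies_unique hp'.1 hp hp'.2 hs⟩
  · refine Set.Subset.antisymm (fun G hG => ?_) fun G ⟨p, hp, hs⟩ => ?_
    · obtain ⟨v, hv⟩ := exists_isVertexTimes_of_mem_blocks hG
      exact hv.exists_family
    · obtain ⟨v, hv⟩ := exists_isVertexTimes_of_isSubstitution hp hs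
      exact hv.mem_blocks
  · obtain ⟨v, hv⟩ := exists_isVertexTimes_of_mem_blocks hG
    obtain ⟨p, hp, hs⟩ := hv.exists_family
    exact ⟨p, ⟨hp, hs⟩, fun p' hp' => apexTreeFamilies_unique (hsub hp'.1) (hsub hp) hp'.2 hs⟩
  · obtain ⟨v, hv⟩ := exists_isVertexTimes_of_mem_blocks hG
    exact ⟨v, hv, fun w hw => IsVertexTimes.unique hw hv⟩
  · exact fun h => h.exists.choose_spec.mem_blocks
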